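/- Let $J$ be a germ at a point $p\in\mathbb{R}^3$ of a smooth $(1,1)$-tensor field (operator field), and let $$N_J(X,Y)=[JX,JY]-J\big([JX,Y]+[X,JY]-J[X,Y]\big)$$ be its Nijenhuis tensor. Call $J$ a \emph{Nijenhuis operator} if $N_J=0$ near $p$. Call $J$ \emph{stable} if the type of its (complex) Jordan normal form, i.e. the number of distinct eigenvalues together with the sizes of the Jordan blocks belonging to each of them (hence also the multiplicities of the eigenvalues), does not change in a neighbourhood of $p$. Call $J$ \emph{non-degenerate} if, at each point near $p$, different Jordan blocks have different eigenvalues. \textbf{Theorem.} $J$ is a stable, non-degenerate Nijenhuis operator if and only if in some smooth local coordinate system $(x_1,x_2,x_3)$ around $p$ it has one of the following four forms (the $j$-th column of the matrix holds the components of $J\partial_{x_j}$): \begin{itemize} \item[(A)] (real semi-simple case) $J=\begin{pmatrix}\lambda_1(x_1)&0&0\\0&\lambda_2(x_2)&0\\0&0&\lambda_3(x_3)\end{pmatrix}$; \item[(B)] ($2\times2$ and $1\times1$ Jordan blocks) $J=\begin{pmatrix}\lambda_2(x_2)&1&0\\0&\lambda_2(x_2)&0\\0&0&\lambda_3(x_3)\end{pmatrix}$;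 \item[(C)] ($3\times3$ Jordan block) $J=\begin{pmatrix}\lambda_3(x_3)&e^{\lambda_3'(x_3)x_2}&0\\0&\lambda_3(x_3)&1\\0&0&\lambda_3(x_3)\end{pmatrix}$; \item[(D)] (complex semi-simple case) $J=\begin{pmatrix}a(x_1,x_2)&-b(x_1,x_2)&0\\b(x_1,x_2)&a(x_1,x_2)&0\\0&0&\lambda_3(x_3)\end{pmatrix}$. \end{itemize} Here the $\lambda_i$ are arbitrary smooth real functions of one variable such that, in each of the cases (A) and (B), $\lambda_i(x_i)\neq\lambda_j(x_j)$ for $i\neq j$ everywhere on the coordinate domain, and in case (D) $a(x_1,x_2)+i\,b(x_1,x_2)$ is an arbitrary holomorphic function of $z=x_1+i\,x_2$ with $b$ nowhere zero. -/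

import Mathlib

open Filter Topology
open scoped ContDiff Matrix

namespace NijenhuisGerm

/-- The space `ℝ³`; smoothness does not depend on the choice of norm. -/
abbrev E3 : Type := Fin 3 → ℝ

/-- An operator field ((1,1)-tensor field) on `ℝ³`: the value at `x` is an endomorphism of the
tangent space at `x`. Only its germ at a point is used below. -/
abbrev OperatorField : Type := E3 → (E3 →L[ℝ] E3)

/-- The germ of `J` at `p` is smooth. -/
def SmoothAt (J : OperatorField) (p : E3) : Prop :=
  ∀ᶠ x in 𝓝 p, ContDiffAt ℝ ∞ J x

/-- The Nijenhuis tensor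
`N_J(X, Y) = [JX, JY] - J ([JX, Y] + [X, JY] - J [X, Y])` at the point `x`. -/
noncomputable def nijenhuisTensor (J : OperatorField) (X Y : E3 → E3) (x : E3) : E3 :=
  VectorField.lieBracket ℝ (fun y => J y (X y)) (fun y => J y (Y y)) x
    - J x (VectorField.lieBracket ℝ (fun y => J y (X y)) Y x
        + VectorField.lieBracket ℝ X (fun y => J y (Y y)) x
        - J x (VectorField.lieBracket ℝ X Y x))

/-- The germ of `J` at `p` is a Nijenhuis operator: `N_J` vanishes near `p`. -/
def IsNijenhuisAt (J : OperatorField) (p : E3) : Prop :=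
  ∀ᶠ x in 𝓝 p, ∀ X Y : E3 → E3, ContDiff ℝ ∞ X → ContDiff ℝ ∞ Y →
    nijenhuisTensor J X Y x = 0

/-- The complexification of an endomorphism of `ℝ³`. -/
noncomputable def complexify (A : E3 →L[ℝ] E3) : (Fin 3 → ℂ) →ₗ[ℂ] (Fin 3 → ℂ) :=
  Matrix.toLin' ((LinearMap.toMatrix' (A : E3 →ₗ[ℝ] E3)).map (algebraMap ℝ ℂ))

/-- `dim ker (A - μ)^k` over `ℂ`. For fixed `μ` these numbers determine, and are determined by,
the sizes of the Jordan blocks of `A` with eigenvalue `μ`; they all vanish iff `μ` is not an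
eigenvalue, and `k = 1` gives the number of Jordan blocks with eigenvalue `μ`. -/
noncomputable def kerDim (A : E3 →L[ℝ] E3) (μ : ℂ) (k : ℕ) : ℕ :=
  Module.finrank ℂ (LinearMap.ker ((complexify A - μ • LinearMap.id) ^ k))

/-- `A` and `B` have the same Jordan normal form up to the values of the (distinct) eigenvalues:
there is a bijective correspondence of eigenvalues that preserves the sizes of the Jordan blocks
(hence also the multiplicities). -/
def SameJordanType (A B : E3 →L[ℝ] E3) : Prop :=
  ∃ σ : ℂ ≃ ℂ, ∀ (μ : ℂ) (k : ℕ), kerDim A μ k = kerDim B (σ μ) k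

/-- The germ of `J` at `p` is stable: the type of the Jordan normal form and the multiplicities
of the eigenvalues do not change in a neighbourhood of `p`. -/
def IsStableAt (J : OperatorField) (p : E3) : Prop :=
  ∀ᶠ x in 𝓝 p, SameJordanType (J p) (J x)

/-- The germ of `J` at `p` is non-degenerate: different Jordan blocks have different eigenvalues,
that is, each complex number is the eigenvalue of at most one Jordan block. -/
def IsNondegenerateAt (J : OperatorField) (p : E3) : Prop :=
  ∀ᶠ x in 𝓝 p, ∀ μ : ℂ, kerDim (J x) μ 1 ≤ 1

/-- `φ` is a smooth local coordinate system around `p`. -/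
structure IsSmoothChartAt (φ : OpenPartialHomeomorph E3 E3) (p : E3) : Prop where
  mem_source : p ∈ φ.source
  contDiffOn : ContDiffOn ℝ ∞ φ φ.source
  contDiffOn_symm : ContDiffOn ℝ ∞ φ.symm φ.target

/-- In the coordinates `φ`, the operator field `J` has the matrix `M`, whose `j`-th column holds
the components of `J ∂_j`. -/
def HasMatrixIn (J : OperatorField) (φ : OpenPartialHomeomorph E3 E3)
    (M : E3 → Matrix (Fin 3) (Fin 3) ℝ) : Prop :=
  ∀ x ∈ φ.source, ∀ v : E3, fderiv ℝ φ x (J x v) = M (φ x) *ᵥ (fderiv ℝ φ x v)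

/-- The set of values of the `i`-th coordinate function of `φ`. -/
def coordRange (φ : OpenPartialHomeomorph E3 E3) (i : Fin 3) : Set ℝ :=
  (fun y : E3 => y i) '' φ.target

/-- The complex coordinate `z = x₁ + i x₂` (the coordinates are numbered from `0`). -/
def zCoord (y : E3) : ℂ := ⟨y 0, y 1⟩

/-- Real semi-simple form. -/
def HasFormA (J : OperatorField) (p : E3) : Prop :=
  ∃ (φ : OpenPartialHomeomorph E3 E3) (l₁ l₂ l₃ : ℝ → ℝ),
    IsSmoothChartAt φ p ∧
    ContDiffOn ℝ ∞ l₁ (coordRange φ 0) ∧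
    ContDiffOn ℝ ∞ l₂ (coordRange φ 1) ∧
    ContDiffOn ℝ ∞ l₃ (coordRange φ 2) ∧
    (∀ y ∈ φ.target, l₁ (y 0) ≠ l₂ (y 1) ∧ l₁ (y 0) ≠ l₃ (y 2) ∧ l₂ (y 1) ≠ l₃ (y 2)) ∧
    HasMatrixIn J φ (fun y =>
      !![l₁ (y 0), 0, 0;
         0, l₂ (y 1), 0;
         0, 0, l₃ (y 2)])

/-- One `2 × 2` and one `1 × 1` Jordan block. -/
def HasFormB (J : OperatorField) (p : E3) : Prop :=
  ∃ (φ : OpenPartialHomeomorph E3 E3) (l₂ l₃ : ℝ → ℝ),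
    IsSmoothChartAt φ p ∧
    ContDiffOn ℝ ∞ l₂ (coordRange φ 1) ∧
    ContDiffOn ℝ ∞ l₃ (coordRange φ 2) ∧
    (∀ y ∈ φ.target, l₂ (y 1) ≠ l₃ (y 2)) ∧
    HasMatrixIn J φ (fun y =>
      !![l₂ (y 1), 1, 0;
         0, l₂ (y 1), 0;
         0, 0, l₃ (y 2)])

/-- One `3 × 3` Jordan block. -/
def HasFormC (J : OperatorField) (p : E3) : Prop :=
  ∃ (φ : OpenPartialHomeomorph E3 E3) (l₃ : ℝ → ℝ),
    IsSmoothChartAt φ p ∧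
    ContDiffOn ℝ ∞ l₃ (coordRange φ 2) ∧
    HasMatrixIn J φ (fun y =>
      !![l₃ (y 2), Real.exp (deriv l₃ (y 2) * y 1), 0;
         0, l₃ (y 2), 1;
         0, 0, l₃ (y 2)])

/-- Complex semi-simple form: `a + i b` is a holomorphic function of `z = x₁ + i x₂`, with
`b ≠ 0`, so that the eigenvalues `a ± i b` are not real. -/
def HasFormD (J : OperatorField) (p : E3) : Prop :=
  ∃ (φ : OpenPartialHomeomorph E3 E3) (Z : ℂ → ℂ) (l₃ : ℝ → ℝ),
    IsSmoothChartAt φ p ∧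
    DifferentiableOn ℂ Z (zCoord '' φ.target) ∧
    ContDiffOn ℝ ∞ l₃ (coordRange φ 2) ∧
    (∀ y ∈ φ.target, (Z (zCoord y)).im ≠ 0) ∧
    HasMatrixIn J φ (fun y =>
      !![(Z (zCoord y)).re, -(Z (zCoord y)).im, 0;
         (Z (zCoord y)).im, (Z (zCoord y)).re, 0;
         0, 0, l₃ (y 2)])

end NijenhuisGerm

/-! Let `l` be a real eigenvalue with one Jordan block and let `α` generate the annihilator of `im
(J - l)`, so that `α ∘ J = l α`. Contracting `N_J = 0` with `α` gives `dα((J-l)u, (J-l)v) = ((dl ∘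
(J-l)) ∧ α)(u, v)` (`CorankOneData.extd_α`). Once `J^* dl = l dl` is known, `dα` vanishes on `im
(J-l) = ker α`. By Frobenius, `α` is then proportional to some `dz`; and `l`, whose differential
also kills `im (J-l)`, is a function of `z` (`CorankOneData.exists_coordinate`). For a simple
eigenvalue `J^* dl = l dl` follows by inserting the eigenvector for `v`. For a multiple one it comes
from `J^* d(tr J) = d(tr J²)/2` (`fderiv_trace_sq`): stability keeps the multiplicity constant, so
both traces are polynomials in smooth eigenvalues.

Three simple real eigenvalues thus give the coordinates of (A). For a larger block the missing
coordinates solve `dX ∘ (J - l) = θ` (`CorankOneData.exists_primitive`). A pointwise solution `γ`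
exists if `θ` kills the eigenvector; `N_J = 0` together with a compatibility condition on `dθ` makes
`γ` closed along the leaves of `z`, and a Poincaré lemma with parameters supplies `X`. In (B) `θ =
dz`. In (C) one solves `dY ∘ (J - l) = dz` and `dX ∘ (J - l) = e^{λ'(z) Y} dY`; the exponential is
the factor that makes the second equation compatible.

In (D) the operator descends to the two-dimensional quotient by the real eigendirection
(`exists_quotient`). There isothermal coordinates (`exists_isothermal`) turn it into multiplication
by a complex function, which `N_J = 0` forces to be holomorphic. Isothermal coordinates come from
the Beltrami equation `w_z̄ = μ w_z`, solved by a Neumann series in `L¹` on the Fourier side: there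
the Beurling transform is multiplication by `conj ξ / ξ`, of modulus at most one, and rescaling
makes `μ` small.

The analytic tools are the Frobenius theorem and the leafwise Poincaré lemma. In both, smooth
dependence on parameters follows because superposition is smooth on the Banach space of continuous
functions on `[0,1]`.

Conversely, `N_J` is natural (`fderiv_nij`), so it may be computed in the coordinates. Up to a
conjugation in (C), the matrix minus an eigenvalue is an invertible matrix times a commuting
constant one, so the Jordan data do not vary. -/

namespace NijenhuisGerm

/-! ### Smooth germs: inverse and implicit functions, straightening, factorisation. -/

section Germs

variable {E F G : Type*} [NormedAddCommGroup E] [NormedSpace ℝ E] [NormedAddCommGroup F]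
  [NormedSpace ℝ F] [NormedAddCommGroup G] [NormedSpace ℝ G]

/-- The germ of `f` at `p` is smooth. -/
def SmoothNear (f : E → F) (p : E) : Prop := ∀ᶠ x in 𝓝 p, ContDiffAt ℝ ∞ f x

theorem SmoothNear.contDiffAt {f : E → F} {p : E} (h : SmoothNear f p) : ContDiffAt ℝ ∞ f p :=
  Eventually.self_of_nhds h

theorem SmoothNear.continuousAt {f : E → F} {p : E} (h : SmoothNear f p) : ContinuousAt f p :=
  h.contDiffAt.continuousAt

theorem _root_.ContDiffAt.fderiv_infty {f : E → F} {x : E} (h : ContDiffAt ℝ ∞ f x) :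
    ContDiffAt ℝ ∞ (fderiv ℝ f) x :=
  h.fderiv_right (m := ∞) (by simp)

theorem _root_.ContDiffAt.diffAt {f : E → F} {x : E} (h : ContDiffAt ℝ ∞ f x) :
    DifferentiableAt ℝ f x :=
  h.differentiableAt (by simp)

theorem _root_.ContDiffAt.fderiv_fderiv_comm {f : E → F} {x : E} (h : ContDiffAt ℝ ∞ f x)
    (u v : E) : fderiv ℝ (fderiv ℝ f) x u v = fderiv ℝ (fderiv ℝ f) x v u := by
  refine (h.isSymmSndFDerivAt ?_).eq u v
  rw [minSmoothness_of_isRCLikeNormedField]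
  exact WithTop.coe_le_coe.2 (le_top (a := (2 : ℕ∞)))

theorem SmoothNear.differential {f : E → F} {p : E} (h : SmoothNear f p) :
    SmoothNear (fderiv ℝ f) p := by
  filter_upwards [h] with x hx using hx.fderiv_infty

theorem SmoothNear.comp {f : E → F} {g : F → G} {p : E} (hg : SmoothNear g (f p))
    (hf : SmoothNear f p) : SmoothNear (fun x => g (f x)) p := by
  filter_upwards [hf, hf.continuousAt.eventually hg] with x h1 h2 using h2.comp x h1

theorem _root_.ContDiff.smoothNear {f : E → F} (h : ContDiff ℝ ∞ f) (p : E) : SmoothNear f p :=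
  Eventually.of_forall fun _ => h.contDiffAt

theorem SmoothNear.clm_comp {f : E → F} {p : E} (L : F →L[ℝ] G) (h : SmoothNear f p) :
    SmoothNear (fun x => L (f x)) p := by
  filter_upwards [h] with x hx using L.contDiff.contDiffAt.comp x hx

/-- Every smooth germ on a finite-dimensional space extends to a global smooth function. -/
theorem SmoothNear.exists_contDiff [FiniteDimensional ℝ E] {f : E → F} {p : E}
    (h : SmoothNear f p) : ∃ g : E → F, ContDiff ℝ ∞ g ∧ g =ᶠ[𝓝 p] f := by
  obtain ⟨ε, hε, hb⟩ := Metric.eventually_nhds_iff_ball.1 h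
  let χ : ContDiffBump p := ⟨ε / 4, ε / 2, by positivity, by linarith⟩
  refine ⟨fun x => χ x • f x, contDiff_iff_contDiffAt.2 fun x => ?_, ?_⟩
  · by_cases hx : x ∈ Metric.ball p ε
    · exact χ.contDiff.contDiffAt.smul (hb x hx)
    · have hx' : x ∉ tsupport χ := by
        rw [χ.tsupport_eq]
        intro h'
        have h2 : dist x p ≤ ε / 2 := h'
        have h3 : ¬ dist x p < ε := hx
        linarith
      have : (fun x => χ x • f x) =ᶠ[𝓝 x] fun _ => 0 := by
        filter_upwards [notMem_tsupport_iff_eventuallyEq.1 hx'] with y hy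
        simp [hy]
      exact contDiffAt_const.congr_of_eventuallyEq this
  · filter_upwards [χ.eventuallyEq_one] with x hx
    simp [hx]

/-- The inverse function theorem for smooth germs, with a ball as target. -/
theorem SmoothNear.exists_chart [CompleteSpace E] {f : E → F} {p : E} (h : SmoothNear f p)
    {A : E ≃L[ℝ] F} (hA : fderiv ℝ f p = A) {P : E → Prop} (hP : ∀ᶠ x in 𝓝 p, P x) :
    ∃ (φ : OpenPartialHomeomorph E F) (r : ℝ), 0 < r ∧ p ∈ φ.source ∧
      φ.target = Metric.ball (f p) r ∧ (∀ x, φ x = f x) ∧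
      (∀ x ∈ φ.source, P x ∧ ContDiffAt ℝ ∞ f x) ∧ (∀ y ∈ φ.target, ContDiffAt ℝ ∞ φ.symm y) := by
  have hd : HasFDerivAt f (A : E →L[ℝ] F) p := hA ▸ h.contDiffAt.diffAt.hasFDerivAt
  let e := h.contDiffAt.toOpenPartialHomeomorph f hd (by simp)
  have he : ∀ x, e x = f x := fun x => rfl
  have hpe : p ∈ e.source := h.contDiffAt.mem_toOpenPartialHomeomorph_source hd (by simp)
  -- Invertibility of the differential is kept on the whole source, so that the inverse chart is
  -- smooth at every point of the target.
  have hinv : ∀ᶠ x in 𝓝 p, fderiv ℝ f x ∈ Set.range ((↑) : (E ≃L[ℝ] F) → E →L[ℝ] F) := by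
    refine h.differential.continuousAt.eventually ?_
    rw [hA]
    exact ContinuousLinearEquiv.nhds A
  obtain ⟨V, hV, hVo, hpV⟩ := eventually_nhds_iff.1 ((hP.and h).and hinv)
  let e₁ := e.restrOpen V hVo
  have hfp : f p ∈ e₁.target := by
    have : p ∈ e₁.source := ⟨hpe, hpV⟩
    exact e₁.map_source this
  obtain ⟨r, hr, hball⟩ := Metric.isOpen_iff.1 e₁.open_target _ hfp
  -- Cutting the inverse down to a ball makes the target convex, as the mean value argument in
  -- `SmoothNear.exists_factor` needs.
  let e₂ := (e₁.symm.restrOpen (Metric.ball (f p) r) Metric.isOpen_ball).symm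
  have ht : e₂.target = Metric.ball (f p) r := by
    ext y
    exact ⟨fun hy => hy.2, fun hy => ⟨hball hy, hy⟩⟩
  have hsub : ∀ x ∈ e₂.source, x ∈ V := by
    intro x hx
    have h1 : x ∈ e₁.symm.target := by
      have : e₂.symm (e₂ x) = x := e₂.left_inv hx
      rw [← this]
      have h2 : e₂ x ∈ e₂.target := e₂.map_source hx
      exact e₁.symm.map_source (hball (ht ▸ h2))
    exact h1.2
  refine ⟨e₂, r, hr, ?_, ht, fun x => rfl, fun x hx => (hV x (hsub x hx)).1, fun y hy => ?_⟩
  · have h1 : e₂.symm (f p) = p := by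
      have : p ∈ e₁.source := ⟨hpe, hpV⟩
      exact e₁.left_inv this
    rw [← h1]
    exact e₂.map_target (ht ▸ Metric.mem_ball_self hr)
  · obtain ⟨⟨-, h2⟩, B, hB⟩ := hV _ (hsub _ (e₂.map_target hy))
    refine e₂.contDiffAt_symm (f₀' := B) hy ?_ h2
    rw [hB]
    exact h2.diffAt.hasFDerivAt

theorem fderiv_comp_symm {f : E → F} {φ : OpenPartialHomeomorph E F} (hf : ∀ x, φ x = f x)
    {y : F} (hy : y ∈ φ.target) (h1 : ContDiffAt ℝ ∞ f (φ.symm y))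
    (h2 : ContDiffAt ℝ ∞ φ.symm y) (v : F) :
    fderiv ℝ f (φ.symm y) (fderiv ℝ φ.symm y v) = v := by
  have h3 : (fun z => f (φ.symm z)) =ᶠ[𝓝 y] id := by
    filter_upwards [φ.open_target.mem_nhds hy] with z hz
    rw [← hf, φ.right_inv hz, id]
  have h4 := h3.fderiv_eq (𝕜 := ℝ)
  have h5 : fderiv ℝ (fun z => f (φ.symm z)) y
      = (fderiv ℝ f (φ.symm y)).comp (fderiv ℝ φ.symm y) :=
    fderiv_comp y h1.diffAt h2.diffAt
  rw [h5, fderiv_id] at h4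
  exact DFunLike.congr_fun h4 v

theorem fderiv_symm_comp {f : E → F} {φ : OpenPartialHomeomorph E F} (hf : ∀ x, φ x = f x)
    {x : E} (hx : x ∈ φ.source) (h1 : ContDiffAt ℝ ∞ f x)
    (h2 : ContDiffAt ℝ ∞ φ.symm (φ x)) (v : E) :
    fderiv ℝ φ.symm (φ x) (fderiv ℝ f x v) = v := by
  have h3 : (fun z => φ.symm (f z)) =ᶠ[𝓝 x] id := by
    filter_upwards [φ.open_source.mem_nhds hx] with z hz
    rw [← hf, φ.left_inv hz, id]
  have h4 := h3.fderiv_eq (𝕜 := ℝ)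
  rw [hf] at h2 ⊢
  have h5 : fderiv ℝ (fun z => φ.symm (f z)) x
      = (fderiv ℝ φ.symm (f x)).comp (fderiv ℝ f x) :=
    fderiv_comp x h2.diffAt h1.diffAt
  rw [h5, fderiv_id] at h4
  exact DFunLike.congr_fun h4 v

theorem SmoothNear.exists_inverse [CompleteSpace F] {H : E → F →L[ℝ] G} {p : E}
    (h : SmoothNear H p) {A : F ≃L[ℝ] G} (hA : H p = A) :
    ∃ M : E → G →L[ℝ] F, SmoothNear M p ∧ M p = A.symm ∧
      ∀ᶠ x in 𝓝 p, (∀ v, M x (H x v) = v) ∧ ∀ v, H x (M x v) = v := by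
  have hinv : ∀ᶠ x in 𝓝 p, H x ∈ Set.range ((↑) : (F ≃L[ℝ] G) → F →L[ℝ] G) := by
    refine h.continuousAt.eventually ?_
    rw [hA]
    exact ContinuousLinearEquiv.nhds A
  refine ⟨fun x => (H x).inverse, ?_, by simp [hA], ?_⟩
  · filter_upwards [h, hinv] with x hx ⟨B, hB⟩
    refine ContDiffAt.comp x (g := ContinuousLinearMap.inverse) ?_ hx
    rw [← hB]
    exact contDiffAt_map_inverse B
  · filter_upwards [hinv] with x ⟨B, hB⟩
    simp [← hB]

/-- The implicit function theorem for smooth germs. -/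
theorem SmoothNear.exists_implicit [CompleteSpace E] [CompleteSpace F] {f : E × F → G} {a : E}
    {b : F} (h : SmoothNear f (a, b)) {C : F ≃L[ℝ] G}
    (hC : ∀ v, fderiv ℝ f (a, b) (0, v) = C v) :
    ∃ ψ : E → F, SmoothNear ψ a ∧ ψ a = b ∧ ∀ᶠ x in 𝓝 a, f (x, ψ x) = f (a, b) := by
  let g : E × F → E × G := fun x => (x.1, f x)
  have hg : SmoothNear g (a, b) := by
    filter_upwards [h] with x hx
    fun_prop
  let A : (E × F) ≃L[ℝ] (E × G) := (ContinuousLinearEquiv.refl ℝ E).skewProd C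
    ((fderiv ℝ f (a, b)).comp (ContinuousLinearMap.inl ℝ E F))
  have hA : fderiv ℝ g (a, b) = A := by
    have h1 : HasFDerivAt g ((ContinuousLinearMap.fst ℝ E F).prod (fderiv ℝ f (a, b))) (a, b) :=
      hasFDerivAt_fst.prodMk h.contDiffAt.diffAt.hasFDerivAt
    rw [h1.fderiv]
    ext v
    · simp [A]
    · simp [A]
    · simp [A]
    · simp [A, hC]
  obtain ⟨φ, r, hr, hp, ht, he, h1, h2⟩ := hg.exists_chart hA (P := fun _ => True) (by simp)
  have hmem : ∀ᶠ x in 𝓝 a, (x, f (a, b)) ∈ φ.target := by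
    have : ContinuousAt (fun x : E => (x, f (a, b))) a := by fun_prop
    refine this.eventually (φ.open_target.mem_nhds ?_)
    rw [ht]
    exact Metric.mem_ball_self hr
  have hsymm : ∀ x, (x, f (a, b)) ∈ φ.target →
      (φ.symm (x, f (a, b))).1 = x ∧ f (φ.symm (x, f (a, b))) = f (a, b) := fun x hx => by
    have h3 := φ.right_inv hx
    rw [he] at h3
    exact ⟨congrArg Prod.fst h3, congrArg Prod.snd h3⟩
  refine ⟨fun x => (φ.symm (x, f (a, b))).2, ?_, ?_, ?_⟩
  · filter_upwards [hmem] with x hx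
    exact contDiffAt_snd.comp x ((h2 _ hx).comp x (by fun_prop))
  · have : φ.symm (a, f (a, b)) = (a, b) := by
      have h4 := φ.left_inv hp
      rwa [he] at h4
    simp [this]
  · filter_upwards [hmem] with x hx
    obtain ⟨h3, h4⟩ := hsymm x hx
    refine Eq.trans ?_ h4
    congr 1
    exact Prod.ext h3.symm rfl

/-- A submersion germ `w` is linearised by a chart with target a ball around `0`. -/
theorem SmoothNear.exists_straightening [CompleteSpace E] {w : E → G} {p : E}
    (hw : SmoothNear w p) {R : G →L[ℝ] E} (hR : ∀ v, fderiv ℝ w p (R v) = v) {P : E → Prop}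
    (hP : ∀ᶠ x in 𝓝 p, P x) :
    ∃ (φ : OpenPartialHomeomorph E E) (f : E → E) (r : ℝ), 0 < r ∧ p ∈ φ.source ∧ f p = 0 ∧
      φ.target = Metric.ball 0 r ∧ (∀ x, φ x = f x) ∧
      (∀ x ∈ φ.source, P x ∧ ContDiffAt ℝ ∞ f x) ∧ (∀ y ∈ φ.target, ContDiffAt ℝ ∞ φ.symm y) ∧
      (∀ x, fderiv ℝ w p (f x) = w x - w p) := by
  set L := fderiv ℝ w p
  -- The identity with its component along the range of `R` replaced by `w`: the differential at `p`
  -- is the identity, and `L ∘ f = w - w p`.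
  let f : E → E := fun x => (x - p) - R (L (x - p)) + R (w x - w p)
  have hf : SmoothNear f p := by
    filter_upwards [hw] with x hx
    fun_prop
  have hfp : f p = 0 := by simp [f]
  have hd : fderiv ℝ f p = (ContinuousLinearEquiv.refl ℝ E : E →L[ℝ] E) := by
    have h1 : HasFDerivAt w L p := hw.contDiffAt.diffAt.hasFDerivAt
    have h2 : HasFDerivAt f ((ContinuousLinearMap.id ℝ E - R.comp (L.comp (.id ℝ E)))
        + R.comp L) p := by
      have h0 : HasFDerivAt (fun x : E => x - p) (ContinuousLinearMap.id ℝ E) p :=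
        (hasFDerivAt_id p).sub_const p
      exact (h0.sub (R.hasFDerivAt.comp p (L.hasFDerivAt.comp p h0))).add
        (R.hasFDerivAt.comp p (h1.sub_const _))
    rw [h2.fderiv]
    ext v
    simp
  obtain ⟨φ, r, hr, hp, ht, he, h1, h2⟩ := hf.exists_chart hd hP
  refine ⟨φ, f, r, hr, hp, hfp, by rw [ht, hfp], he, h1, h2, fun x => ?_⟩
  simp only [f, map_add, map_sub, hR]
  abel

/-- Only the derivative in the single direction `b - a` matters: the restriction to the segment is
constant. -/
theorem eq_of_fderiv_sub_eq_zero {f : E → F} {s : Set E} (hs : Convex ℝ s)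
    (hd : ∀ y ∈ s, DifferentiableAt ℝ f y) {a b : E} (ha : a ∈ s) (hb : b ∈ s)
    (h : ∀ y ∈ s, fderiv ℝ f y (b - a) = 0) : f a = f b := by
  have hmem : ∀ t ∈ Set.Icc (0 : ℝ) 1, a + t • (b - a) ∈ s := fun t ht =>
    hs.add_smul_sub_mem ha hb ht
  have hder : ∀ t ∈ Set.Icc (0 : ℝ) 1, HasDerivAt (fun t : ℝ => f (a + t • (b - a))) 0 t := by
    intro t ht
    have h1 : HasDerivAt (fun t : ℝ => a + t • (b - a)) (b - a) t := by
      simpa using ((hasDerivAt_id t).smul_const (b - a)).const_add a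
    have h2 := (hd _ (hmem t ht)).hasFDerivAt.comp_hasDerivAt t h1
    rwa [h _ (hmem t ht)] at h2
  have := constant_of_has_deriv_right_zero (f := fun t : ℝ => f (a + t • (b - a)))
    (a := 0) (b := 1) (fun t ht => (hder t ht).continuousAt.continuousWithinAt)
    (fun t ht => (hder t ⟨ht.1, ht.2.le⟩).hasDerivWithinAt) 1 (by simp)
  simpa using this.symm

/-- A smooth germ whose differential vanishes on the kernel of the differential of a submersion
germ `w` factors through `w`. -/
theorem SmoothNear.exists_factor [CompleteSpace E] {w : E → G} {f : E → F} {p : E}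
    (hw : SmoothNear w p) (hf : SmoothNear f p) {R : G →L[ℝ] E}
    (hR : ∀ v, fderiv ℝ w p (R v) = v)
    (hk : ∀ᶠ x in 𝓝 p, ∀ v, fderiv ℝ w x v = 0 → fderiv ℝ f x v = 0) :
    ∃ g : G → F, SmoothNear g (w p) ∧ ∀ᶠ x in 𝓝 p, f x = g (w x) := by
  obtain ⟨φ, Φ, r, hr, hp, hΦp, ht, he, h1, h2, hL⟩ :=
    hw.exists_straightening hR ((hf.and hw).and hk)
  set L := fderiv ℝ w p with hLdef
  have hφp : φ p = 0 := by rw [he, hΦp]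
  have h0t : (0 : E) ∈ φ.target := by rw [← hφp]; exact φ.map_source hp
  -- In the straightened chart the fibres of `w` are the slices parallel to `ker L`. The function
  -- `g` reads off `f` on the transversal slice given by the range of `R`.
  let g : G → F := fun ζ => f (φ.symm (R (ζ - w p)))
  have hψ0 : φ.symm 0 = p := by rw [← hφp, φ.left_inv hp]
  have hψ : SmoothNear (fun y => f (φ.symm y)) 0 := by
    filter_upwards [φ.open_target.mem_nhds h0t] with y hy
    exact (h1 _ (φ.map_target hy)).1.1.1.comp y (h2 y hy)
  refine ⟨g, ?_, ?_⟩
  · have h3 : SmoothNear (fun ζ => R (ζ - w p)) (w p) :=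
      ContDiff.smoothNear (by fun_prop) _
    have h4 : SmoothNear (fun y => f (φ.symm y)) (R (w p - w p)) := by simpa using hψ
    exact SmoothNear.comp (f := fun ζ => R (ζ - w p)) (g := fun y => f (φ.symm y)) h4 h3
  · have hev : ∀ᶠ x in 𝓝 p, R (w x - w p) ∈ φ.target := by
      have : ContinuousAt (fun x => R (w x - w p)) p :=
        R.continuous.continuousAt.comp (hw.continuousAt.sub continuousAt_const)
      refine this.eventually ?_
      simpa using φ.open_target.mem_nhds h0t
    filter_upwards [hev, φ.open_source.mem_nhds hp] with x hx hxs
    have hy : φ x ∈ φ.target := φ.map_source hxs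
    have hLy : L (φ x) = w x - w p := by rw [he]; exact hL x
    have key : f (φ.symm (φ x)) = f (φ.symm (R (w x - w p))) := by
      -- Both points lie in the same slice of the ball, and `f` has zero derivative along slices by
      -- `hk`.
      refine eq_of_fderiv_sub_eq_zero (f := fun t => f (φ.symm t)) (s := φ.target)
        (ht ▸ convex_ball (0 : E) r) (fun y hy => ?_) hy hx (fun y hy' => ?_)
      · exact (h1 _ (φ.map_target hy)).1.1.1.diffAt.comp y (h2 y hy).diffAt
      · obtain ⟨⟨⟨h3, h4⟩, h5⟩, h6⟩ := h1 _ (φ.map_target hy')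
        have e1 : fderiv ℝ (fun t => f (φ.symm t)) y
            = (fderiv ℝ f (φ.symm y)).comp (fderiv ℝ φ.symm y) :=
          fderiv_comp y h3.diffAt (h2 y hy').diffAt
        rw [e1, ContinuousLinearMap.comp_apply]
        refine h5 _ ?_
        have e2 := fderiv_comp_symm he hy' h6 (h2 y hy') (R (w x - w p) - φ x)
        have e3 : fderiv ℝ (fun x => L (Φ x)) (φ.symm y)
            = L.comp (fderiv ℝ Φ (φ.symm y)) :=
          (L.hasFDerivAt.comp _ h6.diffAt.hasFDerivAt).fderiv
        have e4 : (fun x => L (Φ x)) = fun x => w x - w p := funext hL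
        rw [e4, fderiv_sub_const] at e3
        rw [e3, ContinuousLinearMap.comp_apply, e2, map_sub, hR, hLy, sub_self]
    rw [φ.left_inv hxs] at key
    exact key

end Germs


/-! ### Smoothness of superposition operators on `C(K, E)`. -/

section Superposition

variable {K : Type} [TopologicalSpace K] [CompactSpace K]
  {E F : Type} [NormedAddCommGroup E] [NormedSpace ℝ E] [NormedAddCommGroup F]
  [NormedSpace ℝ F]

/-- The pointwise application of a field of operators to a field of vectors. -/
noncomputable def pointwiseApply (K E F : Type) [TopologicalSpace K] [CompactSpace K]
    [NormedAddCommGroup E] [NormedSpace ℝ E] [NormedAddCommGroup F] [NormedSpace ℝ F] :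
    C(K, E →L[ℝ] F) →L[ℝ] C(K, E) →L[ℝ] C(K, F) :=
  LinearMap.mkContinuous₂
    (LinearMap.mk₂ ℝ (fun (A : C(K, E →L[ℝ] F)) (u : C(K, E)) =>
        (⟨fun t => A t (u t), by fun_prop⟩ : C(K, F)))
      (fun A B u => by ext; simp) (fun c A u => by ext; simp)
      (fun A u v => by ext; simp) (fun c A u => by ext; simp)) 1 (by
    intro A u
    rw [one_mul]
    refine (ContinuousMap.norm_le _ (by positivity)).2 fun t => ?_
    exact ((A t).le_opNorm _).trans
      (mul_le_mul (A.norm_coe_le_norm t) (u.norm_coe_le_norm t) (norm_nonneg _) (norm_nonneg A)))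

@[simp] theorem pointwiseApply_apply (A : C(K, E →L[ℝ] F)) (u : C(K, E)) (t : K) :
    pointwiseApply K E F A u t = A t (u t) := rfl

/-- The derivative of `f` is uniformly continuous near the compact image of `u`, so the mean value
inequality bounds the remainder uniformly in `t`. -/
theorem hasFDerivAt_superposition {f : E → F} (hf : ContDiff ℝ 1 f) (u : C(K, E)) :
    HasFDerivAt (fun u : C(K, E) => (⟨f, hf.continuous⟩ : C(E, F)).comp u)
      (pointwiseApply K E F
        ((⟨fderiv ℝ f, hf.continuous_fderiv (by simp)⟩ : C(E, E →L[ℝ] F)).comp u)) u := by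
  rw [hasFDerivAt_iff_isLittleO_nhds_zero, Asymptotics.isLittleO_iff]
  intro ε hε
  have hc : IsCompact (Set.range u) := isCompact_range u.continuous
  have hcont : Continuous (fderiv ℝ f) := hf.continuous_fderiv (by simp)
  have hu := hc.uniformContinuousAt_of_continuousAt (fderiv ℝ f)
    (fun x _ => hcont.continuousAt) (Metric.dist_mem_uniformity hε)
  obtain ⟨δ, hδ, hδ'⟩ := Metric.mem_uniformity_dist.1 hu
  filter_upwards [Metric.ball_mem_nhds (0 : C(K, E)) hδ] with h hh
  have hh' : ‖h‖ < δ := by simpa using hh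
  refine (ContinuousMap.norm_le _ (by positivity)).2 fun t => ?_
  have hconv := (convex_ball (u t) δ).norm_image_sub_le_of_norm_fderiv_le'
    (𝕜 := ℝ) (f := f) (φ := fderiv ℝ f (u t)) (C := ε) (x := u t) (y := u t + h t)
    (fun x _ => (hf.differentiable (by simp)) x) (fun x hx => ?_) (Metric.mem_ball_self hδ) ?_
  · simp only [add_sub_cancel_left] at hconv
    refine hconv.trans ?_
    gcongr
    exact h.norm_coe_le_norm t
  · have := hδ' (a := u t) (b := x) (by rw [dist_comm]; exact hx) ⟨t, rfl⟩
    have h3 : dist (fderiv ℝ f (u t)) (fderiv ℝ f x) < ε := this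
    rw [dist_comm, dist_eq_norm] at h3
    exact h3.le
  · simpa using (h.norm_coe_le_norm t).trans_lt hh'

/-- Superposition with a smooth function is a smooth operation on continuous functions on a
compact space. -/
theorem contDiff_superposition {f : E → F} (hf : ContDiff ℝ ∞ f) :
    ContDiff ℝ ∞ (fun u : C(K, E) => (⟨f, hf.continuous⟩ : C(E, F)).comp u) := by
  -- The induction runs over all target spaces at once, since the derivative is governed by
  -- superposition with `fderiv ℝ f`, whose values lie in `E →L[ℝ] F`.
  have key : ∀ (n : ℕ) (F : Type) [NormedAddCommGroup F] [NormedSpace ℝ F] (f : E → F)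
      (hf : ContDiff ℝ ∞ f),
      ContDiff ℝ n (fun u : C(K, E) => (⟨f, hf.continuous⟩ : C(E, F)).comp u) := by
    intro n
    induction n with
    | zero =>
      intro F _ _ f hf
      exact contDiff_zero.2 (ContinuousMap.continuous_postcomp _)
    | succ n ih =>
      intro F _ _ f hf
      have hf1 : ContDiff ℝ 1 f := hf.of_le (by exact_mod_cast le_top)
      have hf' : ContDiff ℝ ∞ (fderiv ℝ f) := hf.fderiv_right (by simp)
      push_cast
      rw [contDiff_succ_iff_hasFDerivAt]
      exact ⟨fun u => pointwiseApply K E F _,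
        (pointwiseApply K E F).contDiff.comp (ih (E →L[ℝ] F) (fderiv ℝ f) hf'),
        fun u => hasFDerivAt_superposition hf1 u⟩
  exact contDiff_infty.2 fun n => key n F f hf

/-- Constant functions, as a continuous linear map. -/
noncomputable def constCLM (K E : Type) [TopologicalSpace K] [CompactSpace K]
    [NormedAddCommGroup E] [NormedSpace ℝ E] : E →L[ℝ] C(K, E) :=
  LinearMap.mkContinuous
    { toFun := fun v => ContinuousMap.const K v
      map_add' := fun _ _ => rfl
      map_smul' := fun _ _ => rfl } 1 (fun v => by
    rw [one_mul]
    exact (ContinuousMap.norm_le _ (norm_nonneg _)).2 fun t => le_rfl)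

@[simp] theorem constCLM_apply (v : E) (t : K) : constCLM K E v t = v := rfl

end Superposition

/-! ### Integration as an operator on `C([0,1], F)`. -/

section Primitive

variable {F : Type} [NormedAddCommGroup F]

/-- The extension of a function on the unit interval by constants. -/
noncomputable def extendUnit (g : C(unitInterval, F)) : ℝ → F :=
  fun s => g (Set.projIcc 0 1 zero_le_one s)

theorem continuous_extendUnit (g : C(unitInterval, F)) : Continuous (extendUnit g) :=
  g.continuous.comp continuous_projIcc

theorem extendUnit_coe (g : C(unitInterval, F)) (t : unitInterval) : extendUnit g t = g t := by
  simp [extendUnit]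

variable [NormedSpace ℝ F] [CompleteSpace F]

theorem hasDerivAt_integral_extendUnit (g : C(unitInterval, F)) (t : ℝ) :
    HasDerivAt (fun t => ∫ s in (0 : ℝ)..t, extendUnit g s) (extendUnit g t) t :=
  intervalIntegral.integral_hasDerivAt_right
    ((continuous_extendUnit g).intervalIntegrable _ _)
    ((continuous_extendUnit g).stronglyMeasurableAtFilter _ _)
    (continuous_extendUnit g).continuousAt

/-- The primitive of a continuous function on the unit interval that vanishes at `0`. -/
noncomputable def primitive (F : Type) [NormedAddCommGroup F] [NormedSpace ℝ F]
    [CompleteSpace F] : C(unitInterval, F) →L[ℝ] C(unitInterval, F) :=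
  LinearMap.mkContinuous
    { toFun := fun g => ⟨fun t => ∫ s in (0 : ℝ)..t, extendUnit g s, by
        have : Continuous fun t : ℝ => ∫ s in (0 : ℝ)..t, extendUnit g s :=
          continuous_iff_continuousAt.2 fun t =>
            (hasDerivAt_integral_extendUnit g t).continuousAt
        exact this.comp continuous_subtype_val⟩
      map_add' := fun g h => by
        ext t
        exact intervalIntegral.integral_add ((continuous_extendUnit g).intervalIntegrable _ _)
          ((continuous_extendUnit h).intervalIntegrable _ _)
      map_smul' := fun c g => by
        ext t
        exact intervalIntegral.integral_smul c _ } 1 (fun g => by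
    refine (ContinuousMap.norm_le _ (by positivity)).2 fun t => ?_
    have := intervalIntegral.norm_integral_le_of_norm_le_const (a := (0 : ℝ)) (b := t)
      (f := extendUnit g) (C := ‖g‖) (fun s _ => g.norm_coe_le_norm _)
    refine this.trans ?_
    rw [one_mul, sub_zero, abs_of_nonneg t.2.1]
    exact mul_le_of_le_one_right (norm_nonneg _) t.2.2)

end Primitive


/-! ### The Frobenius theorem for vector-valued one-forms. -/

section Frobenius

variable {E G : Type} [NormedAddCommGroup E] [NormedSpace ℝ E] [NormedAddCommGroup G]
  [NormedSpace ℝ G]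

/-- The ray `t ↦ t • v`, as a continuous linear map of `v`. -/
noncomputable def rayCLM (E : Type) [NormedAddCommGroup E] [NormedSpace ℝ E] :
    E →L[ℝ] C(unitInterval, E) :=
  LinearMap.mkContinuous
    { toFun := fun v => ⟨fun t => (t : ℝ) • v, by fun_prop⟩
      map_add' := fun _ _ => by ext; simp
      map_smul' := fun c v => by ext t; simp [smul_comm c] } 1 (fun v => by
    rw [one_mul]
    refine (ContinuousMap.norm_le _ (norm_nonneg _)).2 fun t => ?_
    have : ‖(t : ℝ) • v‖ ≤ ‖v‖ := by
      rw [norm_smul, Real.norm_of_nonneg t.2.1]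
      exact mul_le_of_le_one_left (norm_nonneg _) t.2.2
    exact this)

@[simp] theorem rayCLM_apply (v : E) (t : unitInterval) : rayCLM E v t = (t : ℝ) • v := rfl

variable [CompleteSpace E] [CompleteSpace G]

set_option maxHeartbeats 1000000 in
/-- If `A` restricts to an involutive distribution near `p`, then the integral curves of the
distribution over the rays of `ker (A p)` sweep out integral manifolds. -/
theorem exists_integral_manifolds {A : E → E →L[ℝ] G} (hA : ContDiff ℝ ∞ A) {R : G →L[ℝ] E}
    (hR : ∀ x v, A x (R v) = v) {p : E}
    (hinv : ∀ᶠ x in 𝓝 p, ∀ u v, A x u = 0 → A x v = 0 →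
      fderiv ℝ A x u v = fderiv ℝ A x v u) :
    ∃ Φ : E → E, SmoothNear Φ 0 ∧ Φ 0 = p ∧ fderiv ℝ Φ 0 = ContinuousLinearMap.id ℝ E ∧
      ∀ᶠ y in 𝓝 0, ∀ u, A p u = 0 → A (Φ y) (fderiv ℝ Φ y u) = 0 := by
  have hA1 : Differentiable ℝ A := hA.differentiable (by simp)
  have hA' : ContDiff ℝ ∞ (fderiv ℝ A) := hA.fderiv_right (by simp)
  set L := A p with hL
  let k : E →L[ℝ] E := ContinuousLinearMap.id ℝ E - R.comp L
  have hk : ∀ v, k v = v - R (L v) := fun v => rfl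
  have hLk : ∀ v, L (k v) = 0 := fun v => by rw [hk, map_sub, hL, hR, sub_self]
  let Rc : C(unitInterval, G) →L[ℝ] C(unitInterval, E) := R.compLeftContinuous ℝ unitInterval
  have hRc : ∀ g t, Rc g t = R (g t) := fun g t => rfl
  let S : C(unitInterval, E) → C(unitInterval, E →L[ℝ] G) :=
    fun u => (⟨A, hA.continuous⟩ : C(E, E →L[ℝ] G)).comp u
  let S' : C(unitInterval, E) → C(unitInterval, E →L[ℝ] E →L[ℝ] G) :=
    fun u => (⟨fderiv ℝ A, hA'.continuous⟩ : C(E, E →L[ℝ] E →L[ℝ] G)).comp u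
  have hS : ContDiff ℝ ∞ S := contDiff_superposition hA
  have hS' : ∀ u, HasFDerivAt S (pointwiseApply unitInterval E (E →L[ℝ] G) (S' u)) u :=
    fun u => hasFDerivAt_superposition (hA.of_le (by exact_mod_cast le_top)) u
  -- The candidate curve `t ↦ p + t k(y) + R(ζ(t))`: a ray in `ker L`, corrected by an unknown
  -- function in the transversal direction.
  let c : E × C(unitInterval, G) → C(unitInterval, E) := fun x =>
    constCLM unitInterval E p + rayCLM E (k x.1) + Rc x.2
  have hc : ContDiff ℝ ∞ c := by fun_prop
  let P := primitive G
  let B := pointwiseApply unitInterval E G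
  -- A zero of `Ψ` satisfies `ζ(t) = L y - ∫₀ᵗ A(c(s))(k y) ds`, so `c' = k y - R(A(c)(k y))` lies
  -- in `ker A` because `A ∘ R = id`. As `Ψ(0, ζ) = ζ`, the implicit function theorem in the Banach
  -- space of continuous functions provides the solution and its smooth dependence on `y`.
  let Ψ : E × C(unitInterval, G) → C(unitInterval, G) := fun x =>
    x.2 - constCLM unitInterval G (L x.1) + P (B (S (c x)) (constCLM unitInterval E (k x.1)))
  have hΨ : ContDiff ℝ ∞ Ψ := by fun_prop
  have hΨ0 : ∀ ζ, Ψ (0, ζ) = ζ := fun ζ => by simp [Ψ]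
  have hΨd : ∀ v, fderiv ℝ Ψ (0, 0) (0, v)
      = ContinuousLinearEquiv.refl ℝ C(unitInterval, G) v := by
    intro v
    have h1 : HasFDerivAt Ψ (fderiv ℝ Ψ (0, 0)) (0, (0 : C(unitInterval, G))) :=
      ((hΨ.differentiable (by simp)) _).hasFDerivAt
    have h2 := HasFDerivAt.comp (0 : C(unitInterval, G)) (f := fun ζ => ((0 : E), ζ)) h1
      (hasFDerivAt_prodMk_right (0 : E) (0 : C(unitInterval, G)))
    have h3 : (Ψ ∘ fun ζ => ((0 : E), ζ)) = id := funext hΨ0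
    rw [h3] at h2
    have h4 := h2.unique (hasFDerivAt_id _)
    exact DFunLike.congr_fun h4 v
  obtain ⟨Z, hZ, hZ0, hZeq⟩ := (hΨ.smoothNear (0, 0)).exists_implicit hΨd
  rw [hΨ0] at hZeq
  let cZ : E → C(unitInterval, E) := fun y => c (y, Z y)
  have hZeq' : ∀ᶠ y in 𝓝 0, Z y = constCLM unitInterval G (L y)
      - P (B (S (cZ y)) (constCLM unitInterval E (k y))) := by
    filter_upwards [hZeq] with y hy
    have : Z y - constCLM unitInterval G (L y)
      + P (B (S (cZ y)) (constCLM unitInterval E (k y))) = 0 := hy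
    rw [← sub_eq_zero, ← this]
    abel
  -- the variation of the family of curves
  have hvar : ∀ᶠ y in 𝓝 0, ∀ u, fderiv ℝ Z y u = constCLM unitInterval G (L u)
      - P (B (S (cZ y)) (constCLM unitInterval E (k u))
        + B (pointwiseApply unitInterval E (E →L[ℝ] G) (S' (cZ y))
          (rayCLM E (k u) + Rc (fderiv ℝ Z y u))) (constCLM unitInterval E (k y))) := by
    filter_upwards [hZeq'.eventually_nhds, hZ] with y hy hZy u
    have hZd : HasFDerivAt Z (fderiv ℝ Z y) y := hZy.diffAt.hasFDerivAt
    have h1 : HasFDerivAt cZ ((rayCLM E).comp k + Rc.comp (fderiv ℝ Z y)) y :=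
      (((rayCLM E).comp k).hasFDerivAt.const_add _).add (Rc.hasFDerivAt.comp y hZd)
    have h2 := HasFDerivAt.comp (g := S) y (hS' (cZ y)) h1
    have h3 := B.hasFDerivAt_of_bilinear h2 ((constCLM unitInterval E).comp k).hasFDerivAt
    have h4 := (((constCLM unitInterval G).comp L).hasFDerivAt (x := y)).sub
      (P.hasFDerivAt.comp y h3)
    have h5 := hZd.unique (h4.congr_of_eventuallyEq hy)
    have h6 := DFunLike.congr_fun h5 u
    exact h6
  let ev : C(unitInterval, G) →L[ℝ] G := ContinuousMap.evalCLM ℝ 1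
  let Φ : E → E := fun y => p + k y + R (ev (Z y))
  have hΦ' : ∀ᶠ y in 𝓝 0, ∀ u, fderiv ℝ Φ y u = k u + R (fderiv ℝ Z y u 1) := by
    filter_upwards [hZ] with y hZy u
    have h1 : HasFDerivAt Φ (k + R.comp (ev.comp (fderiv ℝ Z y))) y :=
      (k.hasFDerivAt.const_add p).add
        (R.hasFDerivAt.comp y (ev.hasFDerivAt.comp y hZy.diffAt.hasFDerivAt))
    rw [h1.fderiv]
    rfl
  refine ⟨Φ, ?_, ?_, ?_, ?_⟩
  · filter_upwards [hZ] with y hZy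
    fun_prop
  · simp [Φ, hZ0]
  · ext u
    rw [hΦ'.self_of_nhds u, hvar.self_of_nhds u]
    have h1 : B (S (cZ 0)) (constCLM unitInterval E (k u)) = 0 := by
      ext t
      have : cZ 0 t = p := by simp [cZ, c, hZ0]
      have h2 : B (S (cZ 0)) (constCLM unitInterval E (k u)) t = A (cZ 0 t) (k u) := rfl
      rw [h2, this]
      exact hLk u
    rw [h1]
    simp only [map_zero, ContinuousMap.sub_apply, zero_add, constCLM_apply]
    simp [hk u]
  · have hclose : ∀ᶠ y in 𝓝 0, ∀ t, ∀ u v, A (cZ y t) u = 0 → A (cZ y t) v = 0 →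
        fderiv ℝ A (cZ y t) u v = fderiv ℝ A (cZ y t) v u := by
      obtain ⟨ε, hε, hb⟩ := Metric.eventually_nhds_iff_ball.1 hinv
      have hcc : ContinuousAt cZ 0 :=
        hc.continuous.continuousAt.comp (continuousAt_id.prodMk hZ.continuousAt)
      filter_upwards [hcc (Metric.ball_mem_nhds _ hε)] with y hy t
      refine hb _ ?_
      have h0 : cZ 0 t = p := by simp [cZ, c, hZ0]
      rw [Metric.mem_ball, ← h0]
      exact (ContinuousMap.dist_apply_le_dist t).trans_lt hy
    -- `A x (R v) = v` does not depend on `x`.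
    have hDR : ∀ x w v, fderiv ℝ A x w (R v) = 0 := by
      intro x w v
      have h1 : HasFDerivAt (fun x => A x (R v)) ((fderiv ℝ A x).flip (R v)) x := by
        simpa using (hA1 x).hasFDerivAt.clm_apply (hasFDerivAt_const (R v) x)
      have h2 : (fun x => A x (R v)) = fun _ => v := funext fun x => hR x v
      rw [h2] at h1
      exact DFunLike.congr_fun (h1.unique (hasFDerivAt_const v x)) w
    filter_upwards [hZeq', hvar, hΦ', hclose] with y hy hv hΦy hcl u hu
    have hku : k u = u := by rw [hk, hu, map_zero, sub_zero]
    set δ := fderiv ℝ Z y u with hδ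
    set g := B (S (cZ y)) (constCLM unitInterval E (k y)) with hg
    set h := B (S (cZ y)) (constCLM unitInterval E u)
        + B (pointwiseApply unitInterval E (E →L[ℝ] G) (S' (cZ y))
          (rayCLM E u + Rc δ)) (constCLM unitInterval E (k y)) with hh
    have hδe : δ = - P h := by
      rw [hδ, hv u, hku, hu, map_zero, zero_sub]
    let z : ℝ → G := fun t => L y - ∫ s in (0 : ℝ)..t, extendUnit g s
    let d : ℝ → G := fun t => -∫ s in (0 : ℝ)..t, extendUnit h s
    let U : ℝ → E := fun t => p + t • k y + R (z t)
    let U' : ℝ → E := fun t => k y - R (extendUnit g t)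
    let W : ℝ → E := fun t => t • u + R (d t)
    have hz : ∀ t : unitInterval, Z y t = z t := fun t => by rw [hy]; rfl
    have hd : ∀ t : unitInterval, δ t = d t := fun t => by rw [hδe]; rfl
    have hcU : ∀ t : unitInterval, cZ y t = U t := fun t => by
      simp only [U, ← hz]
      rfl
    have hgU : ∀ t : unitInterval, extendUnit g t = A (U t) (k y) := fun t => by
      rw [extendUnit_coe, ← hcU]
      rfl
    have hhU : ∀ t : unitInterval, extendUnit h t
        = A (U t) u + fderiv ℝ A (U t) (W t) (k y) := fun t => by
      rw [extendUnit_coe, ← hcU]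
      simp only [W, ← hd]
      rfl
    have hUd : ∀ t, HasDerivAt U (U' t) t := fun t => by
      have h1 : HasDerivAt z (-extendUnit g t) t := by
        simpa using (hasDerivAt_integral_extendUnit g t).const_sub (L y)
      have h2 := (((hasDerivAt_id t).smul_const (k y)).const_add p).add
        (R.hasFDerivAt.comp_hasDerivAt t h1)
      have h3 : HasDerivAt U _ t := h2
      exact h3.congr_deriv (by simp [U', sub_eq_add_neg])
    have hWd : ∀ t, HasDerivAt W (u - R (extendUnit h t)) t := fun t => by
      have h1 : HasDerivAt d (-extendUnit h t) t := (hasDerivAt_integral_extendUnit h t).neg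
      have h2 := ((hasDerivAt_id t).smul_const u).add (R.hasFDerivAt.comp_hasDerivAt t h1)
      have h3 : HasDerivAt W _ t := h2
      exact h3.congr_deriv (by simp [sub_eq_add_neg])
    -- `W` is the variation of the curve `U` in the direction `u`, and `η` measures its failure to
    -- be tangent to the distribution.
    let η : ℝ → G := fun t => A (U t) (W t)
    have hηd : ∀ t, HasDerivAt η (fderiv ℝ A (U t) (U' t) (W t)
        + A (U t) (u - R (extendUnit h t))) t := fun t =>
      ((hA1 (U t)).hasFDerivAt.comp_hasDerivAt t (hUd t)).clm_apply (hWd t)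
    -- Involutivity for the two tangent vectors `U'` and `W - R η` turns the derivative of `η` into
    -- a homogeneous linear expression in `η`. With `η 0 = 0`, Grönwall's inequality then gives `η 1
    -- = 0`.
    have hη' : ∀ t : unitInterval, fderiv ℝ A (U t) (U' t) (W t)
        + A (U t) (u - R (extendUnit h t)) = - fderiv ℝ A (U t) (R (η t)) (U' t) := by
      intro t
      have h1 := hcl t (U' t) (W t - R (η t))
        (by rw [hcU]; simp only [U', map_sub, hR, hgU, sub_self])
        (by rw [hcU]; simp only [η, map_sub, hR, sub_self])
      rw [hcU] at h1
      simp only [map_sub, hDR, sub_zero, sub_apply] at h1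
      have h2 : fderiv ℝ A (U t) (W t) (U' t) = fderiv ℝ A (U t) (W t) (k y) := by
        simp only [U', map_sub, hDR, sub_zero]
      rw [h1, h2, map_sub (A (U t)), hR, hhU]
      abel
    have hUc : Continuous U := continuous_iff_continuousAt.2 fun t => (hUd t).continuousAt
    have hU'c : Continuous U' :=
      continuous_const.sub (R.continuous.comp (continuous_extendUnit g))
    have hDc : Continuous fun t => fderiv ℝ A (U t) := hA'.continuous.comp hUc
    obtain ⟨M₁, hM₁⟩ := (isCompact_Icc (a := (0 : ℝ)) (b := 1)).exists_bound_of_continuousOn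
      (E := E →L[ℝ] E →L[ℝ] G) (f := fun t => fderiv ℝ A (U t)) hDc.continuousOn
    obtain ⟨M₂, hM₂⟩ := (isCompact_Icc (a := (0 : ℝ)) (b := 1)).exists_bound_of_continuousOn
      hU'c.continuousOn
    have hη0 : η 0 = 0 := by simp [η, W, d]
    have hη1 : η 1 = 0 := by
      refine eq_zero_of_abs_deriv_le_mul_abs_self_of_eq_zero_right (K := M₁ * ‖R‖ * M₂) (a := 0) (b := 1)
        (fun t _ => (hηd t).continuousAt.continuousWithinAt)
        (fun t _ => (hηd t).hasDerivWithinAt) hη0 (fun t ht => ?_) 1 (by simp)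
      rw [hη' ⟨t, ht.1, ht.2.le⟩, norm_neg]
      have h1 := hM₁ t ⟨ht.1, ht.2.le⟩
      have h2 := hM₂ t ⟨ht.1, ht.2.le⟩
      have h3 : 0 ≤ M₁ := (norm_nonneg _).trans h1
      calc ‖fderiv ℝ A (U t) (R (η t)) (U' t)‖
          ≤ ‖fderiv ℝ A (U t)‖ * ‖R (η t)‖ * ‖U' t‖ :=
            ((fderiv ℝ A (U t)).le_opNorm₂ _ _)
        _ ≤ M₁ * (‖R‖ * ‖η t‖) * M₂ := by
            gcongr
            exact R.le_opNorm _
        _ = M₁ * ‖R‖ * M₂ * ‖η t‖ := by ring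
    have e1 : Φ y = U 1 := by
      have : Φ y = cZ y 1 := by simp [Φ, cZ, c, ev, hRc]
      rw [this, hcU]
      rfl
    have e2 : fderiv ℝ Φ y u = W 1 := by
      rw [hΦy, hku, hd]
      simp [W]
    rw [e1, e2]
    exact hη1

/-- The Frobenius theorem: an involutive distribution given as the kernel of a smooth vector-valued
one-form is, locally, contained in the kernel of an exact one. -/
theorem frobenius [FiniteDimensional ℝ E] {α : E → E →L[ℝ] G} {p : E} (hα : SmoothNear α p)
    {R : G →L[ℝ] E} (hR : ∀ v, α p (R v) = v)
    (hinv : ∀ᶠ x in 𝓝 p, ∀ u v, α x u = 0 → α x v = 0 → fderiv ℝ α x u v = fderiv ℝ α x v u) :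
    ∃ w : E → G, SmoothNear w p ∧ fderiv ℝ w p = α p ∧
      ∀ᶠ x in 𝓝 p, ∀ v, α x v = 0 → fderiv ℝ w x v = 0 := by
  set L := α p with hL
  let k : E →L[ℝ] E := ContinuousLinearMap.id ℝ E - R.comp L
  have hk : ∀ v, k v = v - R (L v) := fun v => rfl
  -- normalise the one-form so that `R` is a right inverse everywhere
  have hNp : (α p).comp R = (ContinuousLinearEquiv.refl ℝ G : G →L[ℝ] G) := by
    ext v
    exact hR v
  have hNs : SmoothNear (fun x => (α x).comp R) p := by
    filter_upwards [hα] with x hx using hx.clm_comp contDiffAt_const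
  obtain ⟨M, hM, hMp, hMinv⟩ := hNs.exists_inverse hNp
  have hMα : SmoothNear (fun x => (M x).comp (α x)) p := by
    filter_upwards [hα, hM] with x hx hMx using hMx.clm_comp hx
  obtain ⟨β, hβ, hβα⟩ := hMα.exists_contDiff
  -- Globally smooth, equal to `M ∘ α` near `p`, and satisfying `A ∘ R = id` everywhere: `β` is
  -- applied only after the projection `k`, which kills the range of `R`.
  let A : E → E →L[ℝ] G := fun x => L + (β x).comp k
  have hA : ContDiff ℝ ∞ A := contDiff_const.add (hβ.clm_comp contDiff_const)
  have hAR : ∀ x v, A x (R v) = v := fun x v => by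
    have : k (R v) = 0 := by rw [hk, hL, hR, sub_self]
    simp [A, this, hR]
  have hAα : A =ᶠ[𝓝 p] fun x => (M x).comp (α x) := by
    filter_upwards [hβα, hMinv] with x hx hx'
    ext v
    have h1 : M x (α x (R (L v))) = L v := hx'.1 (L v)
    simp only [A, add_apply, hx, ContinuousLinearMap.comp_apply, hk, map_sub, h1]
    abel
  have hAp : A p = L := by
    rw [hAα.self_of_nhds]
    simp only [hMp]
    ext v
    rfl
  have hker : ∀ᶠ x in 𝓝 p, ∀ v, A x v = 0 ↔ α x v = 0 := by
    filter_upwards [hAα, hMinv] with x hx hx' v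
    rw [hx, ContinuousLinearMap.comp_apply]
    refine ⟨fun h => ?_, fun h => by rw [h, map_zero]⟩
    have h1 := hx'.2 (α x v)
    rw [h, map_zero] at h1
    exact h1.symm
  -- Involutivity depends only on the kernel: the term with the derivative of `M` is applied to `α x
  -- u = 0` or `α x v = 0`.
  have hAinv : ∀ᶠ x in 𝓝 p, ∀ u v, A x u = 0 → A x v = 0 →
      fderiv ℝ A x u v = fderiv ℝ A x v u := by
    filter_upwards [hinv, hker, hAα.eventually_nhds, hM, hα] with x h1 h2 h3 h4 h5 u v hu hv
    have h6 : fderiv ℝ A x = fderiv ℝ (fun x => (M x).comp (α x)) x :=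
      Filter.EventuallyEq.fderiv_eq h3
    rw [h2] at hu hv
    rw [h6, fderiv_clm_comp h4.diffAt h5.diffAt]
    simp [hu, hv, h1 u v hu hv]
  obtain ⟨Φ, hΦ, hΦ0, hΦd, hΦA⟩ := exists_integral_manifolds hA hAR hAinv
  rw [hAp] at hΦA
  -- The function sought is `L ∘ Φ⁻¹`. If `v = DΦ u` is tangent to the distribution, splitting `u =
  -- k u + R (L u)` leaves `(A ∘ DΦ ∘ R)(L u) = 0`. This operator is the identity at `0`, hence
  -- invertible nearby, and `L u = 0`.
  have hBs : SmoothNear (fun y => ((A (Φ y)).comp (fderiv ℝ Φ y)).comp R) 0 := by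
    filter_upwards [hΦ] with y hy
    exact ((hA.contDiffAt.comp y hy).clm_comp hy.fderiv_infty).clm_comp contDiffAt_const
  obtain ⟨M', -, -, hM'⟩ := hBs.exists_inverse (A := ContinuousLinearEquiv.refl ℝ G) (by
    ext v
    simp [hΦ0, hΦd, hAR])
  obtain ⟨φ, r, hr, h0, ht, he, h1, h2⟩ :=
    hΦ.exists_chart (A := ContinuousLinearEquiv.refl ℝ E) hΦd (hΦA.and hM')
  have hpt : p ∈ φ.target := by
    rw [ht, hΦ0]
    exact Metric.mem_ball_self hr
  have hp0 : φ.symm p = 0 := by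
    rw [← hΦ0, ← he, φ.left_inv h0]
  have hwd : ∀ x ∈ φ.target, fderiv ℝ (fun x => L (φ.symm x)) x = L.comp (fderiv ℝ φ.symm x) :=
    fun x hx => (L.hasFDerivAt.comp x (h2 x hx).diffAt.hasFDerivAt).fderiv
  refine ⟨fun x => L (φ.symm x), ?_, ?_, ?_⟩
  · filter_upwards [φ.open_target.mem_nhds hpt] with x hx
    exact L.contDiff.contDiffAt.comp x (h2 x hx)
  · rw [hwd p hpt]
    ext v
    have h3 := fderiv_comp_symm he hpt (h1 _ (φ.map_target hpt)).2 (h2 p hpt) v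
    rw [hp0, hΦd] at h3
    exact congrArg L h3
  · filter_upwards [φ.open_target.mem_nhds hpt, hker] with x hx hkx v hv
    rw [hwd x hx, ContinuousLinearMap.comp_apply]
    obtain ⟨⟨h4, h5⟩, h6⟩ := h1 _ (φ.map_target hx)
    have h3 := fderiv_comp_symm he hx h6 (h2 x hx) v
    set u := fderiv ℝ φ.symm x v
    have hΦx : Φ (φ.symm x) = x := by rw [← he, φ.right_inv hx]
    have h7 := h4 (k u) (by rw [hk, map_sub, hL, hR, sub_self])
    have h8 : ((A (Φ (φ.symm x))).comp (fderiv ℝ Φ (φ.symm x))).comp R (L u) = 0 := by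
      have h9 : R (L u) = u - k u := by rw [hk]; abel
      simp only [ContinuousLinearMap.comp_apply] at h7 ⊢
      rw [h9, map_sub, map_sub, h7, h3, hΦx, (hkx v).2 hv, sub_zero]
    have h9 := h5.1 (L u)
    rw [h8, map_zero] at h9
    exact h9.symm

end Frobenius

/-! ### The Poincaré lemma along the leaves of a submersion. -/

section LeafPoincare

variable {E : Type} [NormedAddCommGroup E] [NormedSpace ℝ E]

set_option maxHeartbeats 1000000 in
/-- The Poincaré lemma on the leaves of a linear function, for globally smooth one-forms. -/
theorem linear_leaf_poincare {Γ : E → E →L[ℝ] ℝ} (hΓ : ContDiff ℝ ∞ Γ) {L : E →L[ℝ] ℝ} {c : E}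
    (hc : L c = 1)
    (hcl : ∀ᶠ y in 𝓝 0, ∀ u v, L u = 0 → L v = 0 → fderiv ℝ Γ y u v = fderiv ℝ Γ y v u) :
    ∃ X : E → ℝ, ContDiff ℝ ∞ X ∧ ∀ᶠ y in 𝓝 0, ∀ u, L u = 0 → fderiv ℝ X y u = Γ y u := by
  have hΓ1 : Differentiable ℝ Γ := hΓ.differentiable (by simp)
  have hΓ' : ContDiff ℝ ∞ (fderiv ℝ Γ) := hΓ.fderiv_right (by simp)
  let P : E →L[ℝ] E := ContinuousLinearMap.id ℝ E - L.smulRight c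
  have hP : ∀ v, P v = v - L v • c := fun v => rfl
  have hLP : ∀ v, L (P v) = 0 := fun v => by rw [hP, map_sub, map_smul, hc]; simp
  let S : C(unitInterval, E) → C(unitInterval, E →L[ℝ] ℝ) :=
    fun u => (⟨Γ, hΓ.continuous⟩ : C(E, E →L[ℝ] ℝ)).comp u
  have hS : ContDiff ℝ ∞ S := contDiff_superposition hΓ
  let S' : C(unitInterval, E) → C(unitInterval, E →L[ℝ] E →L[ℝ] ℝ) :=
    fun u => (⟨fderiv ℝ Γ, hΓ'.continuous⟩ : C(E, E →L[ℝ] E →L[ℝ] ℝ)).comp u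
  have hS' : ∀ u, HasFDerivAt S (pointwiseApply unitInterval E (E →L[ℝ] ℝ) (S' u)) u :=
    fun u => hasFDerivAt_superposition (hΓ.of_le (by exact_mod_cast le_top)) u
  let cv : E →L[ℝ] C(unitInterval, E) :=
    (constCLM unitInterval E).comp (L.smulRight c) + (rayCLM E).comp P
  have hcv : ∀ y t, cv y t = L y • c + (t : ℝ) • P y := fun y t => rfl
  let B := pointwiseApply unitInterval E ℝ
  let ev : C(unitInterval, ℝ) →L[ℝ] ℝ := (ContinuousMap.evalCLM ℝ 1).comp (primitive ℝ)
  have hev : ∀ g, ev g = ∫ s in (0 : ℝ)..1, extendUnit g s := fun g => rfl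
  -- The radial homotopy formula within each leaf: integrate `Γ` over the segment from `L y • c` to
  -- `y`, whose direction `P y` lies in `ker L`.
  let X : E → ℝ := fun y => ev (B (S (cv y)) (constCLM unitInterval E (P y)))
  have hXd : ∀ y u, fderiv ℝ X y u = ev (B (S (cv y)) (constCLM unitInterval E (P u))
      + B (pointwiseApply unitInterval E (E →L[ℝ] ℝ) (S' (cv y)) (cv u))
        (constCLM unitInterval E (P y))) := by
    intro y u
    have h2 := HasFDerivAt.comp (g := S) y (hS' (cv y)) cv.hasFDerivAt
    have h3 := B.hasFDerivAt_of_bilinear h2 ((constCLM unitInterval E).comp P).hasFDerivAt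
    have h4 : HasFDerivAt X _ y := ev.hasFDerivAt.comp y h3
    rw [h4.fderiv]
    rfl
  have hX : ContDiff ℝ ∞ X := by fun_prop
  refine ⟨X, hX, ?_⟩
  obtain ⟨ε, hε, hb⟩ := Metric.eventually_nhds_iff_ball.1 hcl
  have hclose : ∀ᶠ y in 𝓝 0, ∀ t : unitInterval, cv y t ∈ Metric.ball (0 : E) ε := by
    have hcc : ContinuousAt cv 0 := cv.continuous.continuousAt
    filter_upwards [hcc (Metric.ball_mem_nhds _ hε)] with y hy t
    have h0 : cv 0 t = 0 := by simp
    rw [Metric.mem_ball, ← h0]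
    exact (ContinuousMap.dist_apply_le_dist t).trans_lt hy
  filter_upwards [hclose] with y hy u hu
  have hPu : P u = u := by rw [hP, hu]; simp
  have hcurve : ∀ t : ℝ, HasDerivAt (fun t : ℝ => L y • c + t • P y) (P y) t := fun t => by
    simpa using ((hasDerivAt_id t).smul_const (P y)).const_add (L y • c)
  -- By closedness `DΓ(P y) u = DΓ(u)(P y)`, so the integrand of the derivative of `X` in the
  -- direction `u` is the derivative of `t Γ(c(t)) u`, and the integral telescopes to `Γ y u`.
  have hder : ∀ t : ℝ, HasDerivAt (fun t : ℝ => t * Γ (L y • c + t • P y) u)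
      (1 * Γ (L y • c + t • P y) u + t * fderiv ℝ Γ (L y • c + t • P y) (P y) u) t := fun t => by
    have h1 := ((hΓ1 (L y • c + t • P y)).hasFDerivAt.comp_hasDerivAt t (hcurve t)).clm_apply
      (hasDerivAt_const t u)
    have h2 : HasDerivAt (fun t : ℝ => t * Γ (L y • c + t • P y) u) _ t :=
      (hasDerivAt_id t).mul h1
    exact h2.congr_deriv (by simp)
  rw [hXd, hev]
  have hint := intervalIntegral.integral_eq_sub_of_hasDerivAt (a := 0) (b := 1)
    (fun t _ => hder t) (by
      refine Continuous.intervalIntegrable ?_ _ _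
      have h1 : Continuous fun t : ℝ => Γ (L y • c + t • P y) :=
        hΓ.continuous.comp (by fun_prop)
      have h2 : Continuous fun t : ℝ => fderiv ℝ Γ (L y • c + t • P y) :=
        hΓ'.continuous.comp (by fun_prop)
      fun_prop)
  have hy1 : L y • c + (1 : ℝ) • P y = y := by rw [hP]; simp
  rw [hy1] at hint
  simp only [one_mul, zero_mul, sub_zero] at hint
  rw [← hint]
  refine intervalIntegral.integral_congr fun t ht => ?_
  rw [Set.uIcc_of_le zero_le_one] at ht
  have h1 := extendUnit_coe (B (S (cv y)) (constCLM unitInterval E (P u))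
      + B (pointwiseApply unitInterval E (E →L[ℝ] ℝ) (S' (cv y)) (cv u))
        (constCLM unitInterval E (P y))) ⟨t, ht⟩
  have h2 := hb _ (hy ⟨t, ht⟩) (P y) u (hLP y) hu
  have h3 : cv u ⟨t, ht⟩ = t • u := by rw [hcv, hu, hPu]; simp
  refine h1.trans ?_
  have h4 : (B (S (cv y)) (constCLM unitInterval E (P u))
      + B (pointwiseApply unitInterval E (E →L[ℝ] ℝ) (S' (cv y)) (cv u))
        (constCLM unitInterval E (P y))) ⟨t, ht⟩
      = Γ (cv y ⟨t, ht⟩) (P u) + fderiv ℝ Γ (cv y ⟨t, ht⟩) (cv u ⟨t, ht⟩) (P y) := rfl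
  rw [h4, h3, hPu, map_smul, smul_apply, ← h2]
  rfl

/-- The Poincaré lemma with parameters: a one-form that is closed along the level sets of a
submersion germ `z` is exact along these level sets. -/
theorem leaf_poincare [FiniteDimensional ℝ E] {z : E → ℝ} {γ : E → E →L[ℝ] ℝ} {p : E}
    (hz : SmoothNear z p) {c : E} (hc : fderiv ℝ z p c = 1) (hγ : SmoothNear γ p)
    (hcl : ∀ᶠ x in 𝓝 p, ∀ u v, fderiv ℝ z x u = 0 → fderiv ℝ z x v = 0 →
      fderiv ℝ γ x u v = fderiv ℝ γ x v u) :
    ∃ X : E → ℝ, SmoothNear X p ∧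
      ∀ᶠ x in 𝓝 p, ∀ u, fderiv ℝ z x u = 0 → fderiv ℝ X x u = γ x u := by
  have : CompleteSpace E := FiniteDimensional.complete ℝ E
  obtain ⟨φ, f, r, hr, hp, hfp, ht, he, h1, h2, hL⟩ :=
    hz.exists_straightening (R := (ContinuousLinearMap.id ℝ ℝ).smulRight c)
      (fun v => by simp [hc]) ((hz.and hγ).and hcl)
  set L := fderiv ℝ z p
  have h0t : (0 : E) ∈ φ.target := by
    rw [ht]
    exact Metric.mem_ball_self hr
  have hLd : ∀ x ∈ φ.source, ∀ u, L (fderiv ℝ f x u) = fderiv ℝ z x u := by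
    intro x hx u
    have e3 : fderiv ℝ (fun x => L (f x)) x = L.comp (fderiv ℝ f x) :=
      (L.hasFDerivAt.comp _ (h1 x hx).2.diffAt.hasFDerivAt).fderiv
    have e4 : (fun x => L (f x)) = fun x => z x - z p := funext hL
    rw [e4, fderiv_sub_const] at e3
    rw [e3, ContinuousLinearMap.comp_apply]
  let ψ := φ.symm
  have hγψ : SmoothNear (fun y => (γ (ψ y)).comp (fderiv ℝ ψ y)) 0 := by
    filter_upwards [φ.open_target.mem_nhds h0t] with y hy
    exact ((h1 _ (φ.map_target hy)).1.1.2.comp y (h2 y hy)).clm_comp (h2 y hy).fderiv_infty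
  obtain ⟨Γ, hΓ, hΓγ⟩ := hγψ.exists_contDiff
  have hΓcl : ∀ᶠ y in 𝓝 0, ∀ u v, L u = 0 → L v = 0 →
      fderiv ℝ Γ y u v = fderiv ℝ Γ y v u := by
    filter_upwards [φ.open_target.mem_nhds h0t, hΓγ.eventually_nhds] with y hy hΓy u v hu hv
    obtain ⟨⟨⟨h3, h4⟩, h5⟩, h6⟩ := h1 _ (φ.map_target hy)
    have e1 := fderiv_comp_symm he hy h6 (h2 y hy)
    have e2 : HasFDerivAt (fun y => γ (ψ y)) ((fderiv ℝ γ (ψ y)).comp (fderiv ℝ ψ y)) y :=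
      h4.diffAt.hasFDerivAt.comp y (h2 y hy).diffAt.hasFDerivAt
    have e3 := e2.clm_comp (h2 y hy).fderiv_infty.diffAt.hasFDerivAt
    rw [Filter.EventuallyEq.fderiv_eq hΓy, e3.fderiv]
    -- The only extra term of the pullback involves the symmetric second derivative of `ψ`, so
    -- leafwise closedness survives.
    have hsymm : fderiv ℝ (fderiv ℝ ψ) y u v = fderiv ℝ (fderiv ℝ ψ) y v u :=
      (h2 y hy).fderiv_fderiv_comm u v
    have h7 := h5 (fderiv ℝ ψ y u) (fderiv ℝ ψ y v)
      (by rw [← hLd _ (φ.map_target hy), e1, hu]) (by rw [← hLd _ (φ.map_target hy), e1, hv])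
    have h8 : ∀ u v, ((ContinuousLinearMap.compL ℝ E E ℝ (γ (ψ y))).comp
          (fderiv ℝ (fderiv ℝ ψ) y) + ((ContinuousLinearMap.compL ℝ E E ℝ).flip
          (fderiv ℝ ψ y)).comp ((fderiv ℝ γ (ψ y)).comp (fderiv ℝ ψ y))) u v
        = γ (ψ y) (fderiv ℝ (fderiv ℝ ψ) y u v)
          + fderiv ℝ γ (ψ y) (fderiv ℝ ψ y u) (fderiv ℝ ψ y v) := fun u v => rfl
    rw [h8, h8, hsymm, h7]
  obtain ⟨X, hX, hXd⟩ := linear_leaf_poincare hΓ hc hΓcl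
  have hf : SmoothNear f p := by
    filter_upwards [φ.open_source.mem_nhds hp] with x hx using (h1 x hx).2
  refine ⟨fun x => X (f x), (hX.smoothNear _).comp hf, ?_⟩
  have hf0 : Tendsto f (𝓝 p) (𝓝 0) := hfp ▸ hf.continuousAt
  filter_upwards [φ.open_source.mem_nhds hp, hf0.eventually hXd, hf0.eventually hΓγ]
    with x hx hXx hΓx u hu
  have e1 : fderiv ℝ (fun x => X (f x)) x = (fderiv ℝ X (f x)).comp (fderiv ℝ f x) :=
    fderiv_comp x ((hX.differentiable (by simp)) _) (h1 x hx).2.diffAt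
  have hfx : φ x ∈ φ.target := φ.map_source hx
  have e2 := fderiv_symm_comp he hx (h1 x hx).2 (h2 _ hfx) u
  rw [he] at e2
  have e3 : ψ (f x) = x := by rw [← he]; exact φ.left_inv hx
  rw [e1, ContinuousLinearMap.comp_apply, hXx _ (by rw [hLd x hx, hu]), hΓx,
    ContinuousLinearMap.comp_apply, e2, e3]

end LeafPoincare

/-! ### Exterior derivatives of vector-valued one-forms. -/

section ExteriorDerivative

variable {E F G : Type} [NormedAddCommGroup E] [NormedSpace ℝ E] [NormedAddCommGroup F]
  [NormedSpace ℝ F] [NormedAddCommGroup G] [NormedSpace ℝ G]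

/-- The exterior derivative of a vector-valued one-form. -/
noncomputable def extd (α : E → E →L[ℝ] F) (x u v : E) : F := fderiv ℝ α x u v - fderiv ℝ α x v u

theorem extd_congr {α β : E → E →L[ℝ] F} {x : E} (h : α =ᶠ[𝓝 x] β) (u v : E) :
    extd α x u v = extd β x u v := by
  rw [extd, extd, Filter.EventuallyEq.fderiv_eq h]

theorem extd_fderiv {f : E → F} {x : E} (h : ContDiffAt ℝ ∞ f x) (u v : E) :
    extd (fderiv ℝ f) x u v = 0 := by
  rw [extd, h.fderiv_fderiv_comm, sub_self]

theorem extd_add {α β : E → E →L[ℝ] F} {x : E} (hα : DifferentiableAt ℝ α x)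
    (hβ : DifferentiableAt ℝ β x) (u v : E) :
    extd (fun y => α y + β y) x u v = extd α x u v + extd β x u v := by
  simp only [extd]
  rw [fderiv_fun_add hα hβ]
  simp only [add_apply]
  abel

theorem extd_comp {m : E → F →L[ℝ] G} {α : E → E →L[ℝ] F} {x : E} (hm : DifferentiableAt ℝ m x)
    (hα : DifferentiableAt ℝ α x) (u v : E) :
    extd (fun y => (m y).comp (α y)) x u v
      = m x (extd α x u v) + fderiv ℝ m x u (α x v) - fderiv ℝ m x v (α x u) := by
  have h : ∀ u v, fderiv ℝ (fun y => (m y).comp (α y)) x u v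
      = m x (fderiv ℝ α x u v) + fderiv ℝ m x u (α x v) := fun u v => by
    rw [fderiv_clm_comp hm hα]
    rfl
  simp only [extd, h, map_sub]
  abel

theorem extd_smul {f : E → ℝ} {α : E → E →L[ℝ] F} {x : E} (hf : DifferentiableAt ℝ f x)
    (hα : DifferentiableAt ℝ α x) (u v : E) :
    extd (fun y => f y • α y) x u v
      = f x • extd α x u v + fderiv ℝ f x u • α x v - fderiv ℝ f x v • α x u := by
  have h : ∀ u v, fderiv ℝ (fun y => f y • α y) x u v
      = f x • fderiv ℝ α x u v + fderiv ℝ f x u • α x v := fun u v => by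
    rw [fderiv_fun_smul hf hα]
    rfl
  simp only [extd, h, smul_sub]
  abel

end ExteriorDerivative

/-! ### The Nijenhuis tensor pointwise, dually, and under maps. -/

section NijenhuisTensor

variable {E F : Type} [NormedAddCommGroup E] [NormedSpace ℝ E] [NormedAddCommGroup F]
  [NormedSpace ℝ F]

/-- The Nijenhuis tensor of an operator field, as a bilinear expression in tangent vectors. -/
noncomputable def nij (J : E → E →L[ℝ] E) (x u v : E) : E :=
  fderiv ℝ J x (J x u) v - fderiv ℝ J x (J x v) u - J x (fderiv ℝ J x u v)
    + J x (fderiv ℝ J x v u)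

/-- Tensoriality: every term with a derivative of `X` or `Y` cancels. -/
theorem nijenhuisTensor_eq_nij {J : OperatorField} {X Y : E3 → E3} {x : E3}
    (hJ : DifferentiableAt ℝ J x) (hX : DifferentiableAt ℝ X x) (hY : DifferentiableAt ℝ Y x) :
    nijenhuisTensor J X Y x = nij J x (X x) (Y x) := by
  simp only [nijenhuisTensor, VectorField.lieBracket, nij]
  rw [fderiv_clm_apply hJ hX, fderiv_clm_apply hJ hY]
  simp only [add_apply, ContinuousLinearMap.comp_apply, ContinuousLinearMap.flip_apply, map_sub,
    map_add]
  abel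

theorem isNijenhuisAt_iff {J : OperatorField} {p : E3} (hJ : SmoothAt J p) :
    IsNijenhuisAt J p ↔ ∀ᶠ x in 𝓝 p, ∀ u v, nij J x u v = 0 := by
  refine ⟨fun h => ?_, fun h => ?_⟩
  · filter_upwards [h, hJ] with x hx hJx u v
    rw [← hx (fun _ => u) (fun _ => v) contDiff_const contDiff_const,
      nijenhuisTensor_eq_nij hJx.diffAt (differentiableAt_const _) (differentiableAt_const _)]
  · filter_upwards [h, hJ] with x hx hJx X Y hX hY
    rw [nijenhuisTensor_eq_nij hJx.diffAt hX.contDiffAt.diffAt hY.contDiffAt.diffAt, hx]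

/-- The Nijenhuis tensor in terms of exterior derivatives of one-forms. -/
theorem apply_nij {J : E → E →L[ℝ] E} {α : E → E →L[ℝ] F} {x : E} (hJ : DifferentiableAt ℝ J x)
    (hα : DifferentiableAt ℝ α x) (u v : E) :
    α x (nij J x u v) = extd (fun y => (α y).comp (J y)) x (J x u) v
      + extd (fun y => (α y).comp (J y)) x u (J x v) - extd α x (J x u) (J x v)
      - extd (fun y => ((α y).comp (J y)).comp (J y)) x u v := by
  rw [extd_comp hα hJ, extd_comp hα hJ, extd_comp (m := fun y => (α y).comp (J y))
    (hα.clm_comp hJ) hJ]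
  have h : ∀ u v, fderiv ℝ (fun y => (α y).comp (J y)) x u v
      = α x (fderiv ℝ J x u v) + fderiv ℝ α x u (J x v) := fun u v => by
    rw [fderiv_clm_comp hα hJ]
    rfl
  simp only [h, nij, extd, map_add, map_sub, ContinuousLinearMap.comp_apply]
  abel

/-- The Nijenhuis tensor in terms of a one-form that is intertwined by `J` and an operator field
on its space of values. -/
theorem apply_nij_of_intertwines {J : E → E →L[ℝ] E} {α : E → E →L[ℝ] F} {m : E → F →L[ℝ] F}
    {x : E} (hJ : DifferentiableAt ℝ J x) (hα : DifferentiableAt ℝ α x)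
    (hm : DifferentiableAt ℝ m x) (h : ∀ᶠ y in 𝓝 x, ∀ v, α y (J y v) = m y (α y v)) (u v : E) :
    α x (nij J x u v) = (fderiv ℝ m x (J x u) (α x v) - m x (fderiv ℝ m x u (α x v)))
      - (fderiv ℝ m x (J x v) (α x u) - m x (fderiv ℝ m x v (α x u)))
      - (extd α x (J x u) (J x v) - m x (extd α x (J x u) v + extd α x u (J x v))
        + m x (m x (extd α x u v))) := by
  have h1 : (fun y => (α y).comp (J y)) =ᶠ[𝓝 x] fun y => (m y).comp (α y) := by
    filter_upwards [h] with y hy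
    ext v
    exact hy v
  have h2 : (fun y => ((α y).comp (J y)).comp (J y)) =ᶠ[𝓝 x]
      fun y => (m y).comp ((m y).comp (α y)) := by
    filter_upwards [h] with y hy
    ext v
    simp [hy]
  rw [apply_nij hJ hα, extd_congr h1, extd_congr h1, extd_congr h2, extd_comp hm hα,
    extd_comp hm hα, extd_comp (α := fun y => (m y).comp (α y)) hm (hm.clm_comp hα),
    extd_comp hm hα]
  simp only [map_add, map_sub, ContinuousLinearMap.comp_apply, h.self_of_nhds]
  abel

/-- The Nijenhuis tensor is natural. -/
theorem fderiv_nij {J : E → E →L[ℝ] E} {f : E → F} {M : F → F →L[ℝ] F} {x : E}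
    (hJ : DifferentiableAt ℝ J x) (hf : ContDiffAt ℝ ∞ f x) (hM : DifferentiableAt ℝ M (f x))
    (h : ∀ᶠ y in 𝓝 x, ∀ v, fderiv ℝ f y (J y v) = M (f y) (fderiv ℝ f y v)) (u v : E) :
    fderiv ℝ f x (nij J x u v) = nij M (f x) (fderiv ℝ f x u) (fderiv ℝ f x v) := by
  have hm : HasFDerivAt (fun y => M (f y)) ((fderiv ℝ M (f x)).comp (fderiv ℝ f x)) x :=
    hM.hasFDerivAt.comp x hf.diffAt.hasFDerivAt
  rw [apply_nij_of_intertwines hJ hf.fderiv_infty.diffAt hm.differentiableAt h]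
  simp only [extd_fderiv hf, hm.fderiv, ContinuousLinearMap.comp_apply, h.self_of_nhds, nij,
    map_zero, add_zero, sub_zero]
  abel

end NijenhuisTensor

/-! ### Smooth kernels and cokernels of operators of corank one. -/

section Corank

variable {E : Type} [NormedAddCommGroup E] [NormedSpace ℝ E]

/-- Smooth data attached to an operator germ `n` with one-dimensional kernel: the inverse `H` of the
perturbation `n + c ⊗ ξ`, and the generator `k` of the kernel with `ξ k = 1`. -/
structure CorankOneData (n : E → E →L[ℝ] E) (p : E) where
  k : E → E
  H : E → E →L[ℝ] E
  ξ : E →L[ℝ] ℝ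
  c : E
  smooth_k : SmoothNear k p
  smooth_H : SmoothNear H p
  apply_k : ∀ᶠ x in 𝓝 p, n x (k x) = 0
  ξ_k : ∀ᶠ x in 𝓝 p, ξ (k x) = 1
  H_apply : ∀ᶠ x in 𝓝 p, ∀ v, H x (n x v) = v - ξ v • k x
  apply_H : ∀ᶠ x in 𝓝 p, ∀ v, n x (H x v) + ξ (H x v) • c = v
  H_c : ∀ᶠ x in 𝓝 p, H x c = k x

/-- A generator of the annihilator of the image. -/
noncomputable def CorankOneData.α {n : E → E →L[ℝ] E} {p : E} (D : CorankOneData n p) :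
    E → E →L[ℝ] ℝ :=
  fun x => D.ξ.comp (D.H x)

theorem CorankOneData.smooth_α {n : E → E →L[ℝ] E} {p : E} (D : CorankOneData n p) :
    SmoothNear D.α p := by
  filter_upwards [D.smooth_H] with x hx using contDiffAt_const.clm_comp hx

theorem CorankOneData.α_c {n : E → E →L[ℝ] E} {p : E} (D : CorankOneData n p) :
    ∀ᶠ x in 𝓝 p, D.α x D.c = 1 := by
  filter_upwards [D.H_c, D.ξ_k] with x h1 h2
  simp [α, h1, h2]

theorem CorankOneData.α_apply {n : E → E →L[ℝ] E} {p : E} (D : CorankOneData n p) :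
    ∀ᶠ x in 𝓝 p, ∀ v, D.α x (n x v) = 0 := by
  filter_upwards [D.H_apply, D.ξ_k] with x h1 h2 v
  simp [α, h1, h2]

theorem CorankOneData.exists_of_α_eq_zero {n : E → E →L[ℝ] E} {p : E} (D : CorankOneData n p) :
    ∀ᶠ x in 𝓝 p, ∀ u, D.α x u = 0 → ∃ v, n x v = u := by
  filter_upwards [D.apply_H] with x h1 u hu
  refine ⟨D.H x u, ?_⟩
  have h2 := h1 u
  have h3 : D.ξ (D.H x u) = 0 := hu
  rwa [h3, zero_smul, add_zero] at h2

theorem CorankOneData.eq_smul_k {n : E → E →L[ℝ] E} {p : E} (D : CorankOneData n p) :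
    ∀ᶠ x in 𝓝 p, ∀ v, n x v = 0 → v = D.ξ v • D.k x := by
  filter_upwards [D.H_apply] with x h1 v hv
  have h2 := h1 v
  rw [hv, map_zero] at h2
  exact sub_eq_zero.1 h2.symm

/-- A bordering argument. With `c` outside the image of `n p` and `ξ` equal to `1` on the kernel
vector, `n + c ⊗ ξ` is invertible at `p`, hence nearby. It sends any kernel vector `k` of `n x` to
`ξ(k) c`, so its inverse applied to `c` is the normalised kernel vector and varies smoothly. -/
theorem CorankOneData.nonempty [FiniteDimensional ℝ E] {n : E → E →L[ℝ] E} {p : E}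
    (hn : SmoothNear n p) {k₀ : E} (hk₀ : k₀ ≠ 0) (hker : ∀ v, n p v = 0 → ∃ s : ℝ, v = s • k₀)
    (hk : ∀ᶠ x in 𝓝 p, ∃ k, k ≠ 0 ∧ n x k = 0) : Nonempty (CorankOneData n p) := by
  have : CompleteSpace E := FiniteDimensional.complete ℝ E
  obtain ⟨ξ, hξ⟩ := SeparatingDual.exists_eq_one (R := ℝ) hk₀
  have hc : ∃ c, ∀ v, n p v ≠ c := by
    by_contra! h
    have hsurj : Function.Surjective (n p : E →ₗ[ℝ] E) := h
    have hinj := LinearMap.injective_iff_surjective.2 hsurj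
    obtain ⟨k, hk1, hk2⟩ := hk.self_of_nhds
    exact hk1 (hinj (by simpa using hk2))
  obtain ⟨c, hc⟩ := hc
  let T : E → E →L[ℝ] E := fun x => n x + ξ.smulRight c
  have hTinj : Function.Injective (T p : E →ₗ[ℝ] E) := by
    rw [injective_iff_map_eq_zero]
    intro v hv
    have h1 : n p v + ξ v • c = 0 := hv
    have h2 : ξ v = 0 := by
      by_contra h
      refine hc (-(ξ v)⁻¹ • v) ?_
      rw [map_smul, eq_neg_of_add_eq_zero_left h1, smul_neg, neg_smul, neg_neg, smul_smul,
        inv_mul_cancel₀ h, one_smul]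
    rw [h2, zero_smul, add_zero] at h1
    obtain ⟨s, rfl⟩ := hker v h1
    rw [map_smul, hξ, smul_eq_mul, mul_one] at h2
    rw [h2, zero_smul]
  have hT : SmoothNear T p := by
    filter_upwards [hn] with x hx using hx.add contDiffAt_const
  obtain ⟨H, hH, -, hHT⟩ := hT.exists_inverse
    (A := (LinearEquiv.ofInjectiveEndo (T p : E →ₗ[ℝ] E) hTinj).toContinuousLinearEquiv)
    (by ext v; rfl)
  have key : ∀ᶠ x in 𝓝 p, n x (H x c) = 0 ∧ ξ (H x c) = 1 := by
    filter_upwards [hHT, hk] with x hx ⟨k, hk1, hk2⟩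
    have h1 : T x k = ξ k • c := by simp [T, hk2]
    have h2 : k = ξ k • H x c := by rw [← map_smul, ← h1, hx.1]
    have h3 : ξ k ≠ 0 := fun h => hk1 (by rw [h2, h, zero_smul])
    have h4 : H x c = (ξ k)⁻¹ • k := by
      nth_rw 2 [h2]
      rw [smul_smul, inv_mul_cancel₀ h3, one_smul]
    rw [h4, map_smul, map_smul, hk2, smul_zero, smul_eq_mul, inv_mul_cancel₀ h3]
    exact ⟨rfl, rfl⟩
  refine ⟨⟨fun x => H x c, H, ξ, c, ?_, hH, ?_, ?_, ?_, ?_, ?_⟩⟩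
  · filter_upwards [hH] with x hx using hx.clm_apply contDiffAt_const
  · filter_upwards [key] with x hx using hx.1
  · filter_upwards [key] with x hx using hx.2
  · filter_upwards [key, hHT] with x hx hx' v
    have h1 : T x (v - ξ v • H x c) = n x v := by simp [T, hx.1, hx.2]
    rw [← h1, hx'.1]
  · filter_upwards [hHT] with x hx v using hx.2 v
  · exact Eventually.of_forall fun x => rfl

end Corank

/-! ### Eigenvalues of Nijenhuis operators and the equation `dX ∘ (J - l) = θ`. -/

section Eigenvalue

variable {E : Type} [NormedAddCommGroup E] [NormedSpace ℝ E]
  {J : E → E →L[ℝ] E} {l : E → ℝ} {p : E}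

/-- The operator field `J - l`. -/
noncomputable def shift (J : E → E →L[ℝ] E) (l : E → ℝ) : E → E →L[ℝ] E :=
  fun x => J x - l x • ContinuousLinearMap.id ℝ E

theorem shift_apply (x v : E) : shift J l x v = J x v - l x • v := rfl

theorem SmoothNear.shift (hJ : SmoothNear J p) (hl : SmoothNear l p) :
    SmoothNear (shift J l) p := by
  filter_upwards [hJ, hl] with x h1 h2 using h1.sub (h2.smul contDiffAt_const)

/-- This is `N_J = 0` contracted with the left eigenform, via `apply_nij_of_intertwines` for the
scalar field `m = l`. The left side is `dα((J-l)u, (J-l)v)` multiplied out, the right side `((dl ∘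
(J-l)) ∧ α)(u, v)`. -/
theorem CorankOneData.extd_α (D : CorankOneData (NijenhuisGerm.shift J l) p)
    (hJ : SmoothNear J p) (hl : SmoothNear l p) (hN : ∀ᶠ x in 𝓝 p, ∀ u v, nij J x u v = 0) :
    ∀ᶠ x in 𝓝 p, ∀ u v, extd D.α x (J x u) (J x v)
      - l x * (extd D.α x (J x u) v + extd D.α x u (J x v)) + l x * (l x * extd D.α x u v)
      = (fderiv ℝ l x (J x u) - l x * fderiv ℝ l x u) * D.α x v
        - (fderiv ℝ l x (J x v) - l x * fderiv ℝ l x v) * D.α x u := by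
  have hαJ : ∀ᶠ x in 𝓝 p, ∀ v, D.α x (J x v)
      = (l x • ContinuousLinearMap.id ℝ ℝ) (D.α x v) := by
    filter_upwards [D.α_apply] with x hx v
    have h1 := hx v
    rw [shift_apply, map_sub, map_smul] at h1
    exact sub_eq_zero.1 h1
  filter_upwards [hαJ.eventually_nhds, hJ, hl, hN, D.smooth_α] with x h1 h2 h3 h4 h5 u v
  have hm : HasFDerivAt (fun y => l y • ContinuousLinearMap.id ℝ ℝ)
      ((fderiv ℝ l x).smulRight (ContinuousLinearMap.id ℝ ℝ)) x :=
    HasFDerivAt.smul_const (F := ℝ →L[ℝ] ℝ) h3.diffAt.hasFDerivAt (ContinuousLinearMap.id ℝ ℝ)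
  have h6 := apply_nij_of_intertwines h2.diffAt h5.diffAt hm.differentiableAt h1 u v
  rw [h4, map_zero, hm.fderiv] at h6
  simp only [ContinuousLinearMap.smulRight_apply, smul_apply, ContinuousLinearMap.id_apply,
    smul_eq_mul] at h6
  linarith

/-- A simple eigenvalue `l` of a Nijenhuis operator satisfies `J^* dl = l dl`. -/
theorem CorankOneData.fderiv_eigenvalue (D : CorankOneData (NijenhuisGerm.shift J l) p)
    (hJ : SmoothNear J p) (hl : SmoothNear l p) (hN : ∀ᶠ x in 𝓝 p, ∀ u v, nij J x u v = 0)
    (hs : D.α p (D.k p) ≠ 0) :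
    ∀ᶠ x in 𝓝 p, ∀ u, fderiv ℝ l x (J x u) = l x * fderiv ℝ l x u := by
  have hne : ∀ᶠ x in 𝓝 p, D.α x (D.k x) ≠ 0 := by
    have : ContinuousAt (fun x => D.α x (D.k x)) p :=
      (D.smooth_α.contDiffAt.clm_apply D.smooth_k.contDiffAt).continuousAt
    exact this.eventually_ne hs
  filter_upwards [hne, D.extd_α hJ hl hN, D.apply_k] with x h1 h2 h3 u
  have h4 : J x (D.k x) = l x • D.k x := by
    rw [shift_apply] at h3
    exact sub_eq_zero.1 h3
  -- For `v = k`, where `J k = l k`, all `dα` terms and the second `dl` term cancel; what remains is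
  -- `(dl ∘ (J-l))(u) α(k) = 0`.
  have h5 := h2 u (D.k x)
  rw [h4] at h5
  simp only [extd, map_smul, smul_apply, smul_eq_mul] at h5
  have h6 : (fderiv ℝ l x (J x u) - l x * fderiv ℝ l x u) * D.α x (D.k x) = 0 := by
    linarith
  exact sub_eq_zero.1 ((mul_eq_zero.1 h6).resolve_right h1)

/-- The left eigenvectors of a Nijenhuis operator with eigenvalue `l` are proportional to an exact
form `dz`, and `l` is a function of `z`. -/
theorem CorankOneData.exists_coordinate [FiniteDimensional ℝ E]
    (D : CorankOneData (NijenhuisGerm.shift J l) p)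
    (hJ : SmoothNear J p) (hl : SmoothNear l p) (hN : ∀ᶠ x in 𝓝 p, ∀ u v, nij J x u v = 0)
    (hτ : ∀ᶠ x in 𝓝 p, ∀ u, fderiv ℝ l x (J x u) = l x * fderiv ℝ l x u) :
    ∃ (z : E → ℝ) (g : ℝ → ℝ), SmoothNear z p ∧ SmoothNear g (z p) ∧ fderiv ℝ z p D.c = 1 ∧
      (∀ᶠ x in 𝓝 p, ∀ v, fderiv ℝ z x (J x v) = l x * fderiv ℝ z x v) ∧
      (∀ᶠ x in 𝓝 p, ∀ u, fderiv ℝ z x u = 0 → ∃ v, NijenhuisGerm.shift J l x v = u) ∧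
      ∀ᶠ x in 𝓝 p, l x = g (z x) := by
  have : CompleteSpace E := FiniteDimensional.complete ℝ E
  -- `ker α = im (J-l)`, and `hτ` annihilates the right side of `CorankOneData.extd_α`.
  have hinv : ∀ᶠ x in 𝓝 p, ∀ u v, D.α x u = 0 → D.α x v = 0 →
      fderiv ℝ D.α x u v = fderiv ℝ D.α x v u := by
    filter_upwards [D.exists_of_α_eq_zero, D.extd_α hJ hl hN, hτ] with x h1 h2 h3 u v hu hv
    obtain ⟨u, rfl⟩ := h1 u hu
    obtain ⟨v, rfl⟩ := h1 v hv
    have h4 := h2 u v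
    rw [h3, h3, sub_self, sub_self, zero_mul, zero_mul, sub_self] at h4
    simp only [extd] at h4
    simp only [shift_apply, map_sub, map_smul, sub_apply, smul_apply, smul_eq_mul]
    linarith
  obtain ⟨z, hz, hzp, hzα⟩ := frobenius D.smooth_α
    (R := (ContinuousLinearMap.id ℝ ℝ).smulRight D.c)
    (fun v => by simp [D.α_c.self_of_nhds]) hinv
  have hzc : fderiv ℝ z p D.c = 1 := by rw [hzp, D.α_c.self_of_nhds]
  have hzn : ∀ᶠ x in 𝓝 p, ∀ v, fderiv ℝ z x (NijenhuisGerm.shift J l x v) = 0 := by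
    filter_upwards [hzα, D.α_apply] with x h1 h2 v using h1 _ (h2 v)
  have hzker : ∀ᶠ x in 𝓝 p, ∀ u, fderiv ℝ z x u = 0 →
      ∃ v, NijenhuisGerm.shift J l x v = u := by
    have hne : ∀ᶠ x in 𝓝 p, fderiv ℝ z x D.c ≠ 0 := by
      have : ContinuousAt (fun x => fderiv ℝ z x D.c) p :=
        (hz.differential.contDiffAt.clm_apply contDiffAt_const).continuousAt
      exact this.eventually_ne (by rw [hzc]; exact one_ne_zero)
    filter_upwards [hzα, D.α_c, hne, D.exists_of_α_eq_zero] with x h1 h2 h3 h4 u hu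
    refine h4 u ?_
    have h5 := h1 (u - D.α x u • D.c) (by simp [h2])
    rw [map_sub, hu, map_smul, zero_sub, neg_eq_zero, smul_eq_mul] at h5
    exact (mul_eq_zero.1 h5).resolve_right h3
  -- `ker dz` is contained in `im (J-l)`, on which `dl` vanishes by `hτ`.
  obtain ⟨g, hg, hlg⟩ := hz.exists_factor hl (R := (ContinuousLinearMap.id ℝ ℝ).smulRight D.c)
    (fun v => by simp [hzc]) (by
      filter_upwards [hzker, hτ] with x h1 h2 v hv
      obtain ⟨w, rfl⟩ := h1 v hv
      simp [shift_apply, h2])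
  refine ⟨z, g, hz, hg, hzc, ?_, hzker, hlg⟩
  filter_upwards [hzn] with x hx v
  have h1 := hx v
  rw [shift_apply, map_sub, map_smul] at h1
  exact sub_eq_zero.1 h1

/-- Solving `dX ∘ (J - l) = θ`. -/
theorem CorankOneData.exists_primitive [FiniteDimensional ℝ E]
    (D : CorankOneData (NijenhuisGerm.shift J l) p)
    (hJ : SmoothNear J p) (hl : SmoothNear l p) (hN : ∀ᶠ x in 𝓝 p, ∀ u v, nij J x u v = 0)
    {z : E → ℝ} (hz : SmoothNear z p) {c : E} (hc : fderiv ℝ z p c = 1)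
    (hzker : ∀ᶠ x in 𝓝 p, ∀ u, fderiv ℝ z x u = 0 → ∃ v, NijenhuisGerm.shift J l x v = u)
    (hzJ : ∀ᶠ x in 𝓝 p, ∀ v, fderiv ℝ z x (J x v) = l x * fderiv ℝ z x v)
    (hτ : ∀ᶠ x in 𝓝 p, ∀ u, fderiv ℝ l x (J x u) = l x * fderiv ℝ l x u)
    {θ : E → E →L[ℝ] ℝ} (hθ : SmoothNear θ p) (hθk : ∀ᶠ x in 𝓝 p, θ x (D.k x) = 0)
    (hθd : ∀ᶠ x in 𝓝 p, ∀ u v, extd θ x (J x u) v + extd θ x u (J x v)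
      = l x * extd θ x u v + extd (fun y => (θ y).comp (J y)) x u v) :
    ∃ X : E → ℝ, SmoothNear X p ∧
      ∀ᶠ x in 𝓝 p, ∀ v, fderiv ℝ X x (J x v) = l x * fderiv ℝ X x v + θ x v := by
  -- `H` inverts `J - l` modulo the kernel vector, which `θ` kills, so `γ ∘ (J - l) = θ`.
  let γ : E → E →L[ℝ] ℝ := fun x => (θ x).comp (D.H x)
  have hγ : SmoothNear γ p := by
    filter_upwards [hθ, D.smooth_H] with x h1 h2 using h1.clm_comp h2
  have hγn : ∀ᶠ x in 𝓝 p, ∀ v, γ x (NijenhuisGerm.shift J l x v) = θ x v := by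
    filter_upwards [D.H_apply, hθk] with x h1 h2 v
    simp [γ, h1, h2]
  have hγJ : ∀ᶠ x in 𝓝 p, (γ x).comp (J x) = l x • γ x + θ x := by
    filter_upwards [hγn] with x h1
    ext v
    have h2 := h1 v
    rw [shift_apply, map_sub, map_smul] at h2
    simp only [ContinuousLinearMap.comp_apply, add_apply, smul_apply]
    rw [← h2]
    abel
  have hγJJ : ∀ᶠ x in 𝓝 p, ((γ x).comp (J x)).comp (J x)
      = l x • (γ x).comp (J x) + (θ x).comp (J x) := by
    filter_upwards [hγJ] with x h1
    rw [h1]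
    ext v
    have h2 := DFunLike.congr_fun h1 (J x v)
    have h3 := DFunLike.congr_fun h1 v
    simp only [ContinuousLinearMap.comp_apply, add_apply, smul_apply] at h2 h3 ⊢
    rw [h3]
  -- Vectors tangent to the leaves have the form `(J-l)u`. Contract `N_J = 0` with `γ` and
  -- substitute `γ ∘ J = l γ + θ`: the `dl` terms cancel by `hτ` and the `dθ` terms by `hθd`,
  -- leaving `dγ((J-l)u, (J-l)v) = 0`.
  have hcl : ∀ᶠ x in 𝓝 p, ∀ u v, fderiv ℝ z x u = 0 → fderiv ℝ z x v = 0 →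
      fderiv ℝ γ x u v = fderiv ℝ γ x v u := by
    filter_upwards [hzker, hγJ.eventually_nhds, hγJJ.eventually_nhds, hJ, hl, hN, hθ, hθd, hγ, hτ]
      with x h1 h2 h3 h4 h5 h6 h7 h8 h9 h10 u v hu hv
    obtain ⟨u, rfl⟩ := h1 u hu
    obtain ⟨v, rfl⟩ := h1 v hv
    have e1 := apply_nij h4.diffAt h9.diffAt u v
    have e2 : ∀ u v, extd (fun y => (γ y).comp (J y)) x u v = l x * extd γ x u v
        + fderiv ℝ l x u * γ x v - fderiv ℝ l x v * γ x u + extd θ x u v := fun u v => by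
      have hd : DifferentiableAt ℝ (fun y => l y • γ y) x := (h5.smul h9).diffAt
      rw [extd_congr h2, extd_add hd h7.diffAt, extd_smul h5.diffAt h9.diffAt]
      simp only [smul_eq_mul]
    have e3 : extd (fun y => ((γ y).comp (J y)).comp (J y)) x u v
        = l x * extd (fun y => (γ y).comp (J y)) x u v
        + fderiv ℝ l x u * (γ x).comp (J x) v - fderiv ℝ l x v * (γ x).comp (J x) u
        + extd (fun y => (θ y).comp (J y)) x u v := by
      have h11 := h9.clm_comp h4
      have hd : DifferentiableAt ℝ (fun y => l y • (γ y).comp (J y)) x := (h5.smul h11).diffAt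
      rw [extd_congr h3, extd_add hd (h7.clm_comp h4).diffAt,
        extd_smul h5.diffAt h11.diffAt]
      simp only [smul_eq_mul]
    have e4 := h8 u v
    have e5 : ∀ w, γ x (J x w) = l x * γ x w + θ x w := fun w =>
      DFunLike.congr_fun h2.self_of_nhds w
    rw [h6, map_zero, e3] at e1
    simp only [e2, ContinuousLinearMap.comp_apply, e5, h10] at e1
    have e6 : extd γ x (NijenhuisGerm.shift J l x u) (NijenhuisGerm.shift J l x v)
        = extd γ x (J x u) (J x v) - l x * extd γ x (J x u) v - l x * extd γ x u (J x v)
          + l x * l x * extd γ x u v := by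
      simp only [extd, shift_apply, map_sub, map_smul, sub_apply, smul_apply, smul_eq_mul]
      ring
    refine sub_eq_zero.1 (Eq.trans ?_ (show (0 : ℝ) = 0 from rfl))
    change extd γ x _ _ = 0
    rw [e6]
    linarith
  obtain ⟨X, hX, hXγ⟩ := leaf_poincare hz hc hγ hcl
  refine ⟨X, hX, ?_⟩
  filter_upwards [hXγ, hγn, hzJ] with x h1 h2 h3 v
  have h4 := h1 (NijenhuisGerm.shift J l x v) (by simp [shift_apply, h3])
  rw [h2, shift_apply, map_sub, map_smul, smul_eq_mul] at h4
  linarith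

end Eigenvalue

/-! ### The Beltrami equation: the Neumann series in weighted `L¹`. -/

section Beltrami

open MeasureTheory FourierTransform Convolution ComplexConjugate
open scoped ENNReal

/-- Submultiplicativity distributes the weight over `t` and `x - t`; Tonelli and translation
invariance separate the integrals. Thus weighted `L¹` is a Banach algebra under convolution. -/
theorem lintegral_weight_convolution_le {f g : ℂ → ℂ} (hf : AEStronglyMeasurable f)
    (hg : AEStronglyMeasurable g) {w : ℂ → ℝ≥0∞} (hw : Measurable w)
    (hsub : ∀ x y, w (x + y) ≤ w x * w y) :
    ∫⁻ x, w x * ‖(f ⋆[ContinuousLinearMap.mul ℂ ℂ] g) x‖ₑ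
      ≤ (∫⁻ x, w x * ‖f x‖ₑ) * ∫⁻ x, w x * ‖g x‖ₑ := by
  have hF : AEMeasurable (fun x => w x * ‖f x‖ₑ) := hw.aemeasurable.mul hf.enorm
  have hG : AEMeasurable (fun x => w x * ‖g x‖ₑ) := hw.aemeasurable.mul hg.enorm
  calc ∫⁻ x, w x * ‖(f ⋆[ContinuousLinearMap.mul ℂ ℂ] g) x‖ₑ
      ≤ ∫⁻ x, ∫⁻ t, (w t * ‖f t‖ₑ) * (w (x - t) * ‖g (x - t)‖ₑ) := by
        refine lintegral_mono fun x => ?_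
        calc w x * ‖(f ⋆[ContinuousLinearMap.mul ℂ ℂ] g) x‖ₑ
            ≤ w x * ∫⁻ t, ‖f t‖ₑ * ‖g (x - t)‖ₑ := by
              gcongr
              refine (enorm_integral_le_lintegral_enorm _).trans_eq ?_
              simp [enorm_mul]
          _ ≤ ∫⁻ t, w x * (‖f t‖ₑ * ‖g (x - t)‖ₑ) := lintegral_const_mul_le _ _
          _ ≤ ∫⁻ t, (w t * ‖f t‖ₑ) * (w (x - t) * ‖g (x - t)‖ₑ) := by
              refine lintegral_mono fun t => ?_
              have h := hsub t (x - t)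
              rw [add_sub_cancel] at h
              calc w x * (‖f t‖ₑ * ‖g (x - t)‖ₑ)
                  ≤ (w t * w (x - t)) * (‖f t‖ₑ * ‖g (x - t)‖ₑ) := by gcongr
                _ = _ := by ring
    _ = ∫⁻ t, ∫⁻ x, (w t * ‖f t‖ₑ) * (w (x - t) * ‖g (x - t)‖ₑ) := by
        refine lintegral_lintegral_swap ?_
        exact hF.comp_snd.mul
          (hG.comp_quasiMeasurePreserving (quasiMeasurePreserving_sub volume volume))
    _ = ∫⁻ t, (w t * ‖f t‖ₑ) * ∫⁻ x, w x * ‖g x‖ₑ := by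
        refine lintegral_congr fun t => ?_
        rw [lintegral_const_mul'']
        · rw [lintegral_sub_right_eq_self (fun x => w x * ‖g x‖ₑ) t]
        · exact hG.comp_quasiMeasurePreserving (measurePreserving_sub_right volume t).quasiMeasurePreserving
    _ = _ := lintegral_mul_const'' _ hF

/-- The symbol of the Beurling transform. -/
noncomputable def beurlingSymbol (ξ : ℂ) : ℂ := conj ξ / ξ

theorem measurable_beurlingSymbol : Measurable beurlingSymbol := by
  unfold beurlingSymbol
  exact (Complex.continuous_conj.measurable).div measurable_id

theorem norm_beurlingSymbol_le (ξ : ℂ) : ‖beurlingSymbol ξ‖ ≤ 1 := by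
  rw [beurlingSymbol, norm_div, RCLike.norm_conj]
  exact div_self_le_one _

theorem integrable_beurling {f : ℂ → ℂ} (hf : Integrable f) :
    Integrable (fun ξ => beurlingSymbol ξ * f ξ) :=
  hf.bdd_mul measurable_beurlingSymbol.aestronglyMeasurable
    (Eventually.of_forall norm_beurlingSymbol_le)

/-- The terms of the Neumann series, on the Fourier side. -/
noncomputable def neumannTerm (a : ℂ → ℂ) : ℕ → ℂ → ℂ
  | 0 => a
  | n + 1 => a ⋆[ContinuousLinearMap.mul ℂ ℂ] (fun ξ => beurlingSymbol ξ * neumannTerm a n ξ)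

theorem integrable_neumannTerm {a : ℂ → ℂ} (ha : Integrable a) :
    ∀ n, Integrable (neumannTerm a n)
  | 0 => ha
  | n + 1 => ha.integrable_convolution _ (integrable_beurling (integrable_neumannTerm ha n))

theorem lintegral_neumannTerm_le {a : ℂ → ℂ} (ha : Integrable a) {w : ℂ → ℝ≥0∞}
    (hw : Measurable w) (hsub : ∀ x y, w (x + y) ≤ w x * w y) (n : ℕ) :
    ∫⁻ x, w x * ‖neumannTerm a n x‖ₑ ≤ (∫⁻ x, w x * ‖a x‖ₑ) ^ (n + 1) := by
  induction n with
  | zero => simp [neumannTerm]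
  | succ n ih =>
    have h1 := integrable_neumannTerm ha n
    refine (lintegral_weight_convolution_le ha.1 (integrable_beurling h1).1 hw hsub).trans ?_
    rw [pow_succ' _ (n + 1)]
    gcongr
    refine le_trans (lintegral_mono fun x => ?_) ih
    gcongr
    rw [enorm_mul]
    refine mul_le_of_le_one_left zero_le ?_
    rw [← ofReal_norm, ← ENNReal.ofReal_one]
    exact ENNReal.ofReal_le_ofReal (norm_beurlingSymbol_le x)

theorem lintegral_tsum_neumannTerm_lt {a : ℂ → ℂ} (ha : Integrable a) {w : ℂ → ℝ≥0∞}
    (hw : Measurable w) (hsub : ∀ x y, w (x + y) ≤ w x * w y)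
    (hlt : ∫⁻ x, w x * ‖a x‖ₑ < 1) :
    ∑' n, ∫⁻ x, w x * ‖neumannTerm a n x‖ₑ < (⊤ : ℝ≥0∞) := by
  refine (ENNReal.tsum_le_tsum (lintegral_neumannTerm_le ha hw hsub)).trans_lt ?_
  rw [ENNReal.tsum_geometric_add_one]
  refine ENNReal.mul_lt_top (hlt.trans ENNReal.one_lt_top) ?_
  rw [ENNReal.inv_lt_top]
  exact tsub_pos_of_lt hlt

end Beltrami

/-! ### The Beltrami equation: moments and Fourier transform of the series. -/

section Beltrami

open MeasureTheory FourierTransform Convolution ComplexConjugate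
open scoped ENNReal

/-- A submultiplicative weight of polynomial growth. -/
noncomputable def polyWeight (ε : ℝ) (s : ℕ) (x : ℂ) : ℝ≥0∞ := ENNReal.ofReal ((1 + ε * ‖x‖) ^ s)

theorem measurable_polyWeight (ε : ℝ) (s : ℕ) : Measurable (polyWeight ε s) := by
  unfold polyWeight
  exact ENNReal.measurable_ofReal.comp (by fun_prop)

theorem polyWeight_add_le {ε : ℝ} (hε : 0 ≤ ε) (s : ℕ) (x y : ℂ) :
    polyWeight ε s (x + y) ≤ polyWeight ε s x * polyWeight ε s y := by
  unfold polyWeight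
  rw [← ENNReal.ofReal_mul (by positivity), ← mul_pow]
  apply ENNReal.ofReal_le_ofReal
  gcongr
  have h := mul_le_mul_of_nonneg_left (norm_add_le x y) hε
  have : 0 ≤ (ε * ‖x‖) * (ε * ‖y‖) := by positivity
  nlinarith

/-- Dominated convergence as `ε → 0`: the weights tend to `1` and are bounded by the one with `ε =
1`. A small `ε` gives a weighted norm below `1` for a weight of the same growth, so the series
converges with all moments and no further smallness of `a`. -/
theorem exists_lintegral_polyWeight_lt {a : ℂ → ℂ} (ha : AEStronglyMeasurable a) (s : ℕ)
    (hs : ∫⁻ x, polyWeight 1 s x * ‖a x‖ₑ ≠ (⊤ : ℝ≥0∞)) (hlt : ∫⁻ x, ‖a x‖ₑ < 1) :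
    ∃ ε : ℝ, 0 < ε ∧ ∫⁻ x, polyWeight ε s x * ‖a x‖ₑ < 1 := by
  have hlim : Tendsto (fun n : ℕ => ∫⁻ x, polyWeight (1 / ((n : ℝ) + 1)) s x * ‖a x‖ₑ) atTop
      (𝓝 (∫⁻ x, ‖a x‖ₑ)) := by
    refine tendsto_lintegral_of_dominated_convergence' _
      (fun n => (measurable_polyWeight _ _).aemeasurable.mul ha.enorm)
      (fun n => Eventually.of_forall fun x => ?_) hs (Eventually.of_forall fun x => ?_)
    · refine mul_le_mul' (ENNReal.ofReal_le_ofReal ?_) le_rfl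
      gcongr
      rw [div_le_one (by positivity)]
      linarith [(Nat.cast_nonneg n : (0 : ℝ) ≤ n)]
    · have h1 : Tendsto (fun n : ℕ => polyWeight (1 / ((n : ℝ) + 1)) s x) atTop (𝓝 1) := by
        have h2 : Tendsto (fun n : ℕ => (1 + (1 / ((n : ℝ) + 1)) * ‖x‖) ^ s) atTop
            (𝓝 ((1 + 0 * ‖x‖) ^ s)) :=
          ((tendsto_one_div_add_atTop_nhds_zero_nat.mul_const _).const_add _).pow _
        simpa [polyWeight] using ENNReal.tendsto_ofReal h2
      simpa using ENNReal.Tendsto.mul_const h1 (Or.inl one_ne_zero)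
  obtain ⟨n, hn⟩ := (hlim.eventually (gt_mem_nhds hlt)).exists
  exact ⟨_, by positivity, hn⟩

theorem lintegral_weight_tsum_le {g : ℕ → ℂ → ℂ} (hg : ∀ n, AEStronglyMeasurable (g n))
    {w : ℂ → ℝ≥0∞} (hw : Measurable w) :
    ∫⁻ x, w x * ‖∑' n, g n x‖ₑ ≤ ∑' n, ∫⁻ x, w x * ‖g n x‖ₑ := by
  rw [← lintegral_tsum (f := fun n x => w x * ‖g n x‖ₑ) fun n => hw.aemeasurable.mul (hg n).enorm]
  refine lintegral_mono fun x => ?_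
  rw [ENNReal.tsum_mul_left]
  gcongr
  exact enorm_tsum_le_tsum_enorm

/-- The sum of the Neumann series, on the Fourier side. -/
noncomputable def neumannSum (a : ℂ → ℂ) (x : ℂ) : ℂ := ∑' n, neumannTerm a n x

theorem aestronglyMeasurable_tsum {g : ℕ → ℂ → ℂ} (hg : ∀ n, AEStronglyMeasurable (g n))
    (hs : ∑' n, ∫⁻ x, ‖g n x‖ₑ ≠ (⊤ : ℝ≥0∞)) : AEStronglyMeasurable (fun x => ∑' n, g n x) := by
  rw [← lintegral_tsum fun n => (hg n).enorm] at hs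
  have hsum : ∀ᵐ x, Summable fun n => g n x := by
    filter_upwards [ae_lt_top' (AEMeasurable.tsum fun n => (hg n).enorm) hs] with x hx
    exact Summable.of_enorm hx.ne
  refine aestronglyMeasurable_of_tendsto_ae atTop
    (f := fun (N : ℕ) x => ∑ n ∈ Finset.range N, g n x)
    (fun N => Finset.aestronglyMeasurable_fun_sum _ fun n _ => hg n) ?_
  filter_upwards [hsum] with x hx
  exact hx.hasSum.tendsto_sum_nat

variable {a : ℂ → ℂ}

theorem tsum_neumannTerm_ne_top (ha : Integrable a) (hlt : ∫⁻ x, ‖a x‖ₑ < 1) :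
    ∑' n, ∫⁻ x, ‖neumannTerm a n x‖ₑ ≠ (⊤ : ℝ≥0∞) := by
  have := lintegral_tsum_neumannTerm_lt ha (w := fun _ => 1) measurable_const (by simp)
    (by simpa using hlt)
  simpa using this.ne

theorem aestronglyMeasurable_neumannSum (ha : Integrable a) (hlt : ∫⁻ x, ‖a x‖ₑ < 1) :
    AEStronglyMeasurable (neumannSum a) :=
  aestronglyMeasurable_tsum (fun n => (integrable_neumannTerm ha n).1)
    (tsum_neumannTerm_ne_top ha hlt)

/-- The norm is at most `A + A² + ⋯ = A / (1 - A)`, which is below `1` precisely when `A < 1/2`. -/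
theorem lintegral_neumannSum_lt (ha : Integrable a) (hlt : ∫⁻ x, ‖a x‖ₑ < 1 / 2) :
    ∫⁻ x, ‖neumannSum a x‖ₑ < 1 := by
  set A := ∫⁻ x, ‖a x‖ₑ with hA
  have h1 : ∫⁻ x, ‖neumannSum a x‖ₑ ≤ ∑' n, A ^ (n + 1) := by
    have h2 := lintegral_weight_tsum_le (fun n => (integrable_neumannTerm ha n).1)
      (w := fun _ => 1) measurable_const
    have h3 := fun n => lintegral_neumannTerm_le ha (w := fun _ => 1) measurable_const (by simp) n
    simp only [one_mul] at h2 h3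
    exact h2.trans (ENNReal.tsum_le_tsum h3)
  refine h1.trans_lt ?_
  rw [ENNReal.tsum_geometric_add_one]
  have hA2 : 1 / 2 < 1 - A := by
    rw [lt_tsub_iff_right]
    calc 1 / 2 + A < 1 / 2 + 1 / 2 := by gcongr; simp
      _ = 1 := ENNReal.add_halves 1
  have hne : (1 - A) ≠ 0 := (lt_of_le_of_lt zero_le hA2).ne'
  rw [← div_eq_mul_inv, ENNReal.div_lt_iff (Or.inl hne) (Or.inl (by simp)), one_mul]
  exact hlt.trans hA2

theorem integrable_neumannSum (ha : Integrable a) (hlt : ∫⁻ x, ‖a x‖ₑ < 1 / 2) :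
    Integrable (neumannSum a) :=
  ⟨aestronglyMeasurable_neumannSum ha (hlt.trans (by simp)),
    (lintegral_neumannSum_lt ha hlt).trans ENNReal.one_lt_top⟩

/-- The geometric series is summed in the weight of `exists_lintegral_polyWeight_lt`; since `‖x‖ ≤
ε⁻¹ (1 + ε ‖x‖)`, that weight controls the `s`-th moment. -/
theorem integrable_pow_mul_neumannSum (ha : ∀ s : ℕ, Integrable fun x => (1 + ‖x‖) ^ s * ‖a x‖)
    (ham : AEStronglyMeasurable a) (hlt : ∫⁻ x, ‖a x‖ₑ < 1) (s : ℕ) :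
    Integrable fun x => ‖x‖ ^ s * ‖neumannSum a x‖ := by
  have ha0 : Integrable a := by
    have := ha 0
    simp only [pow_zero, one_mul] at this
    exact (integrable_norm_iff ham).1 this
  obtain ⟨ε, hε, hεlt⟩ := exists_lintegral_polyWeight_lt ham s (by
    have h := (ha s).2
    rw [hasFiniteIntegral_iff_norm] at h
    refine ne_of_lt (lt_of_eq_of_lt ?_ h)
    refine lintegral_congr fun x => ?_
    rw [polyWeight, one_mul, ← ofReal_norm, ← ENNReal.ofReal_mul (by positivity), norm_mul,
      norm_norm, Real.norm_of_nonneg (by positivity)]) hlt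
  have hsum := lintegral_tsum_neumannTerm_lt ha0 (measurable_polyWeight ε s)
    (polyWeight_add_le hε.le s) hεlt
  have hfin := (lintegral_weight_tsum_le (fun n => (integrable_neumannTerm ha0 n).1)
    (measurable_polyWeight ε s)).trans_lt hsum
  have hm := aestronglyMeasurable_neumannSum ha0 hlt
  have hI : Integrable fun x => (1 + ε * ‖x‖) ^ s * ‖neumannSum a x‖ := by
    refine ⟨(by fun_prop : AEStronglyMeasurable fun x : ℂ => (1 + ε * ‖x‖) ^ s).mul hm.norm, ?_⟩
    rw [hasFiniteIntegral_iff_norm]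
    refine lt_of_eq_of_lt (lintegral_congr fun x => ?_) hfin
    rw [polyWeight, ← ofReal_norm, ← ENNReal.ofReal_mul (by positivity), norm_mul,
      norm_norm, Real.norm_of_nonneg (by positivity)]
    rfl
  refine (hI.const_mul (ε⁻¹ ^ s)).mono' ((by fun_prop : AEStronglyMeasurable
    fun x : ℂ => ‖x‖ ^ s).mul hm.norm) (Eventually.of_forall fun x => ?_)
  rw [norm_mul, norm_norm, Real.norm_of_nonneg (by positivity), ← mul_assoc, ← mul_pow]
  gcongr
  rw [mul_add, inv_mul_cancel_left₀ hε.ne']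
  have : 0 < ε⁻¹ := by positivity
  linarith

theorem hasSum_fourier_tsum {g : ℕ → ℂ → ℂ} (hg : ∀ n, Integrable (g n))
    (hs : ∑' n, ∫⁻ x, ‖g n x‖ₑ ≠ (⊤ : ℝ≥0∞)) (y : ℂ) :
    HasSum (fun n => 𝓕 (g n) y) (𝓕 (fun x => ∑' n, g n x) y) := by
  have h1 := hasSum_integral_of_summable_integral_norm
    (F := fun n x => Real.fourierChar (-(inner ℝ x y)) • g n x) (μ := volume) (fun n => by
      have := (Real.fourierIntegral_convergent_iff (μ := volume) (f := g n) y).2 (hg n)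
      exact this) (by
      simp only [Circle.norm_smul]
      have : (fun n => ∫ x, ‖g n x‖) = fun n => (∫⁻ x, ‖g n x‖ₑ).toReal := by
        funext n
        exact integral_norm_eq_lintegral_enorm (hg n).1
      rw [this]
      exact ENNReal.summable_toReal hs)
  have h2 : ∀ x, ∑' n, Real.fourierChar (-(inner ℝ x y)) • g n x
      = Real.fourierChar (-(inner ℝ x y)) • ∑' n, g n x := by
    intro x
    simp only [Circle.smul_def, smul_eq_mul]
    exact tsum_mul_left
  simp only [h2] at h1
  simpa only [Real.fourier_eq] using h1

theorem lintegral_beurlingSymbol_mul_le (f : ℂ → ℂ) :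
    ∫⁻ x, ‖beurlingSymbol x * f x‖ₑ ≤ ∫⁻ x, ‖f x‖ₑ := by
  refine lintegral_mono fun x => ?_
  rw [enorm_mul]
  refine mul_le_of_le_one_left zero_le ?_
  rw [← ofReal_norm, ← ENNReal.ofReal_one]
  exact ENNReal.ofReal_le_ofReal (norm_beurlingSymbol_le x)

/-- The Fourier form of the fixed point equation `f = a + a ⋆ (m f)`, with `m` the Beurling symbol:
transform term by term, where convolution with `a` becomes multiplication, and shift the index. -/
theorem fourier_neumannSum (ha : Integrable a) (hlt : ∫⁻ x, ‖a x‖ₑ < 1) (y : ℂ) :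
    𝓕 (neumannSum a) y = 𝓕 a y * (1 + 𝓕 (fun ξ => beurlingSymbol ξ * neumannSum a ξ) y) := by
  have hi := integrable_neumannTerm ha
  have hs := tsum_neumannTerm_ne_top ha hlt
  have h1 := hasSum_fourier_tsum hi hs y
  have h2 := hasSum_fourier_tsum (fun n => integrable_beurling (hi n))
    (ne_top_of_le_ne_top hs
      (ENNReal.tsum_le_tsum fun n => lintegral_beurlingSymbol_mul_le _)) y
  have h3 := h2.mul_left (𝓕 a y)
  have h4 : ∀ n, 𝓕 a y * 𝓕 (fun ξ => beurlingSymbol ξ * neumannTerm a n ξ) y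
      = 𝓕 (neumannTerm a (n + 1)) y := fun n =>
    (Real.fourier_mul_convolution_eq ha (integrable_beurling (hi n)) y).symm
  simp only [h4] at h3
  have h5 := (hasSum_nat_add_iff' 1).2 h1
  have h6 := h5.unique h3
  simp only [Finset.range_one, Finset.sum_singleton, tsum_mul_left] at h6
  rw [sub_eq_iff_eq_add] at h6
  change 𝓕 (neumannSum a) y = _ at h6
  rw [h6]
  simp only [neumannTerm, neumannSum]
  ring

end Beltrami

/-! ### The Beltrami equation with small coefficient. -/

section Beltrami

open MeasureTheory FourierTransform Convolution ComplexConjugate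
open scoped ENNReal

/-- A primitive, on the Fourier side, of the form `𝓕 (m f) dz + 𝓕 f dz̄`, where `m` is the
Beurling symbol. -/
noncomputable def beurlingPotential (f : ℂ → ℂ) (x : ℂ) : ℂ :=
  ∫ ξ, (-(Real.pi * Complex.I * ξ))⁻¹ * f ξ *
    (Complex.exp (Complex.I * ((-(2 * Real.pi * inner ℝ ξ x) : ℝ) : ℂ)) - 1)

theorem hasFDerivAt_exp_inner (ξ x : ℂ) :
    HasFDerivAt (fun x : ℂ => Complex.exp (Complex.I * ((-(2 * Real.pi * inner ℝ ξ x) : ℝ) : ℂ)))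
      ((Complex.exp (Complex.I * ((-(2 * Real.pi * inner ℝ ξ x) : ℝ) : ℂ)) *
          (-(Real.pi * Complex.I))) •
        (conj ξ • ContinuousLinearMap.id ℝ ℂ + ξ • (Complex.conjCLE : ℂ →L[ℝ] ℂ))) x := by
  have h1 : HasFDerivAt (fun x : ℂ => Complex.I * ((-(2 * Real.pi * inner ℝ ξ x) : ℝ) : ℂ))
      ((-(Real.pi * Complex.I)) •
        (conj ξ • ContinuousLinearMap.id ℝ ℂ + ξ • (Complex.conjCLE : ℂ →L[ℝ] ℂ))) x := by
    have h2 : ∀ x : ℂ, Complex.I * ((-(2 * Real.pi * inner ℝ ξ x) : ℝ) : ℂ)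
        = ((-(Real.pi * Complex.I)) •
        (conj ξ • ContinuousLinearMap.id ℝ ℂ + ξ • (Complex.conjCLE : ℂ →L[ℝ] ℂ))) x := by
      intro x
      apply Complex.ext <;>
        simp [Complex.inner] <;> ring
    exact (ContinuousLinearMap.hasFDerivAt _).congr_of_eventuallyEq (Eventually.of_forall h2)
  have h3 := h1.cexp
  rwa [smul_smul] at h3

theorem fourier_eq_integral_exp (f : ℂ → ℂ) (x : ℂ) :
    𝓕 f x = ∫ ξ, Complex.exp (Complex.I * ((-(2 * Real.pi * inner ℝ ξ x) : ℝ) : ℂ)) * f ξ := by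
  rw [Real.fourier_eq']
  refine integral_congr_ae (Eventually.of_forall fun ξ => ?_)
  simp only [smul_eq_mul]
  congr 2
  push_cast
  ring

theorem hasFDerivAt_beurlingPotential {f : ℂ → ℂ} (hf : Integrable f) (x : ℂ) :
    HasFDerivAt (beurlingPotential f)
      (𝓕 (fun ξ => beurlingSymbol ξ * f ξ) x • ContinuousLinearMap.id ℝ ℂ
        + 𝓕 f x • (Complex.conjCLE : ℂ →L[ℝ] ℂ)) x := by
  set e : ℂ → ℂ → ℂ := fun x ξ =>
    Complex.exp (Complex.I * ((-(2 * Real.pi * inner ℝ ξ x) : ℝ) : ℂ)) with he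
  have hec : ∀ x, Continuous (e x) := fun x => by
    simp only [he]
    fun_prop
  have hen : ∀ x ξ, ‖e x ξ‖ = 1 := fun x ξ => by
    simp only [he]
    rw [mul_comm]
    exact Complex.norm_exp_ofReal_mul_I _
  have hEi : ∀ {g : ℂ → ℂ}, Integrable g → ∀ x, Integrable (fun ξ => e x ξ * g ξ) :=
    fun hg x => hg.bdd_mul (hec x).aestronglyMeasurable (Eventually.of_forall fun ξ => (hen x ξ).le)
  have hmeas : ∀ x, AEStronglyMeasurable
      (fun ξ => (-(Real.pi * Complex.I * ξ))⁻¹ * f ξ * (e x ξ - 1)) := fun x => by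
    refine ((Measurable.aestronglyMeasurable (by fun_prop)).mul hf.1).mul
      ((hec x).sub continuous_const).aestronglyMeasurable
  have hF' : (𝓕 (fun ξ => beurlingSymbol ξ * f ξ) x • ContinuousLinearMap.id ℝ ℂ
        + 𝓕 f x • (Complex.conjCLE : ℂ →L[ℝ] ℂ))
      = ∫ ξ, ((e x ξ * (beurlingSymbol ξ * f ξ)) • ContinuousLinearMap.id ℝ ℂ
        + (e x ξ * f ξ) • (Complex.conjCLE : ℂ →L[ℝ] ℂ)) := by
    rw [integral_add ((hEi (integrable_beurling hf) x).smul_const _) ((hEi hf x).smul_const _),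
      integral_smul_const, integral_smul_const, fourier_eq_integral_exp, fourier_eq_integral_exp]
  rw [hF']
  refine hasFDerivAt_integral_of_dominated_of_fderiv_le (𝕜 := ℝ)
    (F := fun x ξ => (-(Real.pi * Complex.I * ξ))⁻¹ * f ξ * (e x ξ - 1))
    (F' := fun x ξ => ((e x ξ * (beurlingSymbol ξ * f ξ)) • ContinuousLinearMap.id ℝ ℂ
        + (e x ξ * f ξ) • (Complex.conjCLE : ℂ →L[ℝ] ℂ)))
    (bound := fun ξ => ‖f ξ‖ * ‖ContinuousLinearMap.id ℝ ℂ‖ + ‖f ξ‖ * ‖(Complex.conjCLE : ℂ →L[ℝ] ℂ)‖)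
    (s := Set.univ) univ_mem (Eventually.of_forall hmeas) ?_ ?_ ?_ ?_ ?_
  · refine (hf.norm.const_mul (2 * ‖x‖)).mono' (hmeas x) (Eventually.of_forall fun ξ => ?_)
    rcases eq_or_ne ξ 0 with rfl | hξ
    · simp only [mul_zero, neg_zero, inv_zero, zero_mul, norm_zero]; positivity
    -- Subtracting `1` from the exponential makes the bracket `O(‖ξ‖)`, which compensates the pole
    -- of the kernel at `ξ = 0`.
    have h1 : ‖e x ξ - 1‖ ≤ 2 * Real.pi * (‖ξ‖ * ‖x‖) := by
      refine (Real.norm_exp_I_mul_ofReal_sub_one_le).trans ?_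
      rw [norm_neg, norm_mul, Real.norm_of_nonneg (by positivity)]
      gcongr
      exact norm_inner_le_norm ξ x
    have h2 : 0 < ‖ξ‖ := norm_pos_iff.2 hξ
    have hpi := Real.pi_pos
    calc ‖(-(Real.pi * Complex.I * ξ))⁻¹ * f ξ * (e x ξ - 1)‖
        = (Real.pi * ‖ξ‖)⁻¹ * ‖f ξ‖ * ‖e x ξ - 1‖ := by
          simp [abs_of_pos hpi]
      _ ≤ (Real.pi * ‖ξ‖)⁻¹ * ‖f ξ‖ * (2 * Real.pi * (‖ξ‖ * ‖x‖)) := by gcongr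
      _ = 2 * ‖x‖ * ‖f ξ‖ := by field_simp
  · exact ((hEi (integrable_beurling hf) x).smul_const _).1.add ((hEi hf x).smul_const _).1
  · refine Eventually.of_forall fun ξ y _ => (norm_add_le _ _).trans ?_
    rw [norm_smul, norm_smul, norm_mul, norm_mul, norm_mul, hen, one_mul, one_mul]
    gcongr
    exact mul_le_of_le_one_left (norm_nonneg _) (norm_beurlingSymbol_le ξ)
  · exact (hf.norm.mul_const _).add (hf.norm.mul_const _)
  -- At `ξ = 0` the inverse takes the value `0` and the pointwise derivative formula can fail, so
  -- this null set is discarded.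
  · have h0 : ∀ᵐ ξ : ℂ, ξ ≠ 0 := by
      simp [ae_iff, measure_singleton]
    filter_upwards [h0] with ξ hξ y _
    refine (((hasFDerivAt_exp_inner ξ y).sub_const 1).const_mul
      ((-(Real.pi * Complex.I * ξ))⁻¹ * f ξ)).congr_fderiv ?_
    ext v
    have hpi : (Real.pi : ℂ) ≠ 0 := by exact_mod_cast Real.pi_ne_zero
    simp only [beurlingSymbol, he, _root_.add_apply, _root_.smul_apply,
      ContinuousLinearMap.id_apply, smul_eq_mul]
    field_simp

theorem contDiff_fourier_of_integrable_pow {f : ℂ → ℂ}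
    (hf : ∀ s : ℕ, Integrable fun x => ‖x‖ ^ s * ‖f x‖) : ContDiff ℝ ∞ (𝓕 f) :=
  Real.contDiff_fourier fun n _ => hf n

/-- The Beltrami equation with a small Schwartz coefficient. -/
theorem exists_beltrami_of_small (μ : SchwartzMap ℂ ℂ)
    (hlt : ∫⁻ x, ‖𝓕⁻ (μ : ℂ → ℂ) x‖ₑ < 1 / 2) :
    ∃ w k : ℂ → ℂ, ContDiff ℝ ∞ w ∧ (∀ x, k x ≠ 0) ∧
      ∀ x v, fderiv ℝ w x v = k x * (v + μ x * conj v) := by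
  set a : SchwartzMap ℂ ℂ := 𝓕⁻ μ with ha
  have haμ : ∀ x, 𝓕 (a : ℂ → ℂ) x = μ x := fun x => by
    have h : 𝓕 a = μ := by rw [ha]; exact FourierTransform.fourier_fourierInv_eq μ
    rw [← SchwartzMap.fourier_coe, h]
  have haa : (𝓕⁻ (μ : ℂ → ℂ)) = a := by rw [ha, SchwartzMap.fourierInv_coe]
  rw [haa] at hlt
  have hai : Integrable (a : ℂ → ℂ) := a.integrable
  have hlt1 : ∫⁻ x, ‖a x‖ₑ < 1 := hlt.trans (by simp)
  have hmom : ∀ s : ℕ, Integrable fun x => (1 + ‖x‖) ^ s * ‖a x‖ := by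
    intro s
    have : (fun x => (1 + ‖x‖) ^ s * ‖a x‖) = fun x =>
        ∑ m ∈ Finset.range (s + 1), (s.choose m : ℝ) * (‖x‖ ^ (s - m) * ‖a x‖) := by
      funext x
      rw [add_pow, Finset.sum_mul]
      refine Finset.sum_congr rfl fun m _ => ?_
      rw [one_pow]; ring
    rw [this]
    exact integrable_finsetSum _ fun m _ => (a.integrable_pow_mul volume _).const_mul _
  set f := neumannSum a with hf
  have hfi : Integrable f := integrable_neumannSum hai hlt
  have hfm : ∀ s : ℕ, Integrable fun x => ‖x‖ ^ s * ‖f x‖ :=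
    integrable_pow_mul_neumannSum hmom hai.1 hlt1
  set S : ℂ → ℂ := 𝓕 (fun ξ => beurlingSymbol ξ * f ξ) with hS
  set G : ℂ → ℂ := 𝓕 f with hG
  have hGs : ContDiff ℝ ∞ G := contDiff_fourier_of_integrable_pow hfm
  have hSs : ContDiff ℝ ∞ S := contDiff_fourier_of_integrable_pow fun s => by
    refine (hfm s).mono ((by fun_prop : AEStronglyMeasurable fun x : ℂ => ‖x‖ ^ s).mul
      (integrable_beurling hfi).1.norm) (Eventually.of_forall fun x => ?_)
    simp only [norm_mul, norm_norm]
    gcongr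
    exact mul_le_of_le_one_left (norm_nonneg _) (norm_beurlingSymbol_le x)
  have hGS : ∀ x, G x = μ x * (1 + S x) := fun x => by
    rw [← haμ x]
    exact fourier_neumannSum hai hlt1 x
  -- `|S|` is bounded by the `L¹` norm of `f`, which is below `1`. The hypothesis `1 / 2` is used
  -- for this, and it keeps `1 + S` away from zero.
  have hSn : ∀ x, ‖S x‖ < 1 := by
    intro x
    have h1 : ‖S x‖ₑ < 1 := by
      rw [hS, fourier_eq_integral_exp]
      refine (enorm_integral_le_lintegral_enorm _).trans_lt
        (lt_of_le_of_lt ?_ (lintegral_neumannSum_lt hai hlt))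
      refine le_trans (lintegral_mono fun ξ => ?_) (lintegral_beurlingSymbol_mul_le _)
      rw [enorm_mul, ← ofReal_norm, mul_comm Complex.I, Complex.norm_exp_ofReal_mul_I]
      simp
      rfl
    rw [← ofReal_norm, ENNReal.ofReal_lt_one] at h1
    exact h1
  have hd : ∀ x, HasFDerivAt (fun x => x + beurlingPotential f x)
      (ContinuousLinearMap.id ℝ ℂ + (S x • ContinuousLinearMap.id ℝ ℂ
        + G x • (Complex.conjCLE : ℂ →L[ℝ] ℂ))) x := fun x =>
    (hasFDerivAt_id x).add (hasFDerivAt_beurlingPotential hfi x)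
  -- The solution is `w = x + potential`, with `w_z = 1 + S` and `w_z̄ = G = μ (1 + S)`.
  refine ⟨fun x => x + beurlingPotential f x, fun x => 1 + S x, ?_, fun x hx => ?_, fun x v => ?_⟩
  · rw [contDiff_infty_iff_fderiv]
    refine ⟨fun x => (hd x).differentiableAt, ?_⟩
    have : fderiv ℝ (fun x => x + beurlingPotential f x) = fun x =>
      (ContinuousLinearMap.id ℝ ℂ + (S x • ContinuousLinearMap.id ℝ ℂ
        + G x • (Complex.conjCLE : ℂ →L[ℝ] ℂ))) := funext fun x => (hd x).fderiv
    rw [this]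
    exact contDiff_const.add ((hSs.smul contDiff_const).add (hGs.smul contDiff_const))
  · have h1 := hSn x
    rw [eq_neg_of_add_eq_zero_right hx, norm_neg, norm_one] at h1
    exact lt_irrefl _ h1
  · rw [(hd x).fderiv, hGS x]
    simp
    ring

end Beltrami

/-! ### The Beltrami equation: localisation and rescaling. -/

section Beltrami

open MeasureTheory FourierTransform Convolution ComplexConjugate
open scoped ENNReal

/-- Three derivatives bounded in `L¹` give decay of order `3`, which is integrable on the plane.
With `V = vol · C`, order `0` contributes `V`, order `3` contributes `2³ · 4 · V`, and `(1 + t)³ ≤ 4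
(1 + t³)`; hence `132 = 4 · 33`. -/
theorem norm_fourier_le_of_iteratedFDeriv_le {ν : ℂ → ℂ} (hν : ContDiff ℝ ∞ ν) {r C : ℝ}
    (hC : ∀ n ≤ 3, ∀ y, ‖iteratedFDeriv ℝ n ν y‖ ≤ (Metric.closedBall (0 : ℂ) r).indicator (fun _ => C) y)
    (x : ℂ) :
    ‖𝓕 ν x‖ ≤ 132 * (volume.real (Metric.closedBall (0 : ℂ) r) * C) * (1 + ‖x‖) ^ (-(3 : ℝ)) := by
  have hind : Integrable ((Metric.closedBall (0 : ℂ) r).indicator (fun _ => C)) :=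
    (integrable_indicator_iff Metric.isClosed_closedBall.measurableSet).2
      (integrableOn_const (isCompact_closedBall _ _).measure_lt_top.ne)
  have hint : ∀ n ≤ 3, Integrable fun y => ‖iteratedFDeriv ℝ n ν y‖ := fun n hn =>
    hind.mono' ((hν.continuous_iteratedFDeriv (m := n) (by exact_mod_cast le_top)).norm.aestronglyMeasurable)
      (Eventually.of_forall fun y => by rw [norm_norm]; exact hC n hn y)
  set V := volume.real (Metric.closedBall (0 : ℂ) r) * C with hV
  have hle : ∀ n ≤ 3, ∫ y, ‖iteratedFDeriv ℝ n ν y‖ ≤ V := fun n hn => by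
    refine (integral_mono (hint n hn) hind (hC n hn)).trans_eq ?_
    rw [integral_indicator_const _ Metric.isClosed_closedBall.measurableSet, smul_eq_mul]
  have hpow : ∀ n : ℕ, n ≤ 3 → ‖x‖ ^ n * ‖𝓕 ν x‖ ≤ 2 ^ n * ((n + 1) * V) := by
    intro n hn
    have h := Real.pow_mul_norm_iteratedFDeriv_fourier_le (f := ν) (K := 0) (N := 3)
      (hν.of_le (by exact_mod_cast le_top)) (fun k m hk hm => by
        obtain rfl : k = 0 := by simpa using hk
        have hm3 : m ≤ 3 := by exact_mod_cast hm
        simpa using hint m hm3) (k := 0) (n := n) le_rfl (by exact_mod_cast hn) x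
    rw [norm_iteratedFDeriv_zero] at h
    refine h.trans ?_
    simp only [pow_zero, one_mul, CharP.cast_eq_zero, mul_zero, zero_add, Finset.range_one,
      Finset.singleton_product, Finset.sum_map, Function.Embedding.coeFn_mk]
    gcongr
    refine (Finset.sum_le_sum (g := fun _ => V) fun m hm => hle m ?_).trans_eq (by simp)
    exact (Nat.lt_succ_iff.1 (Finset.mem_range.1 hm)).trans hn
  have h0 := hpow 0 (by norm_num)
  have h3 := hpow 3 le_rfl
  norm_num at h0 h3
  rw [Real.rpow_neg (by positivity), ← div_eq_mul_inv, le_div_iff₀ (by positivity)]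
  have hcast : (1 + ‖x‖) ^ (3 : ℝ) = (1 + ‖x‖) ^ 3 := by
    rw [← Real.rpow_natCast]; norm_num
  rw [hcast]
  have hx := norm_nonneg x
  have hcube : (1 + ‖x‖) ^ 3 ≤ 4 * (1 + ‖x‖ ^ 3) := by
    nlinarith [mul_nonneg (add_nonneg zero_le_one hx) (sq_nonneg (‖x‖ - 1))]
  calc ‖𝓕 ν x‖ * (1 + ‖x‖) ^ 3 ≤ ‖𝓕 ν x‖ * (4 * (1 + ‖x‖ ^ 3)) := by gcongr
    _ = 4 * (‖𝓕 ν x‖ + ‖x‖ ^ 3 * ‖𝓕 ν x‖) := by ring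
    _ ≤ 132 * V := by linarith

/-- Zooming in makes the cut-off coefficient `O(δ)` in `C³`. The order zero bound is the mean value
inequality with `G 0 = 0`; each higher order gains `δⁿ ≤ δ` from the chain rule. The factor `8 = 2³`
is the sum of the binomial coefficients in the Leibniz rule. -/
theorem exists_iteratedFDeriv_mul_comp_smul_le {G χ : ℂ → ℂ} (hG : ContDiff ℝ ∞ G) (hG0 : G 0 = 0)
    (hχ : ContDiff ℝ ∞ χ) {r : ℝ} (hr : 0 ≤ r) (hsupp : tsupport χ ⊆ Metric.closedBall 0 r) :
    ∃ C, 0 ≤ C ∧ ∀ δ : ℝ, 0 < δ → δ ≤ 1 → ∀ n ≤ 3, ∀ y,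
      ‖iteratedFDeriv ℝ n (fun y => χ y * G (δ • y)) y‖
        ≤ (Metric.closedBall (0 : ℂ) r).indicator (fun _ => C * δ) y := by
  have hK := isCompact_closedBall (0 : ℂ) r
  have hbound : ∀ f : ℂ → ℂ, ContDiff ℝ ∞ f → ∃ M, 0 ≤ M ∧ ∀ n ≤ 3, ∀ y ∈ Metric.closedBall (0 : ℂ) r,
      ‖iteratedFDeriv ℝ n f y‖ ≤ M := by
    intro f hf
    have hc : ∀ n : ℕ, ∃ M, ∀ y ∈ Metric.closedBall (0 : ℂ) r, ‖iteratedFDeriv ℝ n f y‖ ≤ M :=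
      fun n => hK.exists_bound_of_continuousOn
        (hf.continuous_iteratedFDeriv (m := n) (by exact_mod_cast le_top)).continuousOn
    choose M hM using hc
    refine ⟨∑ n ∈ Finset.range 4, |M n|, Finset.sum_nonneg fun _ _ => abs_nonneg _,
      fun n hn y hy => ((hM n y hy).trans (le_abs_self _)).trans ?_⟩
    exact Finset.single_le_sum (f := fun n => |M n|) (fun _ _ => abs_nonneg _)
      (Finset.mem_range.2 (Nat.lt_succ_of_le hn))
  obtain ⟨A, hA0, hA⟩ := hbound χ hχ
  obtain ⟨B, hB0, hB⟩ := hbound G hG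
  have hscale : ∀ δ : ℝ, 0 < δ → δ ≤ 1 → ∀ n ≤ 3, ∀ y ∈ Metric.closedBall (0 : ℂ) r,
      ‖iteratedFDeriv ℝ n (fun y => G (δ • y)) y‖ ≤ (B * (r + 1)) * δ := by
    intro δ hδ hδ1 n hn y hy
    have hyδ : δ • y ∈ Metric.closedBall (0 : ℂ) r := by
      rw [mem_closedBall_zero_iff] at hy ⊢
      rw [norm_smul, Real.norm_of_nonneg hδ.le]
      exact (mul_le_of_le_one_left (norm_nonneg _) hδ1).trans hy
    rcases Nat.eq_zero_or_pos n with rfl | hn0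
    · rw [norm_iteratedFDeriv_zero]
      have h := (convex_closedBall (0 : ℂ) r).norm_image_sub_le_of_norm_fderiv_le (𝕜 := ℝ) (f := G)
        (fun z _ => hG.differentiable (by simp) z)
        (fun z hz => (norm_iteratedFDeriv_one (𝕜 := ℝ) G (x := z)).symm.trans_le (hB 1 (by norm_num) z hz))
        (Metric.mem_closedBall_self hr) hyδ
      rw [hG0, sub_zero, sub_zero, norm_smul, Real.norm_of_nonneg hδ.le] at h
      rw [mem_closedBall_zero_iff] at hy
      calc ‖G (δ • y)‖ ≤ B * (δ * ‖y‖) := h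
        _ ≤ B * (δ * (r + 1)) := by gcongr; linarith
        _ = _ := by ring
    · rw [iteratedFDeriv_comp_const_smul δ (hG.of_le (by exact_mod_cast le_top)), norm_smul, norm_pow,
        Real.norm_of_nonneg hδ.le]
      calc δ ^ n * ‖iteratedFDeriv ℝ n G (δ • y)‖ ≤ δ * B := by
            gcongr
            · exact pow_le_of_le_one hδ.le hδ1 hn0.ne'
            · exact hB n hn _ hyδ
        _ ≤ (B * (r + 1)) * δ := by nlinarith [mul_nonneg (mul_nonneg hB0 hr) hδ.le]
  refine ⟨8 * A * (B * (r + 1)), by positivity, fun δ hδ hδ1 n hn y => ?_⟩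
  by_cases hy : y ∈ Metric.closedBall (0 : ℂ) r
  · rw [Set.indicator_of_mem hy]
    have hGδ : ContDiff ℝ ∞ fun y : ℂ => G (δ • y) := hG.comp (contDiff_const_smul δ)
    refine (norm_iteratedFDeriv_mul_le (N := ∞) hχ hGδ y (n := n) (by exact_mod_cast le_top)).trans ?_
    calc ∑ i ∈ Finset.range (n + 1), (n.choose i : ℝ) * ‖iteratedFDeriv ℝ i χ y‖ *
          ‖iteratedFDeriv ℝ (n - i) (fun y : ℂ => G (δ • y)) y‖
        ≤ ∑ i ∈ Finset.range (n + 1), (n.choose i : ℝ) * (A * ((B * (r + 1)) * δ)) := by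
          refine Finset.sum_le_sum fun i hi => ?_
          have hi' := Nat.lt_succ_iff.1 (Finset.mem_range.1 hi)
          rw [mul_assoc]
          gcongr
          · exact hA i (hi'.trans hn) y hy
          · exact hscale δ hδ hδ1 _ ((Nat.sub_le _ _).trans hn) y hy
      _ = 2 ^ n * (A * ((B * (r + 1)) * δ)) := by
          rw [← Finset.sum_mul, ← Nat.cast_sum, Nat.sum_range_choose]; push_cast; rfl
      _ ≤ 2 ^ 3 * (A * ((B * (r + 1)) * δ)) := by
          gcongr
          norm_num
      _ = _ := by ring
  · rw [Set.indicator_of_notMem hy]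
    have h0 : y ∉ tsupport (iteratedFDeriv ℝ n fun y => χ y * G (δ • y)) := fun h =>
      hy (hsupp (tsupport_mul_subset_left (tsupport_iteratedFDeriv_subset n h)))
    rw [image_eq_zero_of_notMem_tsupport h0, norm_zero]

/-- The Beltrami equation has local solutions with non-vanishing Jacobian. -/
theorem exists_beltrami {μ : ℂ → ℂ} {q : ℂ} (hμ : SmoothNear μ q) (hq : μ q = 0) :
    ∃ w k : ℂ → ℂ, ContDiff ℝ ∞ w ∧ (∀ x, k x ≠ 0) ∧
      ∀ᶠ x in 𝓝 q, ∀ v, fderiv ℝ w x v = k x * (v + μ x * conj v) := by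
  obtain ⟨g, hg, hgμ⟩ := hμ.exists_contDiff
  let b : ContDiffBump (0 : ℂ) := ⟨1, 2, by norm_num, by norm_num⟩
  set χ : ℂ → ℂ := fun y => (b y : ℂ) with hχdef
  have hχ : ContDiff ℝ ∞ χ := Complex.ofRealCLM.contDiff.comp b.contDiff
  have hsupp : tsupport χ ⊆ Metric.closedBall 0 2 := by
    have h1 : Function.support χ ⊆ Function.support b := fun x hx => by
      simpa [hχdef] using hx
    exact (closure_mono h1).trans (by rw [b.support_eq]; exact Metric.closure_ball_subset_closedBall)
  set G : ℂ → ℂ := fun y => g (q + y) with hGdef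
  have hG : ContDiff ℝ ∞ G := hg.comp (contDiff_const.add contDiff_id)
  have hG0 : G 0 = 0 := by simp only [hGdef, add_zero]; rw [hgμ.self_of_nhds, hq]
  obtain ⟨C, hC0, hC⟩ := exists_iteratedFDeriv_mul_comp_smul_le hG hG0 hχ (by norm_num) hsupp
  set V := volume.real (Metric.closedBall (0 : ℂ) 2) with hV
  set I := ∫ x : ℂ, (1 + ‖x‖) ^ (-(3 : ℝ)) with hI
  have hIi : Integrable fun x : ℂ => (1 + ‖x‖) ^ (-(3 : ℝ)) :=
    integrable_one_add_norm (by rw [Complex.finrank_real_complex]; norm_num)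
  have hI0 : 0 ≤ I := integral_nonneg fun x => by positivity
  have hV0 : 0 ≤ V := measureReal_nonneg
  -- Chosen so that `132 V C δ I < 1/2`; the summand `3` makes this strict and ensures `δ ≤ 1`.
  set δ : ℝ := 1 / (264 * (V * C) * I + 3) with hδdef
  have hden : 0 < 264 * (V * C) * I + 3 := by positivity
  have hδ : 0 < δ := by positivity
  have hδ1 : δ ≤ 1 := by
    rw [hδdef, div_le_one hden]
    have : 0 ≤ 264 * (V * C) * I := by positivity
    linarith
  have hGδ : ContDiff ℝ ∞ fun y : ℂ => χ y * G (δ • y) := hχ.mul (hG.comp (contDiff_const_smul δ))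
  have hcs : HasCompactSupport fun y : ℂ => χ y * G (δ • y) :=
    HasCompactSupport.intro (isCompact_closedBall (0 : ℂ) 2) fun x hx => by
      rw [image_eq_zero_of_notMem_tsupport fun h => hx (hsupp h), zero_mul]
  have hsmall : ∫⁻ x, ‖𝓕⁻ (fun y : ℂ => χ y * G (δ • y)) x‖ₑ < 1 / 2 := by
    have h1 : ∀ x, ‖𝓕⁻ (fun y : ℂ => χ y * G (δ • y)) x‖ₑ
        ≤ ENNReal.ofReal (132 * (V * (C * δ)) * (1 + ‖x‖) ^ (-(3 : ℝ))) := fun x => by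
      rw [Real.fourierInv_eq_fourier_neg, ← ofReal_norm]
      refine ENNReal.ofReal_le_ofReal ?_
      have := norm_fourier_le_of_iteratedFDeriv_le hGδ (hC δ hδ hδ1) (-x)
      rwa [norm_neg] at this
    refine (lintegral_mono h1).trans_lt ?_
    rw [← ofReal_integral_eq_lintegral_ofReal (hIi.const_mul _)
      (Eventually.of_forall fun x => by positivity), integral_const_mul]
    have h2 : (1 / 2 : ℝ≥0∞) = ENNReal.ofReal (1 / 2) := by
      rw [ENNReal.ofReal_div_of_pos (by norm_num)]; simp
    rw [h2, ENNReal.ofReal_lt_ofReal_iff (by norm_num)]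
    have h3 : 132 * (V * (C * δ)) * I = (132 * (V * C) * I) / (264 * (V * C) * I + 3) := by
      rw [hδdef]; ring
    change 132 * (V * (C * δ)) * I < _
    rw [h3, div_lt_iff₀ hden]
    linarith
  obtain ⟨w, k, hw, hk, hwk⟩ := exists_beltrami_of_small (hcs.toSchwartzMap hGδ) hsmall
  have haff : ∀ x, HasFDerivAt (fun x : ℂ => δ⁻¹ • (x - q)) (δ⁻¹ • ContinuousLinearMap.id ℝ ℂ) x :=
    fun x => ((hasFDerivAt_id x).sub_const q).const_smul δ⁻¹
  refine ⟨fun x => w (δ⁻¹ • (x - q)), fun x => δ⁻¹ * k (δ⁻¹ • (x - q)),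
    hw.comp ((contDiff_id.sub contDiff_const).const_smul δ⁻¹),
    fun x => mul_ne_zero (by simpa using hδ.ne') (hk _), ?_⟩
  have hnear : ∀ᶠ x in 𝓝 q, ‖δ⁻¹ • (x - q)‖ < 1 := by
    have hc : Continuous fun x : ℂ => ‖δ⁻¹ • (x - q)‖ := by fun_prop
    exact hc.continuousAt.eventually_lt continuousAt_const (by simp)
  filter_upwards [hnear, hgμ] with x hx hxg v
  have h1 := ((hw.differentiable (by simp) (δ⁻¹ • (x - q))).hasFDerivAt.comp x (haff x)).fderiv
  have h2 : fderiv ℝ (fun x => w (δ⁻¹ • (x - q))) x v = fderiv ℝ w (δ⁻¹ • (x - q)) (δ⁻¹ • v) := by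
    have : (fun x => w (δ⁻¹ • (x - q))) = w ∘ fun x => δ⁻¹ • (x - q) := rfl
    rw [this, h1]; rfl
  have h3 : χ (δ⁻¹ • (x - q)) * G (δ • δ⁻¹ • (x - q)) = μ x := by
    have : b (δ⁻¹ • (x - q)) = 1 := b.one_of_mem_closedBall (by
      rw [mem_closedBall_zero_iff]; exact hx.le)
    simp only [hχdef, hGdef, this, smul_inv_smul₀ hδ.ne', add_sub_cancel, hxg, Complex.ofReal_one,
      one_mul]
  rw [h2, map_smul, hwk]
  change δ⁻¹ • (k (δ⁻¹ • (x - q)) * (v + χ (δ⁻¹ • (x - q)) * G (δ • δ⁻¹ • (x - q)) * conj v)) = _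
  rw [h3, Complex.real_smul]
  push_cast
  ring

end Beltrami

/-! ### Persistence of simple real eigenvalues. -/

section SimpleEigenvalue

variable {E : Type} [NormedAddCommGroup E] [NormedSpace ℝ E]

theorem injective_near [FiniteDimensional ℝ E] {F X : Type} [NormedAddCommGroup F]
    [NormedSpace ℝ F] [TopologicalSpace X] {H : X → E →L[ℝ] F} {p : X} (h : ContinuousAt H p)
    (hp : ∀ v, H p v = 0 → v = 0) : ∀ᶠ x in 𝓝 p, ∀ v, H x v = 0 → v = 0 := by
  have hinj : Function.Injective (H p) := (injective_iff_map_eq_zero (H p)).2 hp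
  have := h.eventually (ContinuousLinearMap.isOpen_injective.mem_nhds hinj)
  filter_upwards [this] with x hx using (injective_iff_map_eq_zero (H x)).1 hx

theorem exists_equiv_of_injective [FiniteDimensional ℝ E] {F : Type} [NormedAddCommGroup F]
    [NormedSpace ℝ F] [FiniteDimensional ℝ F] (hd : Module.finrank ℝ E = Module.finrank ℝ F)
    {A : E →L[ℝ] F} (hA : ∀ v, A v = 0 → v = 0) : ∃ B : E ≃L[ℝ] F, A = B := by
  let B := (LinearMap.linearEquivOfInjective (A : E →ₗ[ℝ] F)
    ((injective_iff_map_eq_zero A).2 hA) hd).toContinuousLinearEquiv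
  exact ⟨B, by ext v; rfl⟩

/-- A simple real eigenvalue persists and depends smoothly on the point. -/
theorem exists_simple_eigenvalue [FiniteDimensional ℝ E] {J : E → E →L[ℝ] E} {p : E}
    (hJ : SmoothNear J p) {l₀ : ℝ} {k₀ : E} (hk₀ : k₀ ≠ 0) (heig : J p k₀ = l₀ • k₀)
    (hker : ∀ v, J p v = l₀ • v → ∃ s : ℝ, v = s • k₀) (him : ∀ v, J p v - l₀ • v ≠ k₀) :
    ∃ l : E → ℝ, SmoothNear l p ∧ l p = l₀ ∧
      ∃ D : CorankOneData (shift J l) p, D.α p (D.k p) ≠ 0 := by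
  have : CompleteSpace E := FiniteDimensional.complete ℝ E
  obtain ⟨ξ, hξ⟩ := SeparatingDual.exists_eq_one (R := ℝ) hk₀
  -- The eigenvector normalised by `ξ v = 1` and the eigenvalue are found together as an implicit
  -- function.
  let f : E × (E × ℝ) → E × ℝ := fun y => (J y.1 y.2.1 - y.2.2 • y.2.1, ξ y.2.1)
  have hf : SmoothNear f (p, (k₀, l₀)) := by
    have h1 : ∀ᶠ y : E × (E × ℝ) in 𝓝 (p, (k₀, l₀)), ContDiffAt ℝ ∞ J y.1 :=
      (continuous_fst.continuousAt (x := (p, (k₀, l₀)))).eventually hJ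
    filter_upwards [h1] with y hy
    have h2 : ContDiffAt ℝ ∞ (fun y : E × (E × ℝ) => J y.1) y := hy.comp y contDiffAt_fst
    have h3 : ContDiffAt ℝ ∞ (fun y : E × (E × ℝ) => y.2.1) y := by fun_prop
    have h4 : ContDiffAt ℝ ∞ (fun y : E × (E × ℝ) => y.2.2) y := by fun_prop
    have h5 : ContDiffAt ℝ ∞ (fun y : E × (E × ℝ) => ξ y.2.1) y := by fun_prop
    exact ((h2.clm_apply h3).sub (h4.smul h3)).prodMk h5
  let C' : (E × ℝ) →L[ℝ] (E × ℝ) :=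
    ((J p - l₀ • ContinuousLinearMap.id ℝ E).comp (ContinuousLinearMap.fst ℝ E ℝ)
      - (ContinuousLinearMap.snd ℝ E ℝ).smulRight k₀).prod (ξ.comp (ContinuousLinearMap.fst ℝ E ℝ))
  have hC' : ∀ v, C' v = (J p v.1 - l₀ • v.1 - v.2 • k₀, ξ v.1) := fun v => rfl
  -- Simplicity makes the partial derivative injective: `k₀` is not in the image of `J p - l₀`,
  -- which forces `s = 0`, and then `v` is a multiple of `k₀` with `ξ v = 0`.
  have hCinj : ∀ v, C' v = 0 → v = 0 := by
    rintro ⟨v, s⟩ hv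
    rw [hC'] at hv
    obtain ⟨h1, h2⟩ := Prod.mk.inj hv
    simp only at h1 h2
    have hs : s = 0 := by
      by_contra hs
      refine him (s⁻¹ • v) ?_
      rw [map_smul, smul_comm, ← smul_sub, sub_eq_zero.1 h1, inv_smul_smul₀ hs]
    subst hs
    rw [zero_smul, sub_zero] at h1
    obtain ⟨t, rfl⟩ := hker v (sub_eq_zero.1 h1)
    rw [map_smul, hξ, smul_eq_mul, mul_one] at h2
    simp [h2]
  obtain ⟨C, hC⟩ := exists_equiv_of_injective rfl hCinj
  have hder : ∀ v, fderiv ℝ f (p, (k₀, l₀)) (0, v) = C v := fun v => by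
    have h1 : HasFDerivAt (fun y : E × ℝ => (p, y)) (ContinuousLinearMap.inr ℝ E (E × ℝ)) (k₀, l₀) :=
      hasFDerivAt_prodMk_right p (k₀, l₀)
    have h2 := (hf.contDiffAt.diffAt.hasFDerivAt.comp (k₀, l₀) h1)
    have hfst : HasFDerivAt (fun y : E × ℝ => y.1) (ContinuousLinearMap.fst ℝ E ℝ) (k₀, l₀) :=
      hasFDerivAt_fst
    have hsnd : HasFDerivAt (fun y : E × ℝ => y.2) (ContinuousLinearMap.snd ℝ E ℝ) (k₀, l₀) :=
      hasFDerivAt_snd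
    have h3 : HasFDerivAt (fun y : E × ℝ => ((J p y.1 - y.2 • y.1, ξ y.1) : E × ℝ)) C' (k₀, l₀) := by
      have h4 := (((J p).hasFDerivAt.comp (k₀, l₀) hfst).sub (hsnd.smul hfst)).prodMk
        (ξ.hasFDerivAt.comp (k₀, l₀) hfst)
      refine h4.congr_fderiv ?_
      refine ContinuousLinearMap.ext fun v => ?_
      rw [hC']
      refine Prod.ext ?_ rfl
      simp [sub_sub]
    have h5 := h2.unique h3
    exact DFunLike.congr_fun (h5.trans hC) v
  obtain ⟨ψ, hψ, hψp, hψf⟩ := hf.exists_implicit hder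
  have hl : SmoothNear (fun x => (ψ x).2) p := by
    filter_upwards [hψ] with x hx using contDiffAt_snd.comp x hx
  have hfp : f (p, (k₀, l₀)) = (0, 1) := by simp [f, heig, hξ]
  have hshift : shift J (fun x => (ψ x).2) p = J p - l₀ • ContinuousLinearMap.id ℝ E := by
    simp [shift, hψp]
  obtain ⟨D⟩ := CorankOneData.nonempty (hJ.shift hl) hk₀ (fun v hv => hker v (by
      rw [hshift] at hv
      exact sub_eq_zero.1 hv)) (by
    filter_upwards [hψf] with x hx
    rw [hfp] at hx
    obtain ⟨h1, h2⟩ := Prod.mk.inj hx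
    refine ⟨(ψ x).1, fun h0 => ?_, h1⟩
    simp only [h0, map_zero] at h2
    exact zero_ne_one h2)
  refine ⟨fun x => (ψ x).2, hl, by simp [hψp], D, fun h0 => ?_⟩
  -- If `α(k) = 0`, the eigenvector would lie in the image of `J p - l₀`, against `him`.
  obtain ⟨v, hv⟩ := D.exists_of_α_eq_zero.self_of_nhds _ h0
  have hDk := D.apply_k.self_of_nhds
  rw [hshift] at hv hDk
  obtain ⟨s, hs⟩ := hker _ (sub_eq_zero.1 hDk)
  have hs0 : s ≠ 0 := by
    rintro rfl
    have := D.ξ_k.self_of_nhds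
    rw [hs, zero_smul, map_zero] at this
    exact zero_ne_one this
  refine him (s⁻¹ • v) ?_
  have hv' : J p v - l₀ • v = s • k₀ := hv.trans hs
  rw [map_smul, smul_comm, ← smul_sub, hv', inv_smul_smul₀ hs0]

end SimpleEigenvalue

/-! ### Charts assembled from coordinate functions. -/

section Charts

theorem exists_smoothChart {F : E3 → E3} {p : E3} (hF : SmoothNear F p)
    (hinj : ∀ v, fderiv ℝ F p v = 0 → v = 0) {P : E3 → Prop} (hP : ∀ᶠ x in 𝓝 p, P x) :
    ∃ φ : OpenPartialHomeomorph E3 E3, IsSmoothChartAt φ p ∧ (φ : E3 → E3) = F ∧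
      ∀ x ∈ φ.source, P x := by
  obtain ⟨B, hB⟩ := exists_equiv_of_injective rfl hinj
  obtain ⟨φ, r, -, hp, -, he, h1, h2⟩ := hF.exists_chart hB hP
  have he' : (φ : E3 → E3) = F := funext he
  refine ⟨φ, ⟨hp, fun x hx => ?_, fun y hy => (h2 y hy).contDiffWithinAt⟩, he', fun x hx => (h1 x hx).1⟩
  rw [he']
  exact (h1 x hx).2.contDiffWithinAt

theorem contDiffOn_coordRange {φ : OpenPartialHomeomorph E3 E3} {i : Fin 3} {g : ℝ → ℝ}
    (h : ∀ x ∈ φ.source, ContDiffAt ℝ ∞ g (φ x i)) : ContDiffOn ℝ ∞ g (coordRange φ i) := by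
  rintro _ ⟨y, hy, rfl⟩
  have := h _ (φ.map_target hy)
  rw [φ.right_inv hy] at this
  exact this.contDiffWithinAt

theorem forall_target {φ : OpenPartialHomeomorph E3 E3} {P : E3 → Prop}
    (h : ∀ x ∈ φ.source, P (φ x)) : ∀ y ∈ φ.target, P y := fun y hy => by
  have := h _ (φ.map_target hy)
  rwa [φ.right_inv hy] at this

variable {f₁ f₂ f₃ : E3 → ℝ} {p : E3}

theorem SmoothNear.vec3 (h₁ : SmoothNear f₁ p) (h₂ : SmoothNear f₂ p) (h₃ : SmoothNear f₃ p) :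
    SmoothNear (fun x => (![f₁ x, f₂ x, f₃ x] : E3)) p := by
  filter_upwards [h₁, h₂, h₃] with x a b c
  refine contDiffAt_pi.2 fun i => ?_
  fin_cases i
  exacts [a, b, c]

theorem fderiv_vec3 {x : E3} (h₁ : DifferentiableAt ℝ f₁ x) (h₂ : DifferentiableAt ℝ f₂ x)
    (h₃ : DifferentiableAt ℝ f₃ x) (v : E3) :
    fderiv ℝ (fun x => (![f₁ x, f₂ x, f₃ x] : E3)) x v
      = ![fderiv ℝ f₁ x v, fderiv ℝ f₂ x v, fderiv ℝ f₃ x v] := by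
  have h : HasFDerivAt (fun x => (![f₁ x, f₂ x, f₃ x] : E3))
      (ContinuousLinearMap.pi ![fderiv ℝ f₁ x, fderiv ℝ f₂ x, fderiv ℝ f₃ x]) x := by
    refine hasFDerivAt_pi.2 fun i => ?_
    fin_cases i
    exacts [h₁.hasFDerivAt, h₂.hasFDerivAt, h₃.hasFDerivAt]
  rw [h.fderiv]
  ext i
  fin_cases i <;> rfl

end Charts

/-! ### Isothermal coordinates and holomorphy. -/

section ComplexCase

open ComplexConjugate

/-- The complex linear part of a real linear endomorphism of `ℂ`. -/
noncomputable def linPart (T : ℂ →L[ℝ] ℂ) : ℂ := (T 1 - Complex.I * T Complex.I) / 2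

/-- The antilinear part of a real linear endomorphism of `ℂ`. -/
noncomputable def antiPart (T : ℂ →L[ℝ] ℂ) : ℂ := (T 1 + Complex.I * T Complex.I) / 2

theorem apply_eq_linPart_add_antiPart (T : ℂ →L[ℝ] ℂ) (h : ℂ) :
    T h = linPart T * h + antiPart T * conj h := by
  have h1 : h = h.re • (1 : ℂ) + h.im • Complex.I := by
    apply Complex.ext <;> simp
  have h2 : T h = h.re * T 1 + h.im * T Complex.I := by
    conv_lhs => rw [h1, map_add, map_smul, map_smul]
    simp
  have h3 : h = h.re + h.im * Complex.I := (Complex.re_add_im h).symm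
  have h4 : conj h = h.re - h.im * Complex.I := by
    apply Complex.ext <;> simp
  rw [h2, linPart, antiPart, h4]
  conv_rhs => enter [1]; rw [h3]
  have := Complex.I_mul_I
  linear_combination ((h.im : ℂ) * T Complex.I) * this

/-- Diagonalisation of a real linear endomorphism of `ℂ` whose complex linear part dominates. -/
theorem beltrami_coefficient {A B : ℂ} (hA : 0 < A.im) (hAB : ‖B‖ ^ 2 < A.im ^ 2) :
    let b := Real.sqrt (A.im ^ 2 - ‖B‖ ^ 2)
    let μ := B / (Complex.I * ((b + A.im : ℝ) : ℂ))
    0 < (A + μ * conj B).im ∧ B + μ * conj A = (A + μ * conj B) * μ := by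
  -- For `T h = A h + B conj h`, the form `dz + μ dz̄` is a left eigenform when `conj B μ² + 2i (Im
  -- A) μ - B = 0`. This `μ` is the root that vanishes with `B`, rationalised so that it is smooth
  -- also where `B = 0`; the eigenvalue has imaginary part `b`.
  intro b μ
  have hb : 0 < b := Real.sqrt_pos.2 (by linarith)
  have hb2 : b ^ 2 = A.im ^ 2 - ‖B‖ ^ 2 := Real.sq_sqrt (by linarith)
  have hne : ((b + A.im : ℝ) : ℂ) ≠ 0 := by
    have : b + A.im ≠ 0 := by positivity
    exact_mod_cast this
  have hBB : B * conj B = ((A.im ^ 2 - b ^ 2 : ℝ) : ℂ) := by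
    rw [Complex.mul_conj, Complex.normSq_eq_norm_sq, hb2]
    push_cast
    ring
  have hμB : μ * conj B = -Complex.I * ((A.im - b : ℝ) : ℂ) := by
    have h1 : μ * conj B = (B * conj B) / (Complex.I * ((b + A.im : ℝ) : ℂ)) := by
      simp only [μ]; ring
    rw [h1, hBB, div_eq_iff (mul_ne_zero Complex.I_ne_zero hne)]
    push_cast
    linear_combination ((A.im - b) * (b + A.im) : ℂ) * Complex.I_mul_I
  have hμ : μ * (Complex.I * ((b + A.im : ℝ) : ℂ)) = B :=
    div_mul_cancel₀ _ (mul_ne_zero Complex.I_ne_zero hne)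
  refine ⟨?_, ?_⟩
  · rw [hμB]
    simpa using hb
  · rw [hμB, ← hμ]
    have h4 : conj A = A - 2 * Complex.I * A.im := by
      apply Complex.ext
      · simp
      · simp; ring
    rw [h4]
    push_cast
    ring

/-- A real linear endomorphism field on `ℂ` close to multiplication by a non-real number is
conjugated to a field of multiplications. -/
theorem exists_isothermal {m : ℂ → ℂ →L[ℝ] ℂ} {q Z₀ : ℂ} (hm : SmoothNear m q)
    (hq : ∀ h, m q h = Z₀ * h) (hZ₀ : 0 < Z₀.im) :
    ∃ w Z : ℂ → ℂ, SmoothNear w q ∧ SmoothNear Z q ∧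
      (∃ k : ℂ, k ≠ 0 ∧ ∀ h, fderiv ℝ w q h = k * h) ∧
      ∀ᶠ y in 𝓝 q, 0 < (Z y).im ∧ ∀ h, fderiv ℝ w y (m y h) = Z y * fderiv ℝ w y h := by
  set A : ℂ → ℂ := fun y => linPart (m y) with hA
  set B : ℂ → ℂ := fun y => antiPart (m y) with hB
  have hAq : A q = Z₀ := by
    simp only [hA, linPart, hq]
    linear_combination (-Z₀ / 2) * Complex.I_mul_I
  have hBq : B q = 0 := by
    simp only [hB, antiPart, hq]
    linear_combination (Z₀ / 2) * Complex.I_mul_I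
  have hAs : SmoothNear A q := by
    filter_upwards [hm] with y hy
    simp only [hA, linPart]
    have h1 : ContDiffAt ℝ ∞ (fun y => m y 1) y := hy.clm_apply contDiffAt_const
    have h2 : ContDiffAt ℝ ∞ (fun y => m y Complex.I) y := hy.clm_apply contDiffAt_const
    exact (h1.sub (contDiffAt_const.mul h2)).div_const 2
  have hBs : SmoothNear B q := by
    filter_upwards [hm] with y hy
    simp only [hB, antiPart]
    have h1 : ContDiffAt ℝ ∞ (fun y => m y 1) y := hy.clm_apply contDiffAt_const
    have h2 : ContDiffAt ℝ ∞ (fun y => m y Complex.I) y := hy.clm_apply contDiffAt_const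
    exact (h1.add (contDiffAt_const.mul h2)).div_const 2
  have hpos : ∀ᶠ y in 𝓝 q, 0 < (A y).im ∧ ‖B y‖ ^ 2 < (A y).im ^ 2 := by
    have h1 : ContinuousAt (fun y => (A y).im) q :=
      Complex.continuous_im.continuousAt.comp hAs.continuousAt
    have h2 : ContinuousAt (fun y => ‖B y‖ ^ 2) q := hBs.continuousAt.norm.pow 2
    have h3 : ContinuousAt (fun y => (A y).im ^ 2) q := h1.pow 2
    refine (continuousAt_const.eventually_lt h1 (by rwa [hAq])).and (h2.eventually_lt h3 ?_)
    have := pow_pos hZ₀ 2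
    simpa [hBq, hAq] using this
  set μ : ℂ → ℂ := fun y => B y /
    (Complex.I * ((Real.sqrt ((A y).im ^ 2 - ‖B y‖ ^ 2) + (A y).im : ℝ) : ℂ)) with hμ
  have hμs : SmoothNear μ q := by
    filter_upwards [hAs, hBs, hpos] with y h1 h2 h3
    have h4 : ContDiffAt ℝ ∞ (fun y => (A y).im) y :=
      Complex.imCLM.contDiff.contDiffAt.comp y h1
    have h5 : ContDiffAt ℝ ∞ (fun y => ‖B y‖ ^ 2) y := h2.norm_sq ℝ
    have h6 : ContDiffAt ℝ ∞ (fun y => Real.sqrt ((A y).im ^ 2 - ‖B y‖ ^ 2) + (A y).im) y :=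
      (((h4.pow 2).sub h5).sqrt (sub_ne_zero.2 h3.2.ne')).add h4
    have h7 : ContDiffAt ℝ ∞ (fun y => Complex.I *
        ((Real.sqrt ((A y).im ^ 2 - ‖B y‖ ^ 2) + (A y).im : ℝ) : ℂ)) y :=
      contDiffAt_const.mul (Complex.ofRealCLM.contDiff.contDiffAt.comp y h6)
    simp only [hμ, div_eq_mul_inv]
    refine h2.mul (h7.inv ?_)
    refine mul_ne_zero Complex.I_ne_zero ?_
    have : Real.sqrt ((A y).im ^ 2 - ‖B y‖ ^ 2) + (A y).im ≠ 0 :=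
      (add_pos_of_nonneg_of_pos (Real.sqrt_nonneg _) h3.1).ne'
    exact Complex.ofReal_ne_zero.2 this
  have hμq : μ q = 0 := by simp [hμ, hBq]
  obtain ⟨w, k, hw, hk, hwk⟩ := exists_beltrami hμs hμq
  refine ⟨w, fun y => A y + μ y * conj (B y), hw.smoothNear q, ?_, ⟨k q, hk q, fun h => ?_⟩, ?_⟩
  · filter_upwards [hAs, hBs, hμs] with y h1 h2 h3
    exact h1.add (h3.mul (Complex.conjCLE.contDiff.contDiffAt.comp y h2))
  · rw [hwk.self_of_nhds, hμq]; ring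
  · filter_upwards [hwk, hpos] with y h1 h2
    obtain ⟨h3, h4⟩ := beltrami_coefficient h2.1 h2.2
    refine ⟨h3, fun h => ?_⟩
    have h5 : B y + μ y * conj (A y) = (A y + μ y * conj (B y)) * μ y := h4
    rw [h1, h1, apply_eq_linPart_add_antiPart (m y) h]
    change k y * (A y * h + B y * conj h + μ y * conj (A y * h + B y * conj h)) = _
    simp only [map_add, map_mul, Complex.conj_conj]
    linear_combination k y * conj h * h5

/-- A function `Z` with `w^* Z` an eigenvalue and `dw` the eigenform of a Nijenhuis operator is
holomorphic. -/
theorem differentiableAt_complex_of_twist {Z : ℂ → ℂ} {q : ℂ} (hZ : DifferentiableAt ℝ Z q)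
    (him : (Z q).im ≠ 0) (h : ∀ a b : ℂ,
      (fderiv ℝ Z q (Z q * a) - Z q * fderiv ℝ Z q a) * b
        = (fderiv ℝ Z q (Z q * b) - Z q * fderiv ℝ Z q b) * a) :
    DifferentiableAt ℂ Z q := by
  rw [differentiableAt_complex_iff_differentiableAt_real]
  refine ⟨hZ, ?_⟩
  have hT : ∀ a : ℂ, fderiv ℝ Z q a
      = a.re * fderiv ℝ Z q 1 + a.im * fderiv ℝ Z q Complex.I := fun a => by
    have h1 : a = a.re • (1 : ℂ) + a.im • Complex.I := by apply Complex.ext <;> simp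
    conv_lhs => rw [h1, map_add, map_smul, map_smul]
    simp
  set d₁ := fderiv ℝ Z q 1
  set d₂ := fderiv ℝ Z q Complex.I
  -- This single pair already yields the Cauchy–Riemann equation multiplied by `2 Im Z`.
  have h1 := h 1 Complex.I
  rw [mul_one, hT (Z q), hT (Z q * Complex.I)] at h1
  have hre : (Z q * Complex.I).re = -(Z q).im := by simp
  have hI : (Z q * Complex.I).im = (Z q).re := by simp
  rw [hre, hI] at h1
  have hZq : Z q = (Z q).re + (Z q).im * Complex.I := (Complex.re_add_im _).symm
  have him' : ((Z q).im : ℂ) ≠ 0 := Complex.ofReal_ne_zero.2 him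
  change ((Z q).re * d₁ + (Z q).im * d₂ - Z q * d₁) * Complex.I = (((-(Z q).im : ℝ) : ℂ) * d₁
    + (Z q).re * d₂ - Z q * d₂) * 1 at h1
  push_cast at h1
  have h2 : (2 * (Z q).im) * (d₂ * Complex.I + d₁) = (0 : ℂ) := by
    linear_combination h1 + (d₁ * Complex.I - d₂) * hZq + ((Z q).im * d₁) * Complex.I_mul_I
  have h3 := (mul_eq_zero.1 h2).resolve_left (mul_ne_zero two_ne_zero him')
  rw [smul_eq_mul]
  linear_combination (-Complex.I) * h3 + d₂ * Complex.I_mul_I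

end ComplexCase

/-! ### The quotient by the real eigendirection and form (D). -/

section ComplexForm

open ComplexConjugate

/-- Simplicity gives `J^* dl = l dl` by `CorankOneData.fderiv_eigenvalue`, so the eigenform
integrates. The resulting `dz` does not vanish on `k₀`, since its kernel consists of vectors in the
image of `J - l`, which misses `k₀`. -/
theorem exists_simple_coordinate {E : Type} [NormedAddCommGroup E] [NormedSpace ℝ E]
    [FiniteDimensional ℝ E] {J : E → E →L[ℝ] E} {p : E}
    (hJ : SmoothNear J p) (hN : ∀ᶠ x in 𝓝 p, ∀ u v, nij J x u v = 0)
    {l₀ : ℝ} {k₀ : E} (hk₀ : k₀ ≠ 0) (heig : J p k₀ = l₀ • k₀)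
    (hker : ∀ v, J p v = l₀ • v → ∃ s : ℝ, v = s • k₀) (him : ∀ v, J p v - l₀ • v ≠ k₀) :
    ∃ (z : E → ℝ) (g : ℝ → ℝ), SmoothNear z p ∧ SmoothNear g (z p) ∧ g (z p) = l₀ ∧
      fderiv ℝ z p k₀ ≠ 0 ∧
      ∀ᶠ x in 𝓝 p, ∀ v, fderiv ℝ z x (J x v) = g (z x) * fderiv ℝ z x v := by
  obtain ⟨l, hl, hlp, D, hD⟩ := exists_simple_eigenvalue hJ hk₀ heig hker him
  obtain ⟨z, g, hz, hg, -, hzJ, hzker, hlg⟩ :=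
    D.exists_coordinate hJ hl hN (D.fderiv_eigenvalue hJ hl hN hD)
  refine ⟨z, g, hz, hg, by rw [← hlg.self_of_nhds, hlp], fun h => ?_, ?_⟩
  · obtain ⟨v, hv⟩ := hzker.self_of_nhds _ h
    rw [shift_apply, hlp] at hv
    exact him v hv
  · filter_upwards [hzJ, hlg] with x h1 h2 v
    rw [h1, h2]

/-- Near a point with a simple real eigenvalue, a Nijenhuis operator on `ℝ³` with a pair of
non-real eigenvalues descends to the two-dimensional quotient by the real eigendirection. -/
theorem exists_quotient {J : OperatorField} {p : E3}
    (hJ : SmoothNear J p) (hN : ∀ᶠ x in 𝓝 p, ∀ u v, nij J x u v = 0)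
    {l₀ : ℝ} {k₀ : E3} (hk₀ : k₀ ≠ 0) (heig : J p k₀ = l₀ • k₀)
    (hker : ∀ v, J p v = l₀ • v → ∃ s : ℝ, v = s • k₀) (him : ∀ v, J p v - l₀ • v ≠ k₀)
    {L : E3 →L[ℝ] ℂ} {Z₀ : ℂ} (hZ₀ : Z₀.im ≠ 0) (hL : ∀ v, L (J p v) = Z₀ * L v)
    (hLker : ∀ v, L v = 0 → ∃ s : ℝ, v = s • k₀) :
    ∃ (Y : E3 → ℂ) (m : ℂ → ℂ →L[ℝ] ℂ) (R : ℂ →L[ℝ] E3), SmoothNear Y p ∧ SmoothNear m (Y p) ∧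
      fderiv ℝ Y p = L ∧ (∀ h, L (R h) = h) ∧
      ∀ᶠ x in 𝓝 p, ∀ v, fderiv ℝ Y x (J x v) = m (Y x) (fderiv ℝ Y x v) := by
  obtain ⟨l, hl, hlp, D, -⟩ := exists_simple_eigenvalue hJ hk₀ heig hker him
  have hJk : ∀ᶠ x in 𝓝 p, J x (D.k x) = l x • D.k x := by
    filter_upwards [D.apply_k] with x hx
    rw [shift_apply] at hx
    exact sub_eq_zero.1 hx
  have hLk : L (D.k p) = 0 := by
    have h1 := hL (D.k p)
    rw [hJk.self_of_nhds, map_smul, hlp, Complex.real_smul] at h1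
    have h2 : (l₀ - Z₀) * L (D.k p) = 0 := by linear_combination h1
    refine (mul_eq_zero.1 h2).resolve_left fun h3 => hZ₀ ?_
    rw [← sub_eq_zero.1 h3, Complex.ofReal_im]
  have hLξ : ∀ v, L v = 0 → D.ξ v = 0 → v = 0 := fun v h1 h2 => by
    obtain ⟨s, hs⟩ := hLker v h1
    obtain ⟨t, ht⟩ := hLker _ hLk
    have ht0 : t ≠ 0 := by
      rintro rfl
      have := D.ξ_k.self_of_nhds
      rw [ht, zero_smul, map_zero] at this
      exact zero_ne_one this
    have h3 : v = (s * t⁻¹) • D.k p := by rw [ht, hs, smul_smul, inv_mul_cancel_right₀ ht0]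
    rw [h3, map_smul, D.ξ_k.self_of_nhds, smul_eq_mul, mul_one] at h2
    rw [h3, h2, zero_smul]
  have hdim : Module.finrank ℝ E3 = Module.finrank ℝ (ℂ × ℝ) := by
    simp [Complex.finrank_real_complex]
  have hinj : ∀ v, L.prod D.ξ v = 0 → v = 0 := fun v hv => by
    obtain ⟨h1, h2⟩ := Prod.mk.inj hv
    exact hLξ v h1 h2
  obtain ⟨C, hC⟩ := exists_equiv_of_injective hdim hinj
  let R : ℂ →L[ℝ] E3 := (C.symm : (ℂ × ℝ) →L[ℝ] E3).comp (ContinuousLinearMap.inl ℝ ℂ ℝ)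
  have hR : ∀ h, L (R h) = h := fun h => by
    have h1 : (L.prod D.ξ) (R h) = (h, 0) := by rw [hC]; exact C.apply_symm_apply _
    exact congrArg Prod.fst h1
  -- the form `L - L(k) ⊗ ξ` annihilates `k`
  let α : E3 → E3 →L[ℝ] ℂ := fun x => L - D.ξ.smulRight (L (D.k x))
  have hα : SmoothNear α p := by
    filter_upwards [D.smooth_k] with x hx
    have h1 : ContDiffAt ℝ ∞ (fun x => L (D.k x)) x := L.contDiff.contDiffAt.comp x hx
    have h2 : ContDiffAt ℝ ∞ (fun x => ContinuousLinearMap.smulRightL ℝ E3 ℂ D.ξ (L (D.k x))) x :=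
      (ContinuousLinearMap.contDiff _).contDiffAt.comp x h1
    exact contDiffAt_const.sub h2
  have hαp : α p = L := by ext v; simp [α, hLk]
  have hαk : ∀ᶠ x in 𝓝 p, α x (D.k x) = 0 := by
    filter_upwards [D.ξ_k] with x hx
    simp [α, hx]
  have hαker : ∀ᶠ x in 𝓝 p, ∀ v, α x v = 0 → v = D.ξ v • D.k x := by
    filter_upwards [D.ξ_k] with x hx v hv
    refine sub_eq_zero.1 (hLξ _ ?_ (by simp [hx]))
    rw [map_sub, map_smul, ← hv]
    simp [α]
  -- Involutivity is automatic: the kernel of `α` is the line spanned by `k`.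
  obtain ⟨Y, hY, hYp, hYα⟩ := frobenius hα (R := R) (fun h => by rw [hαp, hR]) (by
    filter_upwards [hαker] with x h1 u v hu hv
    rw [h1 u hu, h1 v hv]
    simp only [map_smul, smul_apply]
    rw [smul_comm])
  rw [hαp] at hYp
  have hYk : ∀ᶠ x in 𝓝 p, fderiv ℝ Y x (D.k x) = 0 := by
    filter_upwards [hαk, hYα] with x h1 h2 using h2 _ h1
  let H : E3 → E3 →L[ℝ] (ℂ × ℝ) := fun x => (fderiv ℝ Y x).prod D.ξ
  have hH : SmoothNear H p := by
    filter_upwards [hY] with x hx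
    exact ((ContinuousLinearMap.prodMapL ℝ E3 ℂ E3 ℝ).contDiff.contDiffAt.comp x
      (hx.fderiv_infty.prodMk contDiffAt_const)).clm_comp
      (contDiffAt_const (c := (ContinuousLinearMap.id ℝ E3).prod (ContinuousLinearMap.id ℝ E3)))
  obtain ⟨M, hM, -, hMH⟩ := hH.exists_inverse (A := C) (by rw [← hC]; simp only [H, hYp])
  have hMk : ∀ᶠ x in 𝓝 p, M x (0, 1) = D.k x := by
    filter_upwards [hMH, hYk, D.ξ_k] with x h1 h2 h3
    rw [← h1.1 (D.k x)]
    simp [H, h2, h3]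
  -- The operator induced by `J` on the quotient by `k`. It is well defined there because `J k = l
  -- k` and `dY(k) = 0`.
  let m : E3 → ℂ →L[ℝ] ℂ := fun x =>
    ((fderiv ℝ Y x).comp (J x)).comp ((M x).comp (ContinuousLinearMap.inl ℝ ℂ ℝ))
  have hm : SmoothNear m p := by
    filter_upwards [hY, hJ, hM] with x h1 h2 h3
    exact (h1.fderiv_infty.clm_comp h2).clm_comp (h3.clm_comp contDiffAt_const)
  have hmJ : ∀ᶠ x in 𝓝 p, ∀ v, fderiv ℝ Y x (J x v) = m x (fderiv ℝ Y x v) := by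
    filter_upwards [hMH, hMk, hJk, hYk] with x h1 h2 h3 h4 v
    have h5 : v = M x (fderiv ℝ Y x v, 0) + D.ξ v • D.k x := by
      rw [← h2, ← map_smul, ← map_add]
      conv_lhs => rw [← h1.1 v]
      simp [H]
    have h6 : m x (fderiv ℝ Y x v) = fderiv ℝ Y x (J x (M x (fderiv ℝ Y x v, 0))) := rfl
    rw [h6]
    conv_lhs => rw [h5]
    simp only [map_add, map_smul, h3, h4, smul_zero, add_zero]
  have hYR : ∀ᶠ x in 𝓝 p, ∀ h, fderiv ℝ Y x (M x (h, 0)) = h := by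
    filter_upwards [hMH] with x h1 h
    exact congrArg Prod.fst (h1.2 (h, 0))
  have hmp : ∀ h, m p h = Z₀ * h := fun h => by
    have h1 := hmJ.self_of_nhds (R h)
    rw [hYp, hL, hR] at h1
    exact h1.symm
  have hml : ∀ᶠ x in 𝓝 p, ∀ h, (m x - l x • ContinuousLinearMap.id ℝ ℂ) h = 0 → h = 0 := by
    refine injective_near (H := fun x => m x - l x • ContinuousLinearMap.id ℝ ℂ) ?_ fun h hh => ?_
    · exact hm.continuousAt.sub (hl.continuousAt.smul continuousAt_const)
    · simp only [sub_apply, smul_apply, ContinuousLinearMap.id_apply, hmp, Complex.real_smul] at hh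
      rw [← sub_mul] at hh
      refine (mul_eq_zero.1 hh).resolve_left fun h3 => hZ₀ ?_
      rw [sub_eq_zero.1 h3, Complex.ofReal_im]
  -- `N_J(·, k) = 0` pushed down by `dY` reads `(m - l) ∘ Dm(k) = 0`. Since `Z₀` is not real, `m -
  -- l` is injective, so `m` is constant along the eigendirection and is a function of `Y`.
  have hDm : ∀ᶠ x in 𝓝 p, fderiv ℝ m x (D.k x) = 0 := by
    filter_upwards [hml, hmJ.eventually_nhds, hJ, hY, hm, hN, hYk, hYR, hJk]
      with x h1 h2 h3 h4 h5 h6 h7 h8 h9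
    ext1 h
    have h10 := apply_nij_of_intertwines h3.diffAt h4.fderiv_infty.diffAt h5.diffAt h2
      (M x (h, 0)) (D.k x)
    rw [h6, map_zero, h7, h9, h8] at h10
    simp only [extd_fderiv h4, map_zero, sub_zero, map_smul, smul_apply, add_zero, zero_sub] at h10
    refine h1 _ ?_
    simp only [sub_apply, smul_apply, ContinuousLinearMap.id_apply]
    rw [← neg_eq_zero, neg_sub]
    have h11 := neg_eq_zero.1 h10.symm
    exact h11
  obtain ⟨m', hm', hmm'⟩ := hY.exists_factor hm (R := R) (fun h => by rw [hYp, hR]) (by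
    filter_upwards [hMH, hYk, hDm, hMk] with x h1 h2 h3 h4 v hv
    have h5 : v = D.ξ v • D.k x := by
      rw [← h4, ← map_smul]
      conv_lhs => rw [← h1.1 v]
      simp [H, hv]
    rw [h5, map_smul, h3]
    exact smul_zero (A := ℂ →L[ℝ] ℂ) (D.ξ v))
  refine ⟨Y, m', R, hY, hm', hYp, hR, ?_⟩
  filter_upwards [hmJ, hmm'] with x h1 h2 v
  rw [h1, h2]

/-- The complex semi-simple normal form. -/
theorem hasFormD_of_eigenvectors {J : OperatorField} {p : E3}
    (hJ : SmoothNear J p) (hN : ∀ᶠ x in 𝓝 p, ∀ u v, nij J x u v = 0)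
    {l₀ : ℝ} {k₀ : E3} (hk₀ : k₀ ≠ 0) (heig : J p k₀ = l₀ • k₀)
    (hker : ∀ v, J p v = l₀ • v → ∃ s : ℝ, v = s • k₀) (him : ∀ v, J p v - l₀ • v ≠ k₀)
    {L : E3 →L[ℝ] ℂ} {Z₀ : ℂ} (hZ₀ : 0 < Z₀.im) (hL : ∀ v, L (J p v) = Z₀ * L v)
    (hLker : ∀ v, L v = 0 → ∃ s : ℝ, v = s • k₀) : HasFormD J p := by
  obtain ⟨z, g, hz, hg, -, hzk, hzJ⟩ := exists_simple_coordinate hJ hN hk₀ heig hker him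
  obtain ⟨Y, m, R, hY, hm, hYp, hR, hYJ⟩ :=
    exists_quotient hJ hN hk₀ heig hker him hZ₀.ne' hL hLker
  obtain ⟨w, Z, hw, hZ, ⟨k, hk, hwk⟩, hwm⟩ := exists_isothermal hm (fun h => by
    have h1 := hYJ.self_of_nhds (R h)
    rw [hYp, hL, hR] at h1
    exact h1.symm) hZ₀
  set W : E3 → ℂ := fun x => w (Y x) with hW
  have hWs : SmoothNear W p := hw.comp hY
  have hZY : SmoothNear (fun x => Z (Y x)) p := hZ.comp hY
  have hWd : ∀ᶠ x in 𝓝 p, ∀ v, fderiv ℝ W x v = fderiv ℝ w (Y x) (fderiv ℝ Y x v) := by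
    filter_upwards [hY, hY.continuousAt.eventually hw] with x h1 h2 v
    rw [hW, fderiv_fun_comp x h2.diffAt h1.diffAt]
    rfl
  have hWJ : ∀ᶠ x in 𝓝 p, 0 < (Z (Y x)).im ∧
      ∀ v, fderiv ℝ W x (J x v) = Z (Y x) * fderiv ℝ W x v := by
    filter_upwards [hWd, hY.continuousAt.eventually hwm, hYJ] with x h1 h2 h3
    refine ⟨h2.1, fun v => ?_⟩
    rw [h1, h1, h3, h2.2]
  have hWp : ∀ v, fderiv ℝ W p v = k * L v := fun v => by
    rw [hWd.self_of_nhds, hYp, hwk]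
  let R' : ℂ →L[ℝ] E3 := R.comp ((ContinuousLinearMap.mul ℝ ℂ) k⁻¹)
  have hR' : ∀ h, fderiv ℝ W p (R' h) = h := fun h => by
    rw [hWp]
    change k * L (R (k⁻¹ * h)) = h
    rw [hR, mul_inv_cancel_left₀ hk]
  -- `dw` is injective near `Y p`, so `dW` and `dY` have the same kernel; hence the eigenvalue is a
  -- function of `W`.
  have hker' : ∀ᶠ x in 𝓝 p, ∀ v, fderiv ℝ W x v = 0 → fderiv ℝ (fun x => Z (Y x)) x v = 0 := by
    have hwinj : ∀ᶠ y in 𝓝 (Y p), ∀ h, fderiv ℝ w y h = 0 → h = 0 :=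
      injective_near hw.differential.continuousAt fun h hh => by
        rw [hwk] at hh
        exact (mul_eq_zero.1 hh).resolve_left hk
    filter_upwards [hWd, hY.continuousAt.eventually hwinj, hY, hY.continuousAt.eventually hZ]
      with x h1 h2 h3 h4 v hv
    rw [h1] at hv
    rw [fderiv_fun_comp x h4.diffAt h3.diffAt, ContinuousLinearMap.comp_apply, h2 _ hv, map_zero]
  obtain ⟨V, hV, hZV⟩ := hWs.exists_factor hZY hR' hker'
  have hsurj : ∀ᶠ x in 𝓝 p, ∀ h, ∃ v, fderiv ℝ W x v = h := by
    let T : E3 → ℂ →L[ℝ] ℂ := fun x => (fderiv ℝ W x).comp R'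
    have hT : SmoothNear T p := by
      filter_upwards [hWs.differential] with x hx using hx.clm_comp contDiffAt_const
    obtain ⟨N, -, -, hNT⟩ := hT.exists_inverse (A := ContinuousLinearEquiv.refl ℝ ℂ) (by
      ext1; simp [T, hR'])
    filter_upwards [hNT] with x hx h
    exact ⟨R' (N x h), hx.2 h⟩
  -- For the exact form `dW`, intertwining `J` with multiplication by `V ∘ W`, the equation `N_J =
  -- 0` is the condition of `differentiableAt_complex_of_twist`.
  have hhol : ∀ᶠ x in 𝓝 p, DifferentiableAt ℂ V (W x) := by
    filter_upwards [hWJ.eventually_nhds, hsurj, hZV.eventually_nhds, hWs, hJ, hN,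
      hWs.continuousAt.eventually hV] with x h1 h2 h3 h4 h5 h6 h7
    refine differentiableAt_complex_of_twist h7.diffAt
      (by rw [← h3.self_of_nhds]; exact h1.self_of_nhds.1.ne') fun a b => ?_
    obtain ⟨u, rfl⟩ := h2 a
    obtain ⟨v, rfl⟩ := h2 b
    have h8 : HasFDerivAt (fun y => ContinuousLinearMap.mul ℝ ℂ (V (W y)))
        ((ContinuousLinearMap.mul ℝ ℂ).comp ((fderiv ℝ V (W x)).comp (fderiv ℝ W x))) x :=
      (ContinuousLinearMap.mul ℝ ℂ).hasFDerivAt.comp x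
        (h7.diffAt.hasFDerivAt.comp x h4.diffAt.hasFDerivAt)
    have h9 := apply_nij_of_intertwines h5.diffAt h4.fderiv_infty.diffAt h8.differentiableAt (by
      filter_upwards [h1, h3] with y h10 h11 v
      rw [h10.2, h11]; rfl) u v
    rw [h6, map_zero, h8.fderiv] at h9
    simp only [extd_fderiv h4, ContinuousLinearMap.comp_apply, ContinuousLinearMap.mul_apply',
      h1.self_of_nhds.2, h3.self_of_nhds, add_zero, mul_zero, sub_zero] at h9
    linear_combination -h9
  let F : E3 → E3 := fun x => ![(W x).re, (W x).im, z x]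
  have hre : SmoothNear (fun x => (W x).re) p := hWs.clm_comp Complex.reCLM
  have him' : SmoothNear (fun x => (W x).im) p := hWs.clm_comp Complex.imCLM
  have hFd : ∀ x, DifferentiableAt ℝ W x → DifferentiableAt ℝ z x → ∀ v, fderiv ℝ F x v
      = ![(fderiv ℝ W x v).re, (fderiv ℝ W x v).im, fderiv ℝ z x v] := fun x h1 h2 v => by
    have h3 : HasFDerivAt (fun x => (W x).re) (Complex.reCLM.comp (fderiv ℝ W x)) x :=
      Complex.reCLM.hasFDerivAt.comp x h1.hasFDerivAt
    have h4 : HasFDerivAt (fun x => (W x).im) (Complex.imCLM.comp (fderiv ℝ W x)) x :=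
      Complex.imCLM.hasFDerivAt.comp x h1.hasFDerivAt
    rw [fderiv_vec3 h3.differentiableAt h4.differentiableAt h2, h3.fderiv, h4.fderiv]
    rfl
  have hFinj : ∀ v, fderiv ℝ F p v = 0 → v = 0 := fun v hv => by
    rw [hFd p hWs.contDiffAt.diffAt hz.contDiffAt.diffAt] at hv
    have h0 := congrFun hv 0
    have h1 := congrFun hv 1
    have h2 := congrFun hv 2
    have h3 : fderiv ℝ W p v = 0 := Complex.ext h0 h1
    rw [hWp] at h3
    obtain ⟨s, rfl⟩ := hLker v ((mul_eq_zero.1 h3).resolve_left hk)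
    have h4 : s * fderiv ℝ z p k₀ = 0 := by
      have : fderiv ℝ z p (s • k₀) = 0 := h2
      rwa [map_smul] at this
    rw [(mul_eq_zero.1 h4).resolve_right hzk, zero_smul]
  obtain ⟨φ, hφ, hφF, hP⟩ := exists_smoothChart (hre.vec3 him' hz) hFinj
    (((((hWs.and hz).and hhol).and hWJ).and hzJ).and (hZV.and (hz.continuousAt.eventually hg)))
  have hzc : ∀ x, zCoord (F x) = W x := fun x => rfl
  refine ⟨φ, V, g, hφ, ?_, contDiffOn_coordRange fun x hx => ?_,
    forall_target fun x hx => ?_, fun x hx v => ?_⟩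
  · rintro _ ⟨y, hy, rfl⟩
    refine DifferentiableAt.differentiableWithinAt ?_
    refine forall_target (φ := φ) (P := fun y => DifferentiableAt ℂ V (zCoord y)) (fun x hx => ?_) y hy
    rw [hφF]
    exact (hP x hx).1.1.1.2
  · rw [hφF]
    exact (hP x hx).2.2
  · rw [hφF]
    change (V (W x)).im ≠ 0
    rw [← (hP x hx).2.1]
    exact (hP x hx).1.1.2.1.ne'
  · obtain ⟨⟨⟨⟨⟨h1, h2⟩, -⟩, h3⟩, h4⟩, h5, -⟩ := hP x hx
    rw [hφF]
    change fderiv ℝ F x _ = _ *ᵥ fderiv ℝ F x v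
    rw [hFd x h1.diffAt h2.diffAt, hFd x h1.diffAt h2.diffAt, h3.2, h4]
    change _ = !![(V (W x)).re, -(V (W x)).im, 0; (V (W x)).im, (V (W x)).re, 0; 0, 0, g (z x)] *ᵥ _
    rw [← h5]
    ext i
    fin_cases i <;> simp [Matrix.mulVec, dotProduct, Fin.sum_univ_three] <;> ring

end ComplexForm

/-! ### Forms (A), (B) and (C) from spectral data. -/

section RealForms

variable {J : OperatorField} {p : E3}

/-- The real semi-simple normal form. -/
theorem hasFormA_of_eigenvectors (hJ : SmoothNear J p) (hN : ∀ᶠ x in 𝓝 p, ∀ u v, nij J x u v = 0)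
    {l : Fin 3 → ℝ} (hl : Function.Injective l) {k : Fin 3 → E3} (hk : ∀ i, k i ≠ 0)
    (heig : ∀ i, J p (k i) = l i • k i) : HasFormA J p := by
  have hli : LinearIndependent ℝ k := Module.End.eigenvectors_linearIndependent'
    (J p : E3 →ₗ[ℝ] E3) l hl k fun i => Module.End.hasEigenvector_iff.2
      ⟨Module.End.mem_eigenspace_iff.2 (heig i), hk i⟩
  let b := basisOfLinearIndependentOfCardEqFinrank hli (by simp)
  have hexp : ∀ v : E3, v = b.repr v 0 • k 0 + b.repr v 1 • k 1 + b.repr v 2 • k 2 := fun v => by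
    have h1 := b.sum_repr v
    rw [Fin.sum_univ_three] at h1
    simpa [b] using h1.symm
  have hext : ∀ u v : E3, (∀ i, b.repr u i = b.repr v i) → u = v := fun u v h => by
    rw [hexp u, hexp v, h, h, h]
  have hrk : ∀ i j, b.repr (k i) j = if i = j then 1 else 0 := fun i j => by
    have : k i = b i := by simp [b]
    rw [this, b.repr_self, Finsupp.single_apply]
  have hJr : ∀ v i, b.repr (J p v) i = l i * b.repr v i := fun v i => by
    conv_lhs => rw [hexp v]
    simp only [map_add, map_smul, heig]
    fin_cases i <;> simp [hrk, mul_comm]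
  have hcoord : ∀ i, ∃ (z : E3 → ℝ) (g : ℝ → ℝ), SmoothNear z p ∧ SmoothNear g (z p) ∧
      g (z p) = l i ∧ fderiv ℝ z p (k i) ≠ 0 ∧
      ∀ᶠ x in 𝓝 p, ∀ v, fderiv ℝ z x (J x v) = g (z x) * fderiv ℝ z x v := fun i => by
    refine exists_simple_coordinate hJ hN (hk i) (heig i) (fun v hv => ⟨b.repr v i, ?_⟩) fun v hv => ?_
    · refine hext _ _ fun j => ?_
      have h1 := hJr v j
      rw [hv, map_smul, Finsupp.smul_apply, smul_eq_mul] at h1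
      rw [map_smul, Finsupp.smul_apply, hrk, smul_eq_mul]
      split_ifs with h
      · rw [h, mul_one]
      · rw [mul_zero]
        have h2 : (l i - l j) * b.repr v j = 0 := by linear_combination h1
        exact (mul_eq_zero.1 h2).resolve_left (sub_ne_zero.2 fun h3 => h (hl h3))
    · have h1 := hrk i i
      rw [← hv, map_sub, map_smul, Finsupp.sub_apply, Finsupp.smul_apply, hJr, smul_eq_mul,
        sub_self, if_pos rfl] at h1
      exact zero_ne_one h1
  choose z g hz hg hgl hzk hzJ using hcoord
  -- Left and right eigenvectors for different eigenvalues are orthogonal, so the three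
  -- differentials are independent at `p`.
  have hzkj : ∀ i j, i ≠ j → fderiv ℝ (z i) p (k j) = 0 := fun i j hij => by
    have h1 := (hzJ i).self_of_nhds (k j)
    rw [heig, map_smul, hgl, smul_eq_mul] at h1
    have h2 : (l j - l i) * fderiv ℝ (z i) p (k j) = 0 := by linear_combination h1
    exact (mul_eq_zero.1 h2).resolve_left (sub_ne_zero.2 fun h3 => hij (hl h3).symm)
  let F : E3 → E3 := fun x => ![z 0 x, z 1 x, z 2 x]
  have hFd : ∀ x, (∀ i, ContDiffAt ℝ ∞ (z i) x) → ∀ v, fderiv ℝ F x v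
      = ![fderiv ℝ (z 0) x v, fderiv ℝ (z 1) x v, fderiv ℝ (z 2) x v] := fun x h v =>
    fderiv_vec3 (h 0).diffAt (h 1).diffAt (h 2).diffAt v
  have hFinj : ∀ v, fderiv ℝ F p v = 0 → v = 0 := fun v hv => by
    have h1 : ∀ i, fderiv ℝ (z i) p v = b.repr v i * fderiv ℝ (z i) p (k i) := fun i => by
      conv_lhs => rw [hexp v]
      simp only [map_add, map_smul]
      fin_cases i <;> simp [hzkj]
    rw [hFd p fun i => (hz i).contDiffAt] at hv
    refine hext _ _ fun i => ?_
    have h2 : fderiv ℝ (z i) p v = 0 := by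
      have := congrFun hv i
      fin_cases i <;> exact this
    rw [h1] at h2
    rw [(mul_eq_zero.1 h2).resolve_right (hzk i), map_zero]
    rfl
  have hgz : ∀ i, ContinuousAt (fun x => g i (z i x)) p := fun i =>
    ((hg i).comp (hz i)).continuousAt
  have hne : ∀ i j, i ≠ j → ∀ᶠ x in 𝓝 p, g i (z i x) ≠ g j (z j x) := fun i j hij => by
    have h1 : ContinuousAt (fun x => g i (z i x) - g j (z j x)) p := (hgz i).sub (hgz j)
    filter_upwards [h1.eventually_ne (y := 0)
      (by rw [hgl, hgl]; exact sub_ne_zero.2 fun h => hij (hl h))] with x hx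
    exact sub_ne_zero.1 hx
  obtain ⟨φ, hφ, hφF, hP⟩ := exists_smoothChart ((hz 0).vec3 (hz 1) (hz 2)) hFinj
    ((((eventually_all.2 hz).and (eventually_all.2 hzJ)).and
      (eventually_all.2 fun i => (hz i).continuousAt.eventually (hg i))).and
      ((hne 0 1 (by decide)).and ((hne 0 2 (by decide)).and (hne 1 2 (by decide)))))
  refine ⟨φ, g 0, g 1, g 2, hφ, contDiffOn_coordRange fun x hx => ?_,
    contDiffOn_coordRange fun x hx => ?_, contDiffOn_coordRange fun x hx => ?_,
    forall_target fun x hx => ?_, fun x hx v => ?_⟩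
  · rw [hφF]; exact (hP x hx).1.2 0
  · rw [hφF]; exact (hP x hx).1.2 1
  · rw [hφF]; exact (hP x hx).1.2 2
  · rw [hφF]; exact (hP x hx).2
  · obtain ⟨⟨⟨h1, h2⟩, -⟩, -⟩ := hP x hx
    rw [hφF]
    change fderiv ℝ F x _ = _ *ᵥ fderiv ℝ F x v
    rw [hFd x h1, hFd x h1, h2, h2, h2]
    change _ = !![g 0 (z 0 x), 0, 0; 0, g 1 (z 1 x), 0; 0, 0, g 2 (z 2 x)] *ᵥ _
    ext i
    fin_cases i <;> simp [Matrix.mulVec, dotProduct, Fin.sum_univ_three]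

variable {l : E3 → ℝ}

/-- Solving `dX ∘ (J - l) = dz`. -/
theorem CorankOneData.exists_primitive_of_coordinate (D : CorankOneData (NijenhuisGerm.shift J l) p)
    (hJ : SmoothNear J p) (hl : SmoothNear l p) (hN : ∀ᶠ x in 𝓝 p, ∀ u v, nij J x u v = 0)
    {z : E3 → ℝ} (hz : SmoothNear z p) {c : E3} (hc : fderiv ℝ z p c = 1)
    (hzker : ∀ᶠ x in 𝓝 p, ∀ u, fderiv ℝ z x u = 0 → ∃ v, NijenhuisGerm.shift J l x v = u)
    (hzJ : ∀ᶠ x in 𝓝 p, ∀ v, fderiv ℝ z x (J x v) = l x * fderiv ℝ z x v)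
    (hτ : ∀ᶠ x in 𝓝 p, ∀ u, fderiv ℝ l x (J x u) = l x * fderiv ℝ l x u)
    {g : ℝ → ℝ} (hg : SmoothNear g (z p)) (hlg : ∀ᶠ x in 𝓝 p, l x = g (z x))
    (hk : ∀ᶠ x in 𝓝 p, ∃ w, NijenhuisGerm.shift J l x w = D.k x) :
    ∃ X : E3 → ℝ, SmoothNear X p ∧
      ∀ᶠ x in 𝓝 p, ∀ v, fderiv ℝ X x (J x v) = l x * fderiv ℝ X x v + fderiv ℝ z x v := by
  refine D.exists_primitive hJ hl hN hz hc hzker hzJ hτ hz.differential ?_ ?_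
  · filter_upwards [hk, hzJ] with x ⟨w, hw⟩ h2
    rw [← hw, shift_apply, map_sub, map_smul, h2, smul_eq_mul, sub_self]
  -- Compatibility holds because `dz` is closed, and so is `dz ∘ J = l dz`, as `l` is a function of
  -- `z`.
  · have h1 : ∀ᶠ x in 𝓝 p, (fderiv ℝ z x).comp (J x) = l x • fderiv ℝ z x := by
      filter_upwards [hzJ] with x hx
      ext v
      exact hx v
    filter_upwards [hz, hl, h1.eventually_nhds, hlg.eventually_nhds,
      hz.continuousAt.eventually hg] with x h2 h3 h4 h5 h6 u v
    have h7 : fderiv ℝ l x = (fderiv ℝ g (z x)).comp (fderiv ℝ z x) := by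
      rw [Filter.EventuallyEq.fderiv_eq h5]
      exact fderiv_comp x h6.diffAt h2.diffAt
    have h8 : ∀ s : ℝ, fderiv ℝ g (z x) s = s * fderiv ℝ g (z x) 1 := fun s => by
      conv_lhs => rw [← mul_one s, ← smul_eq_mul, map_smul, smul_eq_mul]
    rw [extd_congr h4, extd_smul h3.diffAt h2.fderiv_infty.diffAt, h7]
    simp only [extd_fderiv h2, ContinuousLinearMap.comp_apply, smul_eq_mul]
    rw [h8 (fderiv ℝ z x u), h8 (fderiv ℝ z x v)]
    ring

/-- The coordinates are `(X, z, z₃)` with `dX ∘ (J-l) = dz`. A vector killed by `dz` is `(J-l)w`; if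
`dX` kills it too, then `dz(w) = 0` and it equals `(J-l)²u`. On such vectors `dz₃` is injective by
`hinj`. -/
theorem hasFormB_of_corankOneData (hJ : SmoothNear J p)
    (hN : ∀ᶠ x in 𝓝 p, ∀ u v, nij J x u v = 0) (hl : SmoothNear l p)
    (D : CorankOneData (shift J l) p)
    (hτ : ∀ᶠ x in 𝓝 p, ∀ u, fderiv ℝ l x (J x u) = l x * fderiv ℝ l x u)
    (hk : ∀ᶠ x in 𝓝 p, ∃ w, shift J l x w = D.k x)
    {z₃ : E3 → ℝ} {g₃ : ℝ → ℝ} (hz₃ : SmoothNear z₃ p) (hg₃ : SmoothNear g₃ (z₃ p))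
    (hz₃J : ∀ᶠ x in 𝓝 p, ∀ v, fderiv ℝ z₃ x (J x v) = g₃ (z₃ x) * fderiv ℝ z₃ x v)
    (hne : l p ≠ g₃ (z₃ p))
    (hinj : ∀ u, fderiv ℝ z₃ p (shift J l p (shift J l p u)) = 0 →
      shift J l p (shift J l p u) = 0) : HasFormB J p := by
  obtain ⟨z, g, hz, hg, hzc, hzJ, hzker, hlg⟩ := D.exists_coordinate hJ hl hN hτ
  obtain ⟨X, hX, hXJ⟩ := D.exists_primitive_of_coordinate hJ hl hN hz hzc hzker hzJ hτ hg hlg hk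
  let F : E3 → E3 := fun x => ![X x, z x, z₃ x]
  have hFinj : ∀ v, fderiv ℝ F p v = 0 → v = 0 := fun v hv => by
    rw [fderiv_vec3 hX.contDiffAt.diffAt hz.contDiffAt.diffAt hz₃.contDiffAt.diffAt] at hv
    have h0 : fderiv ℝ X p v = 0 := congrFun hv 0
    have h1 : fderiv ℝ z p v = 0 := congrFun hv 1
    have h2 : fderiv ℝ z₃ p v = 0 := congrFun hv 2
    obtain ⟨w, rfl⟩ := hzker.self_of_nhds v h1
    rw [shift_apply, map_sub, map_smul, hXJ.self_of_nhds, smul_eq_mul, add_sub_cancel_left] at h0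
    obtain ⟨u, rfl⟩ := hzker.self_of_nhds w h0
    exact hinj u h2
  have hne' : ∀ᶠ x in 𝓝 p, l x ≠ g₃ (z₃ x) := by
    have h1 : ContinuousAt (fun x => l x - g₃ (z₃ x)) p :=
      hl.continuousAt.sub (hg₃.comp hz₃).continuousAt
    filter_upwards [h1.eventually_ne (y := 0) (sub_ne_zero.2 hne)] with x hx
    exact sub_ne_zero.1 hx
  obtain ⟨φ, hφ, hφF, hP⟩ := exists_smoothChart (hX.vec3 hz hz₃) hFinj
    (((hX.and (hz.and hz₃)).and (hXJ.and (hzJ.and hz₃J))).and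
    ((hz.continuousAt.eventually hg).and ((hz₃.continuousAt.eventually hg₃).and (hne'.and hlg))))
  refine ⟨φ, g, g₃, hφ, contDiffOn_coordRange fun x hx => ?_,
    contDiffOn_coordRange fun x hx => ?_, forall_target fun x hx => ?_, fun x hx v => ?_⟩
  · rw [hφF]; exact (hP x hx).2.1
  · rw [hφF]; exact (hP x hx).2.2.1
  · rw [hφF]
    change g (z x) ≠ g₃ (z₃ x)
    rw [← (hP x hx).2.2.2.2]
    exact (hP x hx).2.2.2.1
  · obtain ⟨⟨⟨h1, h2, h3⟩, h4, h5, h6⟩, -, -, -, h7⟩ := hP x hx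
    rw [hφF]
    change fderiv ℝ F x _ = _ *ᵥ fderiv ℝ F x v
    rw [fderiv_vec3 h1.diffAt h2.diffAt h3.diffAt, fderiv_vec3 h1.diffAt h2.diffAt h3.diffAt,
      h4, h5, h6]
    change _ = !![g (z x), 1, 0; 0, g (z x), 0; 0, 0, g₃ (z₃ x)] *ᵥ _
    rw [← h7]
    ext i
    fin_cases i <;> simp [Matrix.mulVec, dotProduct, Fin.sum_univ_three]

/-- The coordinates are `(X, Y, z)` with `dY ∘ (J-l) = dz` and `dX ∘ (J-l) = e dY`. Peeling off one
factor `J - l` for each vanishing differential shows independence: a common null vector lies in the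
image of `(J-l)³`, which is zero at `p`. -/
theorem hasFormC_of_corankOneData (hJ : SmoothNear J p)
    (hN : ∀ᶠ x in 𝓝 p, ∀ u v, nij J x u v = 0) (hl : SmoothNear l p)
    (D : CorankOneData (shift J l) p)
    (hτ : ∀ᶠ x in 𝓝 p, ∀ u, fderiv ℝ l x (J x u) = l x * fderiv ℝ l x u)
    (hk : ∀ᶠ x in 𝓝 p, ∃ w, shift J l x (shift J l x w) = D.k x)
    (hnil : ∀ u, shift J l p (shift J l p (shift J l p u)) = 0) : HasFormC J p := by
  obtain ⟨z, g, hz, hg, hzc, hzJ, hzker, hlg⟩ := D.exists_coordinate hJ hl hN hτ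
  obtain ⟨Y, hY, hYJ⟩ := D.exists_primitive_of_coordinate hJ hl hN hz hzc hzker hzJ hτ hg hlg
    (by filter_upwards [hk] with x ⟨w, hw⟩ using ⟨_, hw⟩)
  have hdg : SmoothNear (deriv g) (z p) := by
    filter_upwards [hg] with t ht
    exact ht.fderiv_infty.clm_apply contDiffAt_const
  let h : E3 → ℝ := fun x => deriv g (z x)
  have hh : SmoothNear h p := hdg.comp hz
  -- An integrating factor. In `d(e dY ∘ J)` the term `e dl ∧ dY = e h dz ∧ dY` is cancelled by the
  -- part `e h dY ∧ dz` of `de ∧ dz`; the derivative of `h = λ'(z)` adds only multiples of `dz` to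
  -- `de`, which are harmless.
  let e : E3 → ℝ := fun x => Real.exp (h x * Y x)
  have he : SmoothNear e p := by
    filter_upwards [hh, hY] with x h1 h2 using (h1.mul h2).exp
  have hed : ∀ᶠ x in 𝓝 p, ∃ s : ℝ, ∀ u,
      fderiv ℝ e x u = e x * (s * fderiv ℝ z x u + h x * fderiv ℝ Y x u) := by
    filter_upwards [hh, hY, hz, hz.continuousAt.eventually hdg] with x h1 h2 h3 h4
    refine ⟨Y x * fderiv ℝ (deriv g) (z x) 1, fun u => ?_⟩
    have h5 : fderiv ℝ h x u = fderiv ℝ z x u * fderiv ℝ (deriv g) (z x) 1 := by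
      have h6 : fderiv ℝ h x = (fderiv ℝ (deriv g) (z x)).comp (fderiv ℝ z x) :=
        fderiv_comp x h4.diffAt h3.diffAt
      rw [h6, ContinuousLinearMap.comp_apply, ← smul_eq_mul, ← map_smul, smul_eq_mul, mul_one]
    have h7 : HasFDerivAt e (Real.exp (h x * Y x) • (h x • fderiv ℝ Y x + Y x • fderiv ℝ h x)) x :=
      (h1.diffAt.hasFDerivAt.mul h2.diffAt.hasFDerivAt).exp
    rw [h7.fderiv]
    simp only [smul_apply, _root_.add_apply, smul_eq_mul, h5]
    change e x * _ = _
    ring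
  have hld : ∀ᶠ x in 𝓝 p, ∀ u, fderiv ℝ l x u = h x * fderiv ℝ z x u := by
    filter_upwards [hlg.eventually_nhds, hz, hz.continuousAt.eventually hg] with x h1 h2 h3 u
    have h4 : fderiv ℝ l x = (fderiv ℝ g (z x)).comp (fderiv ℝ z x) := by
      rw [Filter.EventuallyEq.fderiv_eq h1]
      exact fderiv_comp x h3.diffAt h2.diffAt
    rw [h4, ContinuousLinearMap.comp_apply]
    change _ = fderiv ℝ g (z x) 1 * fderiv ℝ z x u
    rw [mul_comm, ← smul_eq_mul, ← map_smul, smul_eq_mul, mul_one]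
  obtain ⟨X, hX, hXJ⟩ := D.exists_primitive hJ hl hN hz hzc hzker hzJ hτ
    (θ := fun x => e x • fderiv ℝ Y x) (by
      filter_upwards [he, hY] with x h1 h2 using h1.smul h2.fderiv_infty) (by
      filter_upwards [hk, hYJ, hzJ] with x ⟨w, hw⟩ h1 h2
      rw [smul_apply, ← hw, shift_apply x (shift J l x w), map_sub, map_smul, h1, shift_apply,
        map_sub, map_smul, map_sub, map_smul, h2]
      simp) (by
      have h1 : ∀ᶠ x in 𝓝 p, (e x • fderiv ℝ Y x).comp (J x)
          = (e x * l x) • fderiv ℝ Y x + e x • fderiv ℝ z x := by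
        filter_upwards [hYJ] with x hx
        ext v
        simp only [ContinuousLinearMap.comp_apply, smul_apply, _root_.add_apply, hx, smul_eq_mul]
        ring
      filter_upwards [h1.eventually_nhds, he, hl, hY, hz, hed, hld, hYJ, hzJ]
        with x h2 h3 h4 h5 h6 ⟨s, h7⟩ h8 h9 h10 u v
      have hY' := h5.fderiv_infty.diffAt
      have hz' := h6.fderiv_infty.diffAt
      have hel : HasFDerivAt (fun x => e x * l x) (e x • fderiv ℝ l x + l x • fderiv ℝ e x) x :=
        h3.diffAt.hasFDerivAt.mul h4.diffAt.hasFDerivAt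
      have hA : DifferentiableAt ℝ (fun x => (e x * l x) • fderiv ℝ Y x) x :=
        hel.differentiableAt.smul hY'
      have hB : DifferentiableAt ℝ (fun x => e x • fderiv ℝ z x) x := h3.diffAt.smul hz'
      rw [extd_congr h2, extd_add hA hB, extd_smul hel.differentiableAt hY',
        extd_smul h3.diffAt hz', extd_smul h3.diffAt hY', extd_smul h3.diffAt hY',
        extd_smul h3.diffAt hY', hel.fderiv]
      simp only [extd_fderiv h5, extd_fderiv h6, _root_.add_apply, smul_apply, smul_eq_mul, h7, h8,
        h9, h10]
      ring)
  let F : E3 → E3 := fun x => ![X x, Y x, z x]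
  have hn : ∀ᶠ x in 𝓝 p, (∀ v, fderiv ℝ X x (shift J l x v) = e x * fderiv ℝ Y x v) ∧
      ∀ v, fderiv ℝ Y x (shift J l x v) = fderiv ℝ z x v := by
    filter_upwards [hXJ, hYJ] with x h1 h2
    constructor <;> intro v <;> simp [shift_apply, h1, h2]
  have hFinj : ∀ v, fderiv ℝ F p v = 0 → v = 0 := fun v hv => by
    rw [fderiv_vec3 hX.contDiffAt.diffAt hY.contDiffAt.diffAt hz.contDiffAt.diffAt] at hv
    have h0 : fderiv ℝ X p v = 0 := congrFun hv 0
    have h1 : fderiv ℝ Y p v = 0 := congrFun hv 1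
    have h2 : fderiv ℝ z p v = 0 := congrFun hv 2
    obtain ⟨w, rfl⟩ := hzker.self_of_nhds v h2
    rw [hn.self_of_nhds.2] at h1
    obtain ⟨u, rfl⟩ := hzker.self_of_nhds w h1
    rw [hn.self_of_nhds.1, hn.self_of_nhds.2] at h0
    obtain ⟨t, rfl⟩ := hzker.self_of_nhds u
      ((mul_eq_zero.1 h0).resolve_left (Real.exp_pos _).ne')
    exact hnil t
  obtain ⟨φ, hφ, hφF, hP⟩ := exists_smoothChart (hX.vec3 hY hz) hFinj
    (((hX.and (hY.and hz)).and (hXJ.and (hYJ.and hzJ))).and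
    ((hz.continuousAt.eventually hg).and hlg))
  refine ⟨φ, g, hφ, contDiffOn_coordRange fun x hx => ?_, fun x hx v => ?_⟩
  · rw [hφF]; exact (hP x hx).2.1
  · obtain ⟨⟨⟨h1, h2, h3⟩, h4, h5, h6⟩, -, h7⟩ := hP x hx
    rw [hφF]
    change fderiv ℝ F x _ = _ *ᵥ fderiv ℝ F x v
    rw [fderiv_vec3 h1.diffAt h2.diffAt h3.diffAt, fderiv_vec3 h1.diffAt h2.diffAt h3.diffAt,
      h4, h5, h6]
    change _ = !![g (z x), e x, 0; 0, g (z x), 1; 0, 0, g (z x)] *ᵥ _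
    rw [← h7]
    ext i
    fin_cases i <;> simp [Matrix.mulVec, dotProduct, Fin.sum_univ_three]

end RealForms

/-! ### Traces of a Nijenhuis operator. -/

section TraceFormula

/-- The trace as a continuous linear functional. -/
noncomputable def traceCLM : (E3 →L[ℝ] E3) →L[ℝ] ℝ :=
  LinearMap.toContinuousLinearMap ((LinearMap.trace ℝ E3).comp (ContinuousLinearMap.coeLM ℝ))

theorem traceCLM_apply (A : E3 →L[ℝ] E3) : traceCLM A = LinearMap.trace ℝ E3 (A : E3 →ₗ[ℝ] E3) := rfl

theorem traceCLM_comp_comm (A B : E3 →L[ℝ] E3) : traceCLM (A.comp B) = traceCLM (B.comp A) := by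
  rw [traceCLM_apply, traceCLM_apply]
  exact LinearMap.trace_mul_comm ℝ (A : E3 →ₗ[ℝ] E3) (B : E3 →ₗ[ℝ] E3)

/-- For a Nijenhuis operator, `J^* d(tr J) = d(tr J²) / 2`. -/
theorem fderiv_trace_sq {J : OperatorField} {x : E3} (hJ : DifferentiableAt ℝ J x)
    (hN : ∀ u v, nij J x u v = 0) (u : E3) :
    fderiv ℝ (fun y => traceCLM ((J y).comp (J y))) x u
      = 2 * fderiv ℝ (fun y => traceCLM (J y)) x (J x u) := by
  have h1 : HasFDerivAt (fun y => traceCLM (J y)) (traceCLM.comp (fderiv ℝ J x)) x :=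
    traceCLM.hasFDerivAt.comp x hJ.hasFDerivAt
  have h2 := traceCLM.hasFDerivAt.comp x (hJ.hasFDerivAt.clm_comp hJ.hasFDerivAt)
  have h3 : fderiv ℝ (fun y => traceCLM ((J y).comp (J y))) x u
      = traceCLM ((J x).comp (fderiv ℝ J x u) + (fderiv ℝ J x u).comp (J x)) := by
    have h4 : HasFDerivAt (fun y => traceCLM ((J y).comp (J y))) _ x := h2
    rw [h4.fderiv]
    rfl
  -- `N_J(u, ·) = 0` as an identity of operators. Under the trace the two products of `J` with `v ↦
  -- DJ(v) u`, in opposite orders, cancel.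
  have h5 : fderiv ℝ J x (J x u) + (J x).comp ((fderiv ℝ J x).flip u)
      = ((fderiv ℝ J x).flip u).comp (J x) + (J x).comp (fderiv ℝ J x u) := by
    ext1 v
    have := hN u v
    simp only [nij] at this
    simp only [_root_.add_apply, ContinuousLinearMap.comp_apply, ContinuousLinearMap.flip_apply]
    rw [← sub_eq_zero, ← this]
    abel
  have h6 := congrArg traceCLM h5
  rw [map_add, map_add, traceCLM_comp_comm (J x)] at h6
  rw [h3, h1.fderiv, map_add, traceCLM_comp_comm (fderiv ℝ J x u), ContinuousLinearMap.comp_apply]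
  linarith

end TraceFormula

/-! ### Characteristic polynomials and Jordan type. -/

section Spectrum

open Polynomial

/-- A monic cubic is determined by its values at `0`, `1` and `-1`; these give the trace and the
second symmetric function, hence the trace of the square. -/
theorem trace_of_charpoly_eq {K : Type*} [Field K] [CharZero K] {M : Matrix (Fin 3) (Fin 3) K}
    {a b c : K} (h : M.charpoly = (X - C a) * (X - C b) * (X - C c)) :
    M.trace = a + b + c ∧ (M * M).trace = a ^ 2 + b ^ 2 + c ^ 2 := by
  have key : ∀ t : K, (Matrix.scalar (Fin 3) t - M).det = (t - a) * (t - b) * (t - c) := fun t => by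
    rw [← Matrix.eval_charpoly, h]
    simp
  have h0 := key 0
  have h1 := key 1
  have h2 := key (-1)
  simp only [Matrix.det_fin_three, Matrix.scalar_apply, Matrix.sub_apply, Matrix.diagonal_apply] at h0 h1 h2
  simp at h0 h1 h2
  have ht : M.trace = a + b + c := by
    rw [Matrix.trace_fin_three]
    linear_combination (-(h1 + h2 - 2 * h0) / 2)
  refine ⟨ht, ?_⟩
  rw [Matrix.trace_fin_three] at ht ⊢
  simp only [Matrix.mul_apply, Fin.sum_univ_three]
  linear_combination (M 0 0 + M 1 1 + M 2 2 + (a + b + c)) * ht - (h1 - h2)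

/-- The characteristic polynomial of an endomorphism of `ℝ³`. -/
noncomputable abbrev charPoly (A : E3 →L[ℝ] E3) : ℝ[X] := LinearMap.charpoly (A : E3 →ₗ[ℝ] E3)

theorem charPoly_eq (A : E3 →L[ℝ] E3) :
    charPoly A = (LinearMap.toMatrix' (A : E3 →ₗ[ℝ] E3)).charpoly := by
  rw [← LinearMap.toMatrix_eq_toMatrix', LinearMap.charpoly_toMatrix]

theorem charpoly_complexify (A : E3 →L[ℝ] E3) :
    (complexify A).charpoly = (charPoly A).map (algebraMap ℝ ℂ) := by
  rw [complexify, Matrix.charpoly_toLin', charPoly_eq, Matrix.charpoly_map]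

theorem natDegree_charPoly (A : E3 →L[ℝ] E3) : (charPoly A).natDegree = 3 := by
  rw [LinearMap.charpoly_natDegree]; simp

theorem monic_charPoly (A : E3 →L[ℝ] E3) : (charPoly A).Monic := LinearMap.charpoly_monic _

theorem traceCLM_of_charPoly_eq {A : E3 →L[ℝ] E3} {a b c : ℝ}
    (h : charPoly A = (X - C a) * (X - C b) * (X - C c)) :
    traceCLM A = a + b + c ∧ traceCLM (A.comp A) = a ^ 2 + b ^ 2 + c ^ 2 := by
  have htr : ∀ B : E3 →L[ℝ] E3, traceCLM B = (LinearMap.toMatrix' (B : E3 →ₗ[ℝ] E3)).trace := fun B => by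
    rw [traceCLM_apply, LinearMap.trace_eq_matrix_trace ℝ (Pi.basisFun ℝ (Fin 3)),
      LinearMap.toMatrix_eq_toMatrix']
  rw [charPoly_eq] at h
  rw [htr, htr]
  have h1 := trace_of_charpoly_eq h
  rw [← LinearMap.toMatrix'_comp] at h1
  exact h1

theorem apply_of_charPoly_eq {A : E3 →L[ℝ] E3} {a b c : ℝ}
    (h : charPoly A = (X - C a) * (X - C b) * (X - C c)) (v : E3) :
    (A - a • ContinuousLinearMap.id ℝ E3) ((A - b • ContinuousLinearMap.id ℝ E3)
      ((A - c • ContinuousLinearMap.id ℝ E3) v)) = 0 := by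
  have h1 := LinearMap.aeval_self_charpoly (A : E3 →ₗ[ℝ] E3)
  change aeval _ (charPoly A) = 0 at h1
  rw [h] at h1
  have h2 := LinearMap.congr_fun h1 v
  simp only [map_mul, map_sub, aeval_X, aeval_C] at h2
  exact h2

theorem exists_eigenvector {A : E3 →L[ℝ] E3} {a : ℝ} (h : (charPoly A).IsRoot a) :
    ∃ v : E3, v ≠ 0 ∧ A v = a • v := by
  obtain ⟨v, hv⟩ := (Module.End.hasEigenvalue_iff_isRoot_charpoly (A : E3 →ₗ[ℝ] E3) a).2 h
    |>.exists_hasEigenvector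
  exact ⟨v, hv.2, hv.apply_eq_smul⟩

theorem isRoot_of_eigenvector {A : E3 →L[ℝ] E3} {a : ℝ} {v : E3} (hv : v ≠ 0) (h : A v = a • v) :
    (charPoly A).IsRoot a :=
  (Module.End.hasEigenvalue_iff_isRoot_charpoly (A : E3 →ₗ[ℝ] E3) a).1
    (Module.End.hasEigenvalue_of_hasEigenvector
      (Module.End.hasEigenvector_iff.2 ⟨Module.End.mem_eigenspace_iff.2 h, hv⟩))

theorem complexify_ofReal (A : E3 →L[ℝ] E3) (v : E3) :
    complexify A (fun i => (v i : ℂ)) = fun i => ((A v i : ℝ) : ℂ) := by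
  have h : A v = LinearMap.toMatrix' (A : E3 →ₗ[ℝ] E3) *ᵥ v := by
    rw [← Matrix.toLin'_apply, Matrix.toLin'_toMatrix']; rfl
  rw [h, complexify, Matrix.toLin'_apply]
  ext i
  simp [Matrix.mulVec, dotProduct]

/-- Both real eigenvectors are complex multiples of one complex vector; comparing coordinates shows
that their ratio is real. -/
theorem exists_smul_of_kerDim_le {A : E3 →L[ℝ] E3} {a : ℝ} (h : kerDim A a 1 ≤ 1) {u v : E3}
    (hu : u ≠ 0) (hAu : A u = a • u) (hAv : A v = a • v) : ∃ s : ℝ, v = s • u := by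
  have hmem : ∀ w : E3, A w = a • w →
      (fun i => (w i : ℂ)) ∈ LinearMap.ker ((complexify A - (a : ℂ) • LinearMap.id) ^ 1) := fun w hw => by
    rw [pow_one, LinearMap.mem_ker, LinearMap.sub_apply, complexify_ofReal, hw]
    ext i
    simp
  obtain ⟨w, hw⟩ := finrank_le_one_iff.1 h
  obtain ⟨c, hc⟩ := hw ⟨_, hmem u hAu⟩
  obtain ⟨d, hd⟩ := hw ⟨_, hmem v hAv⟩
  have hc' : ∀ i, c * w.1 i = u i := fun i => congrFun (congrArg Subtype.val hc) i
  have hd' : ∀ i, d * w.1 i = v i := fun i => congrFun (congrArg Subtype.val hd) i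
  obtain ⟨i, hi⟩ := Function.ne_iff.1 hu
  have hi' : u i ≠ 0 := hi
  refine ⟨v i / u i, funext fun j => ?_⟩
  have h1 : (v j : ℂ) * u i = v i * u j := by
    rw [← hc', ← hd', ← hc', ← hd']; ring
  have h2 : v j * u i = v i * u j := by exact_mod_cast h1
  rw [Pi.smul_apply, smul_eq_mul]
  field_simp
  linarith

/-- In dimension three the kernel of the cube is the whole generalised eigenspace. Through this,
`SameJordanType` controls the characteristic polynomial. -/
theorem kerDim_three (A : E3 →L[ℝ] E3) (μ : ℂ) :
    kerDim A μ 3 = ((charPoly A).map (algebraMap ℝ ℂ)).rootMultiplicity μ := by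
  rw [← charpoly_complexify, ← LinearMap.finrank_maxGenEigenspace_eq,
    Module.End.maxGenEigenspace_eq_genEigenspace_finrank, Module.End.genEigenspace_nat,
    Module.finrank_fin_fun]
  rfl

theorem exists_real_root (A : E3 →L[ℝ] E3) : ∃ r, (charPoly A).IsRoot r := by
  obtain ⟨Z, hZ⟩ := IsAlgClosed.exists_aeval_eq_zero ℂ (charPoly A) (by
    rw [degree_eq_natDegree (monic_charPoly A).ne_zero, natDegree_charPoly]; decide)
  by_cases h : Z.im = 0
  · have hZr : Z = algebraMap ℝ ℂ Z.re := by apply Complex.ext <;> simp [h]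
    rw [hZr, aeval_algebraMap_apply, coe_aeval_eq_eval] at hZ
    exact ⟨Z.re, (algebraMap ℝ ℂ).injective (hZ.trans (map_zero _).symm)⟩
  · obtain ⟨q, hq⟩ := quadratic_dvd_of_aeval_eq_zero_im_ne_zero _ hZ h
    have hm : (X ^ 2 - C (2 * Z.re) * X + C (‖Z‖ ^ 2)).Monic := by monicity!
    have hd : (X ^ 2 - C (2 * Z.re) * X + C (‖Z‖ ^ 2)).natDegree = 2 := by compute_degree!
    have hqm : q.Monic := hm.of_mul_monic_left (hq ▸ monic_charPoly A)
    have hqd : q.natDegree = 1 := by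
      have h1 := natDegree_charPoly A
      rw [hq, hm.natDegree_mul hqm, hd] at h1
      omega
    refine ⟨-q.coeff 0, ?_⟩
    rw [hq]
    refine root_mul_left_of_isRoot _ ?_
    rw [hqm.eq_X_add_C hqd]
    simp

theorem map_factor (a b c : ℝ) : ((X - C a) * (X - C b) * (X - C c) : ℝ[X]).map (algebraMap ℝ ℂ)
    = (X - C (a : ℂ)) * (X - C (b : ℂ)) * (X - C (c : ℂ)) := by
  simp

theorem trace_real {A : E3 →L[ℝ] E3} {a b c : ℂ}
    (h : (charPoly A).map (algebraMap ℝ ℂ) = (X - C a) * (X - C b) * (X - C c)) :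
    ∃ t : ℝ, a + b + c = t := by
  rw [charPoly_eq, ← Matrix.charpoly_map] at h
  refine ⟨(LinearMap.toMatrix' (A : E3 →ₗ[ℝ] E3)).trace, ?_⟩
  rw [← (trace_of_charpoly_eq h).1]
  simp [Matrix.trace_fin_three]

/-- Algebraic multiplicities transfer through `kerDim_three`, but `σ` is an arbitrary bijection of
`ℂ`, so reality of the new eigenvalues needs proof: one of them is real because a real cubic has a
real root, and the real trace determines the other. -/
theorem charPoly_eq_of_sameJordanType_double {A B : E3 →L[ℝ] E3} (h : SameJordanType A B) {a b : ℝ}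
    (hab : a ≠ b) (hA : charPoly A = (X - C a) * (X - C a) * (X - C b)) :
    ∃ a' b' : ℝ, a' ≠ b' ∧ charPoly B = (X - C a') * (X - C a') * (X - C b') := by
  obtain ⟨σ, hσ⟩ := h
  have hab' : (a : ℂ) ≠ b := by exact_mod_cast hab
  have hma : ((charPoly B).map (algebraMap ℝ ℂ)).rootMultiplicity (σ a) = 2 := by
    rw [← kerDim_three, ← hσ, kerDim_three, hA, map_factor, ← pow_two]
    rw [rootMultiplicity_mul (mul_ne_zero (pow_ne_zero _ (X_sub_C_ne_zero _)) (X_sub_C_ne_zero _)),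
      rootMultiplicity_X_sub_C_pow, rootMultiplicity_X_sub_C, if_neg hab']
  have hmb : ((charPoly B).map (algebraMap ℝ ℂ)).rootMultiplicity (σ b) = 1 := by
    rw [← kerDim_three, ← hσ, kerDim_three, hA, map_factor]
    rw [rootMultiplicity_mul (mul_ne_zero (mul_ne_zero (X_sub_C_ne_zero _) (X_sub_C_ne_zero _)) (X_sub_C_ne_zero _)),
      rootMultiplicity_mul (mul_ne_zero (X_sub_C_ne_zero _) (X_sub_C_ne_zero _))]
    simp only [rootMultiplicity_X_sub_C, if_neg hab'.symm, if_true]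
  have hne : σ a ≠ σ b := fun h => hab' (σ.injective h)
  have hP : (charPoly B).map (algebraMap ℝ ℂ) = (X - C (σ a)) * (X - C (σ a)) * (X - C (σ b)) := by
    have h1 := pow_rootMultiplicity_dvd ((charPoly B).map (algebraMap ℝ ℂ)) (σ a)
    have h2 := pow_rootMultiplicity_dvd ((charPoly B).map (algebraMap ℝ ℂ)) (σ b)
    rw [hma] at h1
    rw [hmb] at h2
    have h3 := ((isCoprime_X_sub_C_of_isUnit_sub (sub_ne_zero.2 hne).isUnit).pow (m := 2) (n := 1)).mul_dvd h1 h2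
    rw [← pow_two]
    rw [pow_one] at h3
    refine (eq_of_monic_of_dvd_of_natDegree_le (((monic_X_sub_C _).pow 2).mul (monic_X_sub_C _))
      ((monic_charPoly B).map _) h3 ?_)
    rw [natDegree_map, natDegree_charPoly, ((monic_X_sub_C _).pow 2).natDegree_mul (monic_X_sub_C _)]
    simp
  obtain ⟨r, hr⟩ := exists_real_root B
  obtain ⟨t, ht⟩ := trace_real hP
  have hr' : (r : ℂ) = σ a ∨ (r : ℂ) = σ b := by
    have h1 : ((charPoly B).map (algebraMap ℝ ℂ)).IsRoot (r : ℂ) := hr.map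
    rw [hP] at h1
    simp only [IsRoot, eval_mul, eval_sub, eval_X, eval_C, mul_eq_zero, sub_eq_zero, or_self] at h1
    exact h1
  have hreal : ∃ a' b' : ℝ, σ a = a' ∧ σ b = b' := by
    rcases hr' with h1 | h1
    · refine ⟨r, t - 2 * r, h1.symm, ?_⟩
      push_cast
      rw [h1, ← ht]; ring
    · refine ⟨(t - r) / 2, r, ?_, h1.symm⟩
      push_cast
      rw [h1, ← ht]; ring
  obtain ⟨a', b', ha', hb'⟩ := hreal
  refine ⟨a', b', fun h1 => hne (by rw [ha', hb', h1]), ?_⟩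
  apply map_injective _ (algebraMap ℝ ℂ).injective
  rw [hP, map_factor, ha', hb']

theorem charPoly_eq_of_sameJordanType_triple {A B : E3 →L[ℝ] E3} (h : SameJordanType A B) {a : ℝ}
    (hA : charPoly A = (X - C a) * (X - C a) * (X - C a)) :
    ∃ a' : ℝ, charPoly B = (X - C a') * (X - C a') * (X - C a') := by
  obtain ⟨σ, hσ⟩ := h
  have hma : ((charPoly B).map (algebraMap ℝ ℂ)).rootMultiplicity (σ a) = 3 := by
    rw [← kerDim_three, ← hσ, kerDim_three, hA, map_factor, ← pow_two, ← pow_succ,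
      rootMultiplicity_X_sub_C_pow]
  have hP : (charPoly B).map (algebraMap ℝ ℂ) = (X - C (σ a)) * (X - C (σ a)) * (X - C (σ a)) := by
    have h1 := pow_rootMultiplicity_dvd ((charPoly B).map (algebraMap ℝ ℂ)) (σ a)
    rw [hma] at h1
    rw [← pow_two, ← pow_succ]
    refine (eq_of_monic_of_dvd_of_natDegree_le ((monic_X_sub_C _).pow 3)
      ((monic_charPoly B).map _) h1 ?_)
    rw [natDegree_map, natDegree_charPoly]
    simp
  obtain ⟨t, ht⟩ := trace_real hP
  have hreal : σ a = ((t / 3 : ℝ) : ℂ) := by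
    push_cast
    rw [← ht]; ring
  refine ⟨t / 3, ?_⟩
  apply map_injective _ (algebraMap ℝ ℂ).injective
  rw [hP, map_factor, hreal]

/-- A real endomorphism of `ℝ³` has three real eigenvalues, or one real eigenvalue and a pair of
conjugate non-real ones. -/
theorem charPoly_cases (A : E3 →L[ℝ] E3) :
    (∃ a b c : ℝ, charPoly A = (X - C a) * (X - C b) * (X - C c)) ∨
      ∃ (l : ℝ) (Z : ℂ), (charPoly A).IsRoot l ∧ 0 < Z.im ∧
        ((charPoly A).map (algebraMap ℝ ℂ)).IsRoot Z := by
  obtain ⟨l, hl⟩ := exists_real_root A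
  obtain ⟨q, hq⟩ := dvd_iff_isRoot.2 hl
  have hqm : q.Monic := (monic_X_sub_C l).of_mul_monic_left (hq ▸ monic_charPoly A)
  have hqd : q.natDegree = 2 := by
    have h1 := natDegree_charPoly A
    rw [hq, (monic_X_sub_C l).natDegree_mul hqm, natDegree_X_sub_C] at h1
    omega
  obtain ⟨Z, hZ⟩ := IsAlgClosed.exists_root (q.map (algebraMap ℝ ℂ)) (by
    rw [degree_map, degree_eq_natDegree hqm.ne_zero, hqd]; decide)
  have hZA : ((charPoly A).map (algebraMap ℝ ℂ)).IsRoot Z := by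
    rw [hq, Polynomial.map_mul]
    exact root_mul_left_of_isRoot _ hZ
  rcases lt_trichotomy Z.im 0 with h | h | h
  · refine Or.inr ⟨l, starRingEnd ℂ Z, hl, by simpa using h, ?_⟩
    have h1 := aeval_conj (charPoly A) Z
    rw [IsRoot, eval_map_algebraMap] at hZA ⊢
    rw [h1, hZA, map_zero]
  · left
    have hZr : Z = (Z.re : ℂ) := by apply Complex.ext <;> simp [h]
    have hroot : q.IsRoot Z.re := by
      rw [hZr] at hZ
      exact IsRoot.of_map hZ (algebraMap ℝ ℂ).injective
    obtain ⟨s, hs⟩ := dvd_iff_isRoot.2 hroot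
    have hsm : s.Monic := (monic_X_sub_C Z.re).of_mul_monic_left (hs ▸ hqm)
    have hsd : s.natDegree = 1 := by
      rw [hs, (monic_X_sub_C Z.re).natDegree_mul hsm, natDegree_X_sub_C] at hqd
      omega
    refine ⟨l, Z.re, -s.coeff 0, ?_⟩
    have h2 := hsm.eq_X_add_C hsd
    rw [hq, hs, map_neg, sub_neg_eq_add, ← h2, mul_assoc]
  · exact Or.inr ⟨l, Z, hl, h, hZA⟩

theorem exists_left_eigenvector {A : E3 →L[ℝ] E3} {Z : ℂ}
    (h : ((charPoly A).map (algebraMap ℝ ℂ)).IsRoot Z) :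
    ∃ L : E3 →L[ℝ] ℂ, L ≠ 0 ∧ ∀ v, L (A v) = Z * L v := by
  set M := (LinearMap.toMatrix' (A : E3 →ₗ[ℝ] E3)) with hM
  rw [charPoly_eq, ← Matrix.charpoly_map, IsRoot, Matrix.eval_charpoly] at h
  obtain ⟨ℓ, hℓ0, hℓ⟩ := Matrix.exists_vecMul_eq_zero_iff.2 h
  have hℓ' : ℓ ᵥ* (M.map (algebraMap ℝ ℂ)) = Z • ℓ := by
    rw [Matrix.vecMul_sub] at hℓ
    rw [← sub_eq_zero.1 hℓ]
    ext i
    simp [mul_comm]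
  let L : E3 →L[ℝ] ℂ := ∑ i, (ContinuousLinearMap.proj i : E3 →L[ℝ] ℝ).smulRight (ℓ i)
  have hL : ∀ v, L v = ℓ ⬝ᵥ fun i => (v i : ℂ) := fun v => by
    simp [L, dotProduct, mul_comm]
  refine ⟨L, fun h0 => hℓ0 (funext fun i => ?_), fun v => ?_⟩
  · have h1 := hL (Pi.single i 1)
    rw [h0] at h1
    have h2 : (fun j => (((Pi.single i 1 : E3) j : ℝ) : ℂ)) = Pi.single i 1 := by
      ext j
      rcases eq_or_ne j i with rfl | hji
      · simp
      · simp [hji]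
    rw [h2, dotProduct_single] at h1
    simpa using h1.symm
  · rw [hL, hL, ← smul_eq_mul, ← smul_dotProduct, ← hℓ', ← Matrix.dotProduct_mulVec]
    congr 1
    rw [← complexify_ofReal, complexify, Matrix.toLin'_apply]

end Spectrum

/-! ### From stability and non-degeneracy to the normal forms. -/

section NormalForms

open Polynomial

variable {J : OperatorField} {p : E3}

theorem finrank_ker_le_one {A : E3 →L[ℝ] E3} {a : ℝ}
    (h : ∀ u v : E3, u ≠ 0 → A u = a • u → A v = a • v → ∃ s : ℝ, v = s • u) :
    Module.finrank ℝ (LinearMap.ker (A - a • ContinuousLinearMap.id ℝ E3 : E3 →L[ℝ] E3).toLinearMap) ≤ 1 := by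
  have hmem : ∀ w : LinearMap.ker (A - a • ContinuousLinearMap.id ℝ E3 : E3 →L[ℝ] E3).toLinearMap,
      A w = a • (w : E3) := fun w => sub_eq_zero.1 w.2
  by_cases hu : ∃ u : LinearMap.ker (A - a • ContinuousLinearMap.id ℝ E3 : E3 →L[ℝ] E3).toLinearMap, u ≠ 0
  · obtain ⟨u, hu⟩ := hu
    refine finrank_le_one u fun w => ?_
    obtain ⟨s, hs⟩ := h u w (fun h0 => hu (Subtype.ext h0)) (hmem u) (hmem w)
    exact ⟨s, Subtype.ext hs.symm⟩
  · push Not at hu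
    exact finrank_le_one 0 fun w => ⟨0, by rw [hu w, smul_zero]⟩

/-- The image of `A` has dimension at least two and cannot fit into the kernel of `B`. -/
theorem exists_comp_ne_zero {A B : E3 →L[ℝ] E3}
    (hA : Module.finrank ℝ (LinearMap.ker A.toLinearMap) ≤ 1)
    (hB : Module.finrank ℝ (LinearMap.ker B.toLinearMap) ≤ 1) : ∃ v, B (A v) ≠ 0 := by
  by_contra! h
  have h1 : LinearMap.range A.toLinearMap ≤ LinearMap.ker B.toLinearMap := by
    rintro _ ⟨v, rfl⟩
    exact h v
  have h2 := Submodule.finrank_mono h1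
  have h3 := LinearMap.finrank_range_add_finrank_ker A.toLinearMap
  rw [Module.finrank_fin_fun] at h3
  omega

theorem hasFormA_of_charPoly (hJ : SmoothNear J p) (hN : ∀ᶠ x in 𝓝 p, ∀ u v, nij J x u v = 0)
    {a b c : ℝ} (hab : a ≠ b) (hac : a ≠ c) (hbc : b ≠ c)
    (h : charPoly (J p) = (X - C a) * (X - C b) * (X - C c)) : HasFormA J p := by
  have hroot : ∀ i, ∃ v : E3, v ≠ 0 ∧ J p v = (![a, b, c] : Fin 3 → ℝ) i • v := fun i => by
    apply exists_eigenvector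
    rw [h]
    fin_cases i <;> simp [IsRoot]
  choose k hk heig using hroot
  refine hasFormA_of_eigenvectors hJ hN ?_ hk heig
  intro i j hij
  fin_cases i <;> fin_cases j <;> simp_all

/-- The simple eigenvalue `l₃` is an implicit function, so the double one is the smooth function
`(tr J - l₃) / 2`, provided stability keeps it double. The trace formula, minus the relation for
`l₃`, then yields `J^* dl = l dl`. -/
theorem hasFormB_of_charPoly (hJ : SmoothNear J p) (hN : ∀ᶠ x in 𝓝 p, ∀ u v, nij J x u v = 0)
    (hD : ∀ᶠ x in 𝓝 p, ∀ (a : ℝ) (u v : E3), u ≠ 0 → J x u = a • u → J x v = a • v →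
      ∃ s : ℝ, v = s • u)
    (hS : IsStableAt J p) {a b : ℝ} (hab : a ≠ b)
    (h : charPoly (J p) = (X - C a) * (X - C a) * (X - C b)) : HasFormB J p := by
  obtain ⟨k₃, hk₃, heig₃⟩ := exists_eigenvector (A := J p) (a := b) (by rw [h]; simp [IsRoot])
  obtain ⟨k₂, hk₂, heig₂⟩ := exists_eigenvector (A := J p) (a := a) (by rw [h]; simp [IsRoot])
  have him₃ : ∀ v, J p v - b • v ≠ k₃ := fun v hv => by
    have h1 := apply_of_charPoly_eq h v
    have h2 : (J p - b • ContinuousLinearMap.id ℝ E3) v = k₃ := hv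
    rw [h2] at h1
    have h3 : (J p - a • ContinuousLinearMap.id ℝ E3) k₃ = (b - a) • k₃ := by
      change J p k₃ - a • k₃ = _
      rw [heig₃, sub_smul]
    rw [h3, map_smul, h3, smul_smul] at h1
    have h4 := (smul_eq_zero.1 h1).resolve_right hk₃
    exact mul_ne_zero (sub_ne_zero.2 hab.symm) (sub_ne_zero.2 hab.symm) h4
  obtain ⟨l₃, hl₃, hl₃p, D₃, hD₃⟩ := exists_simple_eigenvalue hJ hk₃ heig₃
    (fun v hv => hD.self_of_nhds b k₃ v hk₃ heig₃ hv) him₃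
  have hτ₃ := D₃.fderiv_eigenvalue hJ hl₃ hN hD₃
  obtain ⟨z₃, g₃, hz₃, hg₃, -, hz₃J, hz₃ker, hlg₃⟩ := D₃.exists_coordinate hJ hl₃ hN hτ₃
  have hz₃k : fderiv ℝ z₃ p k₃ ≠ 0 := fun h0 => by
    obtain ⟨v, hv⟩ := hz₃ker.self_of_nhds _ h0
    rw [shift_apply, hl₃p] at hv
    exact him₃ v hv
  have htrs : SmoothNear (fun x => traceCLM (J x)) p := hJ.clm_comp traceCLM
  have htrs₂ : SmoothNear (fun x => traceCLM ((J x).comp (J x))) p := by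
    filter_upwards [hJ] with x hx using traceCLM.contDiff.contDiffAt.comp x (hx.clm_comp hx)
  let l : E3 → ℝ := fun x => (traceCLM (J x) - l₃ x) / 2
  have hl : SmoothNear l p := by
    filter_upwards [htrs, hl₃] with x h1 h2 using (h1.sub h2).div_const 2
  have htp := traceCLM_of_charPoly_eq h
  have hlp : l p = a := by
    simp only [l]
    rw [htp.1, hl₃p]; ring
  -- This expression is `-2 (a - b)²` at `p` and would vanish wherever `l₃` were the double root; it
  -- identifies `l₃` with the simple root near `p`.
  have hdisc : ∀ᶠ x in 𝓝 p,
      traceCLM ((J x).comp (J x)) - 2 * l₃ x ^ 2 - (traceCLM (J x) - 2 * l₃ x) ^ 2 ≠ 0 := by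
    have h1 : ContinuousAt (fun x => traceCLM ((J x).comp (J x)) - 2 * l₃ x ^ 2
        - (traceCLM (J x) - 2 * l₃ x) ^ 2) p :=
      (htrs₂.continuousAt.sub (continuousAt_const.mul (hl₃.continuousAt.pow 2))).sub
        ((htrs.continuousAt.sub (continuousAt_const.mul hl₃.continuousAt)).pow 2)
    refine h1.eventually_ne ?_
    rw [htp.1, htp.2, hl₃p]
    have h2 : a ^ 2 + a ^ 2 + b ^ 2 - 2 * b ^ 2 - (a + a + b - 2 * b) ^ 2 = -2 * (a - b) ^ 2 := by
      ring
    rw [h2]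
    exact mul_ne_zero (by norm_num) (pow_ne_zero _ (sub_ne_zero.2 hab))
  have hchar : ∀ᶠ x in 𝓝 p, charPoly (J x) = (X - C (l x)) * (X - C (l x)) * (X - C (l₃ x)) := by
    filter_upwards [hS, hdisc, D₃.apply_k, D₃.ξ_k] with x h1 h2 h3 h4
    obtain ⟨a', b', -, hc⟩ := charPoly_eq_of_sameJordanType_double h1 hab h
    obtain ⟨h5, h6⟩ := traceCLM_of_charPoly_eq hc
    have h7 : (charPoly (J x)).IsRoot (l₃ x) :=
      isRoot_of_eigenvector (v := D₃.k x) (fun h0 => by rw [h0, map_zero] at h4; exact zero_ne_one h4)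
        (sub_eq_zero.1 h3)
    rw [hc] at h7
    simp only [IsRoot, eval_mul, eval_sub, eval_X, eval_C, mul_eq_zero, sub_eq_zero, or_self] at h7
    have h8 : l₃ x = b' := by
      refine h7.resolve_left fun h9 => h2 ?_
      rw [h5, h6, h9]; ring
    have h9 : l x = a' := by
      simp only [l]
      rw [h5, h8]; ring
    rw [h8, h9, hc]
  have htr : ∀ᶠ x in 𝓝 p, traceCLM (J x) = 2 * l x + l₃ x ∧
      traceCLM ((J x).comp (J x)) = 2 * l x ^ 2 + l₃ x ^ 2 := by
    filter_upwards [hchar] with x hx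
    obtain ⟨h1, h2⟩ := traceCLM_of_charPoly_eq hx
    exact ⟨by rw [h1]; ring, by rw [h2]; ring⟩
  have hτ : ∀ᶠ x in 𝓝 p, ∀ u, fderiv ℝ l x (J x u) = l x * fderiv ℝ l x u := by
    filter_upwards [htr.eventually_nhds, hJ, hN, hl, hl₃, hτ₃] with x h1 h2 h3 h4 h5 h6 u
    have h7 := fderiv_trace_sq h2.diffAt h3 u
    have h8 : (fun x => traceCLM (J x)) =ᶠ[𝓝 x] fun x => 2 * l x + l₃ x := by
      filter_upwards [h1] with y hy using hy.1
    have h9 : (fun x => traceCLM ((J x).comp (J x))) =ᶠ[𝓝 x] fun x => 2 * l x ^ 2 + l₃ x ^ 2 := by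
      filter_upwards [h1] with y hy using hy.2
    have h10 : HasFDerivAt (fun x => 2 * l x + l₃ x)
        ((2 : ℝ) • fderiv ℝ l x + fderiv ℝ l₃ x) x :=
      (h4.diffAt.hasFDerivAt.const_mul 2).add h5.diffAt.hasFDerivAt
    have h11 := ((h4.diffAt.hasFDerivAt.pow 2).const_mul 2).add (h5.diffAt.hasFDerivAt.pow 2)
    have h12 : fderiv ℝ (fun x => 2 * l x ^ 2 + l₃ x ^ 2) x u
        = 4 * l x * fderiv ℝ l x u + 2 * l₃ x * fderiv ℝ l₃ x u := by
      have h13 : HasFDerivAt (fun x => 2 * l x ^ 2 + l₃ x ^ 2) _ x := h11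
      rw [h13.fderiv]
      simp
      ring
    rw [h8.fderiv_eq, h9.fderiv_eq, h12, h10.fderiv] at h7
    simp only [_root_.add_apply, smul_apply, smul_eq_mul, h6] at h7
    linarith
  obtain ⟨D⟩ := CorankOneData.nonempty (hJ.shift hl) hk₂ (fun v hv => by
      rw [shift_apply, hlp] at hv
      exact hD.self_of_nhds a k₂ v hk₂ heig₂ (sub_eq_zero.1 hv)) (by
    filter_upwards [hchar] with x hx
    obtain ⟨v, hv, hJv⟩ := exists_eigenvector (A := J x) (a := l x) (by rw [hx]; simp [IsRoot])
    exact ⟨v, hv, sub_eq_zero.2 hJv⟩)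
  refine hasFormB_of_corankOneData hJ hN hl D hτ ?_ hz₃ hg₃ ?_ ?_ ?_
  · filter_upwards [hchar, hD, D.eq_smul_k] with x h1 h2 h3
    -- For `y = (J - l₃) v` with `(J - l) y ≠ 0`, Cayley–Hamilton gives `(J - l)² y = 0`. So `(J -
    -- l) y` is a nonzero multiple of the kernel vector.
    obtain ⟨v, hv⟩ := exists_comp_ne_zero (finrank_ker_le_one (h2 (l₃ x))) (finrank_ker_le_one (h2 (l x)))
    have h4 := apply_of_charPoly_eq h1 v
    set y := (J x - l₃ x • ContinuousLinearMap.id ℝ E3) v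
    have h5 : shift J l x (shift J l x y) = 0 := h4
    have h6 := h3 _ h5
    have h7 : D.ξ (shift J l x y) ≠ 0 := fun h0 => hv (by
      rw [h0, zero_smul] at h6
      exact h6)
    refine ⟨(D.ξ (shift J l x y))⁻¹ • y, ?_⟩
    rw [map_smul]
    exact (inv_smul_eq_iff₀ h7).2 h6
  · filter_upwards [hz₃J, hlg₃] with x h1 h2 v
    rw [h1, h2]
  · rw [hlp, ← hlg₃.self_of_nhds, hl₃p]
    exact hab
  · intro u hu
    -- By Cayley–Hamilton `(J - a)² u` lies on the line of `k₃`, where `dz₃` does not vanish.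
    have h1 : charPoly (J p) = (X - C b) * (X - C a) * (X - C a) := by rw [h]; ring
    have h2 := apply_of_charPoly_eq h1 u
    have h3 : shift J l p = J p - a • ContinuousLinearMap.id ℝ E3 := by rw [← hlp]; rfl
    rw [h3] at hu ⊢
    obtain ⟨s, hs⟩ := hD.self_of_nhds b k₃ _ hk₃ heig₃ (sub_eq_zero.1 h2)
    rw [hs, map_smul] at hu
    rw [hs, (smul_eq_zero.1 hu).resolve_right hz₃k, zero_smul]

/-- Stability forces a triple eigenvalue nearby, namely the smooth function `tr J / 3`; the trace
formula gives `J^* dl = l dl`. Two factors `J - l` have nonzero product because each has corank at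
most one, so the kernel lies in the image of `(J - l)²`. -/
theorem hasFormC_of_charPoly (hJ : SmoothNear J p) (hN : ∀ᶠ x in 𝓝 p, ∀ u v, nij J x u v = 0)
    (hD : ∀ᶠ x in 𝓝 p, ∀ (a : ℝ) (u v : E3), u ≠ 0 → J x u = a • u → J x v = a • v →
      ∃ s : ℝ, v = s • u)
    (hS : IsStableAt J p) {a : ℝ}
    (h : charPoly (J p) = (X - C a) * (X - C a) * (X - C a)) : HasFormC J p := by
  obtain ⟨k₀, hk₀, heig⟩ := exists_eigenvector (A := J p) (a := a) (by rw [h]; simp [IsRoot])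
  have htrs : SmoothNear (fun x => traceCLM (J x)) p := hJ.clm_comp traceCLM
  let l : E3 → ℝ := fun x => traceCLM (J x) / 3
  have hl : SmoothNear l p := by
    filter_upwards [htrs] with x h1 using h1.div_const 3
  have hchar : ∀ᶠ x in 𝓝 p, charPoly (J x) = (X - C (l x)) * (X - C (l x)) * (X - C (l x)) := by
    filter_upwards [hS] with x h1
    obtain ⟨a', hc⟩ := charPoly_eq_of_sameJordanType_triple h1 h
    have h9 : l x = a' := by
      simp only [l]
      rw [(traceCLM_of_charPoly_eq hc).1]; ring
    rw [h9, hc]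
  have hlp : l p = a := by
    simp only [l]
    rw [(traceCLM_of_charPoly_eq h).1]; ring
  have htr : ∀ᶠ x in 𝓝 p, traceCLM (J x) = 3 * l x ∧
      traceCLM ((J x).comp (J x)) = 3 * l x ^ 2 := by
    filter_upwards [hchar] with x hx
    obtain ⟨h1, h2⟩ := traceCLM_of_charPoly_eq hx
    exact ⟨by rw [h1]; ring, by rw [h2]; ring⟩
  have hτ : ∀ᶠ x in 𝓝 p, ∀ u, fderiv ℝ l x (J x u) = l x * fderiv ℝ l x u := by
    filter_upwards [htr.eventually_nhds, hJ, hN, hl] with x h1 h2 h3 h4 u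
    have h7 := fderiv_trace_sq h2.diffAt h3 u
    have h8 : (fun x => traceCLM (J x)) =ᶠ[𝓝 x] fun x => 3 * l x := by
      filter_upwards [h1] with y hy using hy.1
    have h9 : (fun x => traceCLM ((J x).comp (J x))) =ᶠ[𝓝 x] fun x => 3 * l x ^ 2 := by
      filter_upwards [h1] with y hy using hy.2
    have h10 : HasFDerivAt (fun x => 3 * l x) ((3 : ℝ) • fderiv ℝ l x) x :=
      h4.diffAt.hasFDerivAt.const_mul 3
    have h11 := (h4.diffAt.hasFDerivAt.pow 2).const_mul 3
    have h12 : fderiv ℝ (fun x => 3 * l x ^ 2) x u = 6 * l x * fderiv ℝ l x u := by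
      have h13 : HasFDerivAt (fun x => 3 * l x ^ 2) _ x := h11
      rw [h13.fderiv]
      simp
      ring
    rw [h8.fderiv_eq, h9.fderiv_eq, h12, h10.fderiv] at h7
    simp only [smul_apply, smul_eq_mul] at h7
    linarith
  obtain ⟨D⟩ := CorankOneData.nonempty (hJ.shift hl) hk₀ (fun v hv => by
      rw [shift_apply, hlp] at hv
      exact hD.self_of_nhds a k₀ v hk₀ heig (sub_eq_zero.1 hv)) (by
    filter_upwards [hchar] with x hx
    obtain ⟨v, hv, hJv⟩ := exists_eigenvector (A := J x) (a := l x) (by rw [hx]; simp [IsRoot])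
    exact ⟨v, hv, sub_eq_zero.2 hJv⟩)
  refine hasFormC_of_corankOneData hJ hN hl D hτ ?_ fun u => ?_
  · filter_upwards [hchar, hD, D.eq_smul_k] with x h1 h2 h3
    obtain ⟨v, hv⟩ := exists_comp_ne_zero (finrank_ker_le_one (h2 (l x))) (finrank_ker_le_one (h2 (l x)))
    have h5 : shift J l x (shift J l x (shift J l x v)) = 0 := apply_of_charPoly_eq h1 v
    have h6 := h3 _ h5
    have h7 : D.ξ (shift J l x (shift J l x v)) ≠ 0 := fun h0 => hv (by
      rw [h0, zero_smul] at h6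
      exact h6)
    refine ⟨(D.ξ (shift J l x (shift J l x v)))⁻¹ • v, ?_⟩
    rw [map_smul, map_smul]
    exact (inv_smul_eq_iff₀ h7).2 h6
  · exact apply_of_charPoly_eq hchar.self_of_nhds u

theorem hasFormD_of_charPoly (hJ : SmoothNear J p) (hN : ∀ᶠ x in 𝓝 p, ∀ u v, nij J x u v = 0)
    {l : ℝ} {Z : ℂ} (hl : (charPoly (J p)).IsRoot l) (hZ : 0 < Z.im)
    (hr : ((charPoly (J p)).map (algebraMap ℝ ℂ)).IsRoot Z) : HasFormD J p := by
  obtain ⟨k₀, hk₀, heig⟩ := exists_eigenvector hl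
  obtain ⟨L, hL0, hL⟩ := exists_left_eigenvector hr
  have hZl : (l : ℂ) - Z ≠ 0 := fun h => by
    have := congrArg Complex.im h
    simp at this
    exact hZ.ne' this
  have hzero : ∀ v, J p v = l • v → L v = 0 := fun v hv => by
    have h1 := hL v
    rw [hv, map_smul, Complex.real_smul] at h1
    exact (mul_eq_zero.1 (show ((l : ℂ) - Z) * L v = 0 by linear_combination h1)).resolve_left hZl
  obtain ⟨u, hu⟩ : ∃ u, L u ≠ 0 := by
    by_contra! h
    exact hL0 (ContinuousLinearMap.ext h)
  -- `L u` and `L (J u) = Z L u` form a real basis of `ℂ`, as `Z` is not real. Hence `ker L` is a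
  -- line, the one spanned by `k₀`.
  have hsurj : LinearMap.range L.toLinearMap = ⊤ := by
    rw [LinearMap.range_eq_top]
    intro h
    set t := h / L u
    refine ⟨(t.re - t.im / Z.im * Z.re) • u + (t.im / Z.im) • J p u, ?_⟩
    change L _ = h
    rw [map_add, map_smul, map_smul, hL, Complex.real_smul, Complex.real_smul, ← mul_assoc, ← add_mul]
    have h1 : ((t.re - t.im / Z.im * Z.re : ℝ) : ℂ) + ((t.im / Z.im : ℝ) : ℂ) * Z = t := by
      apply Complex.ext
      · simp [-Complex.ofReal_div, -Complex.ofReal_sub, -Complex.ofReal_mul]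
      · simp [-Complex.ofReal_div, -Complex.ofReal_sub, -Complex.ofReal_mul, hZ.ne']
    rw [h1, div_mul_cancel₀ _ hu]
  have hdim := LinearMap.finrank_range_add_finrank_ker L.toLinearMap
  rw [hsurj, finrank_top, Complex.finrank_real_complex, Module.finrank_fin_fun] at hdim
  have hLker : ∀ v, L v = 0 → ∃ s : ℝ, v = s • k₀ := fun v hv => by
    obtain ⟨s, hs⟩ := exists_smul_eq_of_finrank_eq_one (K := ℝ)
      (V := LinearMap.ker L.toLinearMap) (by omega) (x := ⟨k₀, hzero k₀ heig⟩)
      (fun h => hk₀ (congrArg Subtype.val h)) ⟨v, hv⟩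
    exact ⟨s, (congrArg Subtype.val hs).symm⟩
  refine hasFormD_of_eigenvectors hJ hN hk₀ heig (fun v hv => hLker v (hzero v hv)) (fun v hv => ?_)
    hZ hL hLker
  have h1 := hzero k₀ heig
  rw [← hv, map_sub, map_smul, hL, Complex.real_smul] at h1
  have h2 : ((l : ℂ) - Z) * L v = 0 := by linear_combination -h1
  obtain ⟨s, rfl⟩ := hLker v ((mul_eq_zero.1 h2).resolve_left hZl)
  rw [map_smul, heig, smul_comm, sub_self] at hv
  exact hk₀ hv.symm

theorem hasForm_of_isNijenhuisAt (hJ : SmoothAt J p) (hN : IsNijenhuisAt J p) (hS : IsStableAt J p)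
    (hD : IsNondegenerateAt J p) :
    HasFormA J p ∨ HasFormB J p ∨ HasFormC J p ∨ HasFormD J p := by
  have hJ' : SmoothNear J p := hJ
  have hN' := (isNijenhuisAt_iff hJ).1 hN
  have hD' : ∀ᶠ x in 𝓝 p, ∀ (a : ℝ) (u v : E3), u ≠ 0 → J x u = a • u → J x v = a • v →
      ∃ s : ℝ, v = s • u := by
    filter_upwards [hD] with x hx a u v hu h1 h2
    exact exists_smul_of_kerDim_le (hx a) hu h1 h2
  rcases charPoly_cases (J p) with ⟨a, b, c, h⟩ | ⟨l, Z, hl, hZ, hr⟩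
  · by_cases hab : a = b
    · subst hab
      by_cases hac : a = c
      · subst hac
        exact Or.inr (Or.inr (Or.inl (hasFormC_of_charPoly hJ' hN' hD' hS h)))
      · exact Or.inr (Or.inl (hasFormB_of_charPoly hJ' hN' hD' hS hac h))
    · by_cases hac : a = c
      · subst hac
        exact Or.inr (Or.inl (hasFormB_of_charPoly hJ' hN' hD' hS hab (h.trans (by ring))))
      · by_cases hbc : b = c
        · subst hbc
          exact Or.inr (Or.inl (hasFormB_of_charPoly hJ' hN' hD' hS (Ne.symm hab)
            (h.trans (by ring))))
        · exact Or.inl (hasFormA_of_charPoly hJ' hN' hab hac hbc h)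
  · exact Or.inr (Or.inr (Or.inr (hasFormD_of_charPoly hJ' hN' hl hZ hr)))

end NormalForms

/-! ### Comparing Jordan types through kernel dimensions. -/

section JordanType

theorem kerDim_eq_of_intertwines {A B : E3 →L[ℝ] E3} {T S : E3 →L[ℝ] E3}
    (hT : ∀ v, T (A v) = B (T v)) (hST : ∀ v, S (T v) = v) (hTS : ∀ v, T (S v) = v) (μ : ℂ) (k : ℕ) :
    kerDim A μ k = kerDim B μ k := by
  have hcomp : ∀ C D : E3 →L[ℝ] E3, complexify (C.comp D) = complexify C ∘ₗ complexify D := fun C D => by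
    have h1 : ((C.comp D : E3 →L[ℝ] E3) : E3 →ₗ[ℝ] E3) = (C : E3 →ₗ[ℝ] E3) ∘ₗ (D : E3 →ₗ[ℝ] E3) := rfl
    rw [complexify, h1, LinearMap.toMatrix'_comp, Matrix.map_mul, Matrix.toLin'_mul]
    rfl
  have hid : complexify (ContinuousLinearMap.id ℝ E3) = LinearMap.id := by
    have h1 : ((ContinuousLinearMap.id ℝ E3 : E3 →L[ℝ] E3) : E3 →ₗ[ℝ] E3) = LinearMap.id := rfl
    rw [complexify, h1, LinearMap.toMatrix'_id, Matrix.map_one _ (map_zero _) (map_one _),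
      Matrix.toLin'_one]
  have h1 : complexify S ∘ₗ complexify T = LinearMap.id := by
    rw [← hcomp, ← hid]; congr 1; ext1 v; exact hST v
  have h2 : complexify T ∘ₗ complexify S = LinearMap.id := by
    rw [← hcomp, ← hid]; congr 1; ext1 v; exact hTS v
  have h3 : complexify T ∘ₗ complexify A = complexify B ∘ₗ complexify T := by
    rw [← hcomp, ← hcomp]; congr 1; ext1 v; exact hT v
  let e : (Fin 3 → ℂ) ≃ₗ[ℂ] (Fin 3 → ℂ) := LinearEquiv.ofLinearMap _ _ h2 h1
  let F : Module.End ℂ (Fin 3 → ℂ) := complexify A - μ • LinearMap.id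
  let G : Module.End ℂ (Fin 3 → ℂ) := complexify B - μ • LinearMap.id
  have h4 : ∀ v, e (F v) = G (e v) := fun v => by
    have := LinearMap.congr_fun h3 v
    simp only [LinearMap.comp_apply] at this
    simp [e, F, G, this]
  have h5 : ∀ (k : ℕ) v, e ((F ^ k) v) = (G ^ k) (e v) := fun k => by
    induction k with
    | zero => intro v; simp
    | succ k ih => intro v; rw [pow_succ, pow_succ, Module.End.mul_apply, Module.End.mul_apply, ih, h4]
  have h6 : (LinearMap.ker (F ^ k)).map e.toLinearMap = LinearMap.ker (G ^ k) := by
    ext w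
    constructor
    · rintro ⟨v, hv, rfl⟩
      have hv' : (F ^ k) v = 0 := hv
      change (G ^ k) (e v) = 0
      rw [← h5, hv', map_zero]
    · intro hw
      refine ⟨e.symm w, ?_, e.apply_symm_apply w⟩
      change (F ^ k) (e.symm w) = 0
      apply e.injective
      rw [h5, e.apply_symm_apply, map_zero]
      exact hw
  change Module.finrank ℂ (LinearMap.ker (F ^ k)) = Module.finrank ℂ (LinearMap.ker (G ^ k))
  rw [← h6]
  exact (LinearEquiv.finrank_map_eq e _).symm

/-- `kerDim A μ k` does not change if `A - μ` is multiplied by a commuting invertible matrix. -/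
theorem kerDim_eq_of_factor {A : E3 →L[ℝ] E3} {μ : ℂ} {Q K : Matrix (Fin 3) (Fin 3) ℂ}
    (hQ : Q.det ≠ 0) (hQK : Q * K = K * Q)
    (h : (LinearMap.toMatrix' (A : E3 →ₗ[ℝ] E3)).map (algebraMap ℝ ℂ) - μ • 1 = Q * K) (k : ℕ) :
    kerDim A μ k = Module.finrank ℂ (LinearMap.ker (Matrix.toLin' (K ^ k))) := by
  have h1 : complexify A - μ • LinearMap.id = Matrix.toLin' (Q * K) := by
    rw [← h, map_sub, map_smul, Matrix.toLin'_one]; rfl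
  have h2 : (complexify A - μ • LinearMap.id) ^ k = Matrix.toLin' (Q ^ k) ∘ₗ Matrix.toLin' (K ^ k) := by
    rw [h1, ← Matrix.toLin'_pow, (show Commute Q K from hQK).mul_pow, Matrix.toLin'_mul]
  have h3 : LinearMap.ker (Matrix.toLin' (Q ^ k)) = ⊥ := by
    rw [LinearMap.ker_eq_bot']
    intro v hv
    rw [Matrix.toLin'_apply] at hv
    exact Matrix.eq_zero_of_mulVec_eq_zero (by rw [Matrix.det_pow]; exact pow_ne_zero _ hQ) hv
  rw [kerDim, h2, LinearMap.ker_comp_of_ker_eq_bot _ h3]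

/-- The distinct eigenvalues of `A`, with the dimensions of the iterated kernels. -/
structure HasKerDims {n : ℕ} (A : E3 →L[ℝ] E3) (ev : Fin n → ℂ) (d : Fin n → ℕ → ℕ) : Prop where
  injective : Function.Injective ev
  kerDim_eigenvalue : ∀ i k, kerDim A (ev i) k = d i k
  kerDim_ne : ∀ μ k, (∀ i, μ ≠ ev i) → kerDim A μ k = 0

/-- The group of permutations of `ℂ` is `n`-transitive, so the correspondence of the finitely many
eigenvalues extends to a bijection of `ℂ`; elsewhere all dimensions are zero. -/
theorem HasKerDims.sameJordanType {n : ℕ} {A B : E3 →L[ℝ] E3} {ev ev' : Fin n → ℂ}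
    {d : Fin n → ℕ → ℕ} (hA : HasKerDims A ev d) (hB : HasKerDims B ev' d) : SameJordanType A B := by
  have := Equiv.Perm.isMultiplyPretransitive ℂ n
  obtain ⟨σ, hσ⟩ := MulAction.exists_smul_eq (Equiv.Perm ℂ) (⟨ev, hA.injective⟩ : Fin n ↪ ℂ)
    ⟨ev', hB.injective⟩
  have hσ' : ∀ i, σ (ev i) = ev' i := fun i => DFunLike.congr_fun hσ i
  refine ⟨σ, fun μ k => ?_⟩
  by_cases h : ∃ i, μ = ev i
  · obtain ⟨i, rfl⟩ := h
    rw [hA.kerDim_eigenvalue, hσ', hB.kerDim_eigenvalue]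
  · push Not at h
    rw [hA.kerDim_ne μ k h, hB.kerDim_ne _ k fun i hi => h i (σ.injective (hi.trans (hσ' i).symm))]

theorem HasKerDims.of_intertwines {n : ℕ} {A B : E3 →L[ℝ] E3} {ev : Fin n → ℂ}
    {d : Fin n → ℕ → ℕ} (hB : HasKerDims B ev d) {T S : E3 →L[ℝ] E3}
    (hT : ∀ v, T (A v) = B (T v)) (hST : ∀ v, S (T v) = v) (hTS : ∀ v, T (S v) = v) :
    HasKerDims A ev d :=
  ⟨hB.injective, fun i k => by rw [kerDim_eq_of_intertwines hT hST hTS, hB.kerDim_eigenvalue],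
    fun μ k h => by rw [kerDim_eq_of_intertwines hT hST hTS, hB.kerDim_ne μ k h]⟩

theorem HasKerDims.kerDim_le {n : ℕ} {A : E3 →L[ℝ] E3} {ev : Fin n → ℂ} {d : Fin n → ℕ → ℕ}
    (hA : HasKerDims A ev d) (hd : ∀ i, d i 1 ≤ 1) (μ : ℂ) : kerDim A μ 1 ≤ 1 := by
  by_cases h : ∃ i, μ = ev i
  · obtain ⟨i, rfl⟩ := h
    rw [hA.kerDim_eigenvalue]
    exact hd i
  · push Not at h
    rw [hA.kerDim_ne μ 1 h]
    exact zero_le_one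

/-- The dimensions of the kernels of the powers of a matrix. -/
noncomputable def powKerDim (K : Matrix (Fin 3) (Fin 3) ℂ) (k : ℕ) : ℕ :=
  Module.finrank ℂ (LinearMap.ker (Matrix.toLin' (K ^ k)))

theorem powKerDim_one_le {K : Matrix (Fin 3) (Fin 3) ℂ} {e : Fin 3 → ℂ}
    (h : ∀ v, K *ᵥ v = 0 → ∃ c : ℂ, v = c • e) : powKerDim K 1 ≤ 1 := by
  have h1 : LinearMap.ker (Matrix.toLin' (K ^ 1)) ≤ Submodule.span ℂ {e} := fun v hv => by
    rw [LinearMap.mem_ker, pow_one, Matrix.toLin'_apply] at hv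
    obtain ⟨c, rfl⟩ := h v hv
    exact Submodule.smul_mem _ _ (Submodule.mem_span_singleton_self e)
  exact (Submodule.finrank_mono h1).trans ((finrank_span_le_card {e}).trans (by simp))

/-- All dependence on the point goes into the invertible factors `Q i`, so the dimensions are those
of the powers of `K i`. For stability they need not be computed, only be the same at every point
when the `K i` are constant. -/
theorem hasKerDims_of_factor {n : ℕ} {A : E3 →L[ℝ] E3} {M : Matrix (Fin 3) (Fin 3) ℂ}
    (hM : (LinearMap.toMatrix' (A : E3 →ₗ[ℝ] E3)).map (algebraMap ℝ ℂ) = M)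
    {ev : Fin n → ℂ} (hev : Function.Injective ev) {Q K : Fin n → Matrix (Fin 3) (Fin 3) ℂ}
    (hQ : ∀ i, (Q i).det ≠ 0) (hQK : ∀ i, Q i * K i = K i * Q i)
    (h : ∀ i, M - ev i • 1 = Q i * K i)
    (hdet : ∀ μ, (∀ i, μ ≠ ev i) → (M - μ • 1).det ≠ 0) :
    HasKerDims A ev fun i => powKerDim (K i) := by
  refine ⟨hev, fun i k => kerDim_eq_of_factor (hQ i) (hQK i) (by rw [hM, h i]) k, fun μ k hμ => ?_⟩
  rw [kerDim_eq_of_factor (Q := M - μ • 1) (K := 1) (hdet μ hμ) (by simp) (by rw [hM, mul_one]), one_pow,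
    Matrix.toLin'_one, LinearMap.ker_id, finrank_bot]

end JordanType

/-! ### Operator fields given by matrices in a chart. -/

section MatrixFields

/-- The endomorphism with a given matrix. -/
noncomputable def matCLM (M : Matrix (Fin 3) (Fin 3) ℝ) : E3 →L[ℝ] E3 :=
  ∑ i, ∑ j, M i j • (ContinuousLinearMap.proj j : E3 →L[ℝ] ℝ).smulRight (Pi.single i 1 : E3)

theorem matCLM_apply (M : Matrix (Fin 3) (Fin 3) ℝ) (v : E3) : matCLM M v = M *ᵥ v := by
  ext i
  simp [matCLM, Matrix.mulVec, dotProduct, Finset.sum_apply, Pi.single_apply]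

theorem toMatrix'_matCLM (M : Matrix (Fin 3) (Fin 3) ℝ) :
    LinearMap.toMatrix' (matCLM M : E3 →ₗ[ℝ] E3) = M := by
  have h : (matCLM M : E3 →ₗ[ℝ] E3) = Matrix.toLin' M :=
    LinearMap.ext fun v => matCLM_apply M v
  rw [h, LinearMap.toMatrix'_toLin']

theorem hasFDerivAt_matCLM {M : E3 → Matrix (Fin 3) (Fin 3) ℝ} {M' : Fin 3 → Fin 3 → E3 →L[ℝ] ℝ}
    {y : E3} (h : ∀ i j, HasFDerivAt (fun y => M y i j) (M' i j) y) :
    DifferentiableAt ℝ (fun y => matCLM (M y)) y ∧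
      ∀ w v, fderiv ℝ (fun y => matCLM (M y)) y w v = (Matrix.of fun i j => M' i j w) *ᵥ v := by
  have h1 : HasFDerivAt (fun y => matCLM (M y)) (∑ i, ∑ j, (M' i j).smulRight
      ((ContinuousLinearMap.proj j : E3 →L[ℝ] ℝ).smulRight (Pi.single i 1 : E3))) y := by
    refine HasFDerivAt.fun_sum fun i _ => HasFDerivAt.fun_sum fun j _ => ?_
    exact HasFDerivAt.smul_const (F := E3 →L[ℝ] E3) (h i j) _
  refine ⟨h1.differentiableAt, fun w v => ?_⟩
  rw [h1.fderiv, ← matCLM_apply]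
  simp [matCLM]

variable {J : OperatorField} {p : E3} {φ : OpenPartialHomeomorph E3 E3}
  {M : E3 → Matrix (Fin 3) (Fin 3) ℝ}

/-- An operator field is a stable non-degenerate Nijenhuis operator if its matrix in some
coordinates has this property. -/
theorem isNijenhuisAt_of_hasMatrixIn (hJ : SmoothAt J p) (hφ : IsSmoothChartAt φ p)
    (hM : HasMatrixIn J φ M)
    (hdiff : ∀ y ∈ φ.target, DifferentiableAt ℝ (fun y => matCLM (M y)) y)
    (hnij : ∀ y ∈ φ.target, ∀ u v, nij (fun y => matCLM (M y)) y u v = 0)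
    {n : ℕ} {d : Fin n → ℕ → ℕ} (hd : ∀ i, d i 1 ≤ 1)
    (hdim : ∀ y ∈ φ.target, ∃ ev, HasKerDims (matCLM (M y)) ev d) :
    IsNijenhuisAt J p ∧ IsStableAt J p ∧ IsNondegenerateAt J p := by
  have hsrc := φ.open_source.mem_nhds hφ.mem_source
  have h1 : ∀ x ∈ φ.source, ContDiffAt ℝ ∞ φ x := fun x hx =>
    hφ.contDiffOn.contDiffAt (φ.open_source.mem_nhds hx)
  have h2 : ∀ y ∈ φ.target, ContDiffAt ℝ ∞ φ.symm y := fun y hy =>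
    hφ.contDiffOn_symm.contDiffAt (φ.open_target.mem_nhds hy)
  have hST : ∀ x ∈ φ.source, ∀ v, fderiv ℝ φ.symm (φ x) (fderiv ℝ φ x v) = v := fun x hx v =>
    fderiv_symm_comp (fun _ => rfl) hx (h1 x hx) (h2 _ (φ.map_source hx)) v
  have hTS : ∀ x ∈ φ.source, ∀ v, fderiv ℝ φ x (fderiv ℝ φ.symm (φ x) v) = v := fun x hx v => by
    have h3 := φ.map_source hx
    have := fderiv_comp_symm (f := φ) (φ := φ) (fun _ => rfl) h3
      (by rw [φ.left_inv hx]; exact h1 x hx) (h2 _ h3) v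
    rwa [φ.left_inv hx] at this
  have hM' : ∀ x ∈ φ.source, ∀ v, fderiv ℝ φ x (J x v) = matCLM (M (φ x)) (fderiv ℝ φ x v) :=
    fun x hx v => by rw [hM x hx v, matCLM_apply]
  have hJd : ∀ x ∈ φ.source, ∃ ev, HasKerDims (J x) ev d := fun x hx => by
    obtain ⟨ev, hev⟩ := hdim _ (φ.map_source hx)
    exact ⟨ev, hev.of_intertwines (hM' x hx) (hST x hx) (hTS x hx)⟩
  refine ⟨(isNijenhuisAt_iff hJ).2 ?_, ?_, ?_⟩
  · filter_upwards [hsrc, hJ] with x hx hJx u v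
    have h3 := fderiv_nij hJx.diffAt (h1 x hx) (hdiff _ (φ.map_source hx)) (by
      filter_upwards [φ.open_source.mem_nhds hx] with y hy using hM' y hy) u v
    rw [hnij _ (φ.map_source hx)] at h3
    rw [← hST x hx (nij J x u v), h3, map_zero]
  · filter_upwards [hsrc] with x hx
    obtain ⟨ev, hev⟩ := hJd p hφ.mem_source
    obtain ⟨ev', hev'⟩ := hJd x hx
    exact hev.sameJordanType hev'
  · filter_upwards [hsrc] with x hx μ
    obtain ⟨ev, hev⟩ := hJd x hx
    exact hev.kerDim_le hd μ

theorem contDiffAt_of_coordRange {i : Fin 3} {g : ℝ → ℝ} (hg : ContDiffOn ℝ ∞ g (coordRange φ i))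
    {y : E3} (hy : y ∈ φ.target) : ContDiffAt ℝ ∞ g (y i) := by
  have ho : IsOpen (coordRange φ i) := isOpenMap_eval i _ φ.open_target
  exact hg.contDiffAt (ho.mem_nhds ⟨y, hy, rfl⟩)

theorem hasFDerivAt_comp_eval {g : ℝ → ℝ} {i : Fin 3} {y : E3} (hg : DifferentiableAt ℝ g (y i)) :
    HasFDerivAt (fun y : E3 => g (y i))
      (deriv g (y i) • (ContinuousLinearMap.proj i : E3 →L[ℝ] ℝ)) y :=
  hg.hasDerivAt.comp_hasFDerivAt y (ContinuousLinearMap.proj i : E3 →L[ℝ] ℝ).hasFDerivAt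

end MatrixFields

/-! ### The four forms are stable, non-degenerate and Nijenhuis. -/

section Converse

variable {J : OperatorField} {p : E3}

theorem nij_matCLM {M : E3 → Matrix (Fin 3) (Fin 3) ℝ} {M' : Fin 3 → Fin 3 → E3 →L[ℝ] ℝ} {y : E3}
    (h : ∀ i j, HasFDerivAt (fun y => M y i j) (M' i j) y) (u v : E3) :
    nij (fun y => matCLM (M y)) y u v
      = fun i => ∑ j, M' i j (M y *ᵥ u) * v j - ∑ j, M' i j (M y *ᵥ v) * u j
        - ∑ k, M y i k * ∑ j, M' k j u * v j + ∑ k, M y i k * ∑ j, M' k j v * u j := by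
  simp only [nij, (hasFDerivAt_matCLM h).2, matCLM_apply]
  rfl

theorem isNijenhuisAt_of_hasFormA (hJ : SmoothAt J p) (h : HasFormA J p) :
    IsNijenhuisAt J p ∧ IsStableAt J p ∧ IsNondegenerateAt J p := by
  obtain ⟨φ, l₁, l₂, l₃, hφ, h₁, h₂, h₃, hne, hM⟩ := h
  have hder : ∀ y ∈ φ.target, ∀ i j, HasFDerivAt
      (fun y : E3 => (!![l₁ (y 0), 0, 0; 0, l₂ (y 1), 0; 0, 0, l₃ (y 2)] : Matrix (Fin 3) (Fin 3) ℝ) i j)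
      ((!![deriv l₁ (y 0) • ContinuousLinearMap.proj 0, 0, 0;
        0, deriv l₂ (y 1) • ContinuousLinearMap.proj 1, 0;
        0, 0, deriv l₃ (y 2) • ContinuousLinearMap.proj 2] : Matrix (Fin 3) (Fin 3) (E3 →L[ℝ] ℝ)) i j)
      y := fun y hy i j => by
    have e₁ := hasFDerivAt_comp_eval (contDiffAt_of_coordRange h₁ hy).diffAt
    have e₂ := hasFDerivAt_comp_eval (contDiffAt_of_coordRange h₂ hy).diffAt
    have e₃ := hasFDerivAt_comp_eval (contDiffAt_of_coordRange h₃ hy).diffAt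
    fin_cases i <;> fin_cases j
    exacts [e₁, hasFDerivAt_const _ _, hasFDerivAt_const _ _, hasFDerivAt_const _ _, e₂,
      hasFDerivAt_const _ _, hasFDerivAt_const _ _, hasFDerivAt_const _ _, e₃]
  refine isNijenhuisAt_of_hasMatrixIn (n := 3)
    (d := fun i => powKerDim ((![!![0, 0, 0; 0, 1, 0; 0, 0, 1], !![1, 0, 0; 0, 0, 0; 0, 0, 1],
      !![1, 0, 0; 0, 1, 0; 0, 0, 0]] : Fin 3 → Matrix (Fin 3) (Fin 3) ℂ) i)) hJ hφ hM
    (fun y hy => (hasFDerivAt_matCLM (hder y hy)).1) (fun y hy u v => ?_) (fun i => ?_) fun y hy => ?_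
  · rw [nij_matCLM (hder y hy)]
    funext i
    simp only [Fin.sum_univ_three]
    fin_cases i <;> simp [dotProduct, Fin.sum_univ_three] <;> ring
  · refine powKerDim_one_le (e := Pi.single i 1) fun v hv => ⟨v i, ?_⟩
    have e0 := congrFun hv 0
    have e1 := congrFun hv 1
    have e2 := congrFun hv 2
    ext j
    fin_cases i <;> fin_cases j <;>
      simp_all [Matrix.mulVec, dotProduct, Fin.sum_univ_three]
  · obtain ⟨h12, h13, h23⟩ := hne y hy
    have c12 : (l₁ (y 0) : ℂ) ≠ l₂ (y 1) := by exact_mod_cast h12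
    have c13 : (l₁ (y 0) : ℂ) ≠ l₃ (y 2) := by exact_mod_cast h13
    have c23 : (l₂ (y 1) : ℂ) ≠ l₃ (y 2) := by exact_mod_cast h23
    generalize l₁ (y 0) = a at *
    generalize l₂ (y 1) = b at *
    generalize l₃ (y 2) = c at *
    refine ⟨![(a : ℂ), b, c], hasKerDims_of_factor
      (M := !![(a : ℂ), 0, 0; 0, b, 0; 0, 0, c]) ?_ ?_
      (Q := ![!![1, 0, 0; 0, (b - a : ℂ), 0; 0, 0, c - a], !![(a - b : ℂ), 0, 0; 0, 1, 0; 0, 0, c - b],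
        !![(a - c : ℂ), 0, 0; 0, b - c, 0; 0, 0, 1]]) ?_ ?_ ?_ ?_⟩
    · rw [toMatrix'_matCLM]
      ext i j
      fin_cases i <;> fin_cases j <;> simp
    · intro i j hij
      fin_cases i <;> fin_cases j <;> simp_all
    · intro i
      fin_cases i <;> simp [Matrix.det_fin_three, sub_eq_zero, c12, c13, c23, c12.symm, c13.symm, c23.symm]
    · intro i
      fin_cases i <;> ext i j <;> fin_cases i <;> fin_cases j <;>
        simp [Matrix.mul_apply, Fin.sum_univ_three]
    · intro i
      fin_cases i <;> ext i j <;> fin_cases i <;> fin_cases j <;>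
        simp [Matrix.mul_apply, Fin.sum_univ_three]
    · intro μ hμ
      have m0 := hμ 0
      have m1 := hμ 1
      have m2 := hμ 2
      simp at m0 m1 m2
      simp [Matrix.det_fin_three, sub_eq_zero, Ne.symm m0, Ne.symm m1, Ne.symm m2]

theorem isNijenhuisAt_of_hasFormB (hJ : SmoothAt J p) (h : HasFormB J p) :
    IsNijenhuisAt J p ∧ IsStableAt J p ∧ IsNondegenerateAt J p := by
  obtain ⟨φ, l₂, l₃, hφ, h₂, h₃, hne, hM⟩ := h
  have hder : ∀ y ∈ φ.target, ∀ i j, HasFDerivAt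
      (fun y : E3 => (!![l₂ (y 1), 1, 0; 0, l₂ (y 1), 0; 0, 0, l₃ (y 2)] : Matrix (Fin 3) (Fin 3) ℝ) i j)
      ((!![deriv l₂ (y 1) • ContinuousLinearMap.proj 1, 0, 0;
        0, deriv l₂ (y 1) • ContinuousLinearMap.proj 1, 0;
        0, 0, deriv l₃ (y 2) • ContinuousLinearMap.proj 2] : Matrix (Fin 3) (Fin 3) (E3 →L[ℝ] ℝ)) i j)
      y := fun y hy i j => by
    have e₂ := hasFDerivAt_comp_eval (contDiffAt_of_coordRange h₂ hy).diffAt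
    have e₃ := hasFDerivAt_comp_eval (contDiffAt_of_coordRange h₃ hy).diffAt
    fin_cases i <;> fin_cases j
    exacts [e₂, hasFDerivAt_const _ _, hasFDerivAt_const _ _, hasFDerivAt_const _ _, e₂,
      hasFDerivAt_const _ _, hasFDerivAt_const _ _, hasFDerivAt_const _ _, e₃]
  refine isNijenhuisAt_of_hasMatrixIn (n := 2)
    (d := fun i => powKerDim ((![!![0, 1, 0; 0, 0, 0; 0, 0, 1], !![1, 0, 0; 0, 1, 0; 0, 0, 0]] :
      Fin 2 → Matrix (Fin 3) (Fin 3) ℂ) i)) hJ hφ hM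
    (fun y hy => (hasFDerivAt_matCLM (hder y hy)).1) (fun y hy u v => ?_) (fun i => ?_) fun y hy => ?_
  · rw [nij_matCLM (hder y hy)]
    funext i
    simp only [Fin.sum_univ_three]
    fin_cases i <;> simp [dotProduct, Fin.sum_univ_three] <;> ring
  · refine powKerDim_one_le (e := Pi.single (![0, 2] i) 1) fun v hv => ⟨v (![0, 2] i), ?_⟩
    have e0 := congrFun hv 0
    have e1 := congrFun hv 1
    have e2 := congrFun hv 2
    ext j
    fin_cases i <;> fin_cases j <;>
      simp_all [Matrix.mulVec, dotProduct, Fin.sum_univ_three]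
  · have c23 : (l₂ (y 1) : ℂ) ≠ l₃ (y 2) := by exact_mod_cast hne y hy
    generalize l₂ (y 1) = a at *
    generalize l₃ (y 2) = c at *
    refine ⟨![(a : ℂ), c], hasKerDims_of_factor
      (M := !![(a : ℂ), 1, 0; 0, a, 0; 0, 0, c]) ?_ ?_
      (Q := ![!![1, 0, 0; 0, 1, 0; 0, 0, (c - a : ℂ)], !![(a - c : ℂ), 1, 0; 0, a - c, 0; 0, 0, 1]])
      ?_ ?_ ?_ ?_⟩
    · rw [toMatrix'_matCLM]
      ext i j
      fin_cases i <;> fin_cases j <;> simp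
    · intro i j hij
      fin_cases i <;> fin_cases j <;> simp_all
    · intro i
      fin_cases i <;> simp [Matrix.det_fin_three, sub_eq_zero, c23, c23.symm]
    · intro i
      fin_cases i <;> ext i j <;> fin_cases i <;> fin_cases j <;>
        simp [Matrix.mul_apply, Fin.sum_univ_three]
    · intro i
      fin_cases i <;> ext i j <;> fin_cases i <;> fin_cases j <;>
        simp [Matrix.mul_apply, Fin.sum_univ_three]
    · intro μ hμ
      have m0 := hμ 0
      have m1 := hμ 1
      simp at m0 m1
      simp [Matrix.det_fin_three, sub_eq_zero, Ne.symm m0, Ne.symm m1]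

theorem isNijenhuisAt_of_hasFormC (hJ : SmoothAt J p) (h : HasFormC J p) :
    IsNijenhuisAt J p ∧ IsStableAt J p ∧ IsNondegenerateAt J p := by
  obtain ⟨φ, l, hφ, hl, hM⟩ := h
  have hder : ∀ y ∈ φ.target, ∀ i j, HasFDerivAt
      (fun y : E3 => (!![l (y 2), Real.exp (deriv l (y 2) * y 1), 0; 0, l (y 2), 1; 0, 0, l (y 2)] :
        Matrix (Fin 3) (Fin 3) ℝ) i j)
      ((!![deriv l (y 2) • ContinuousLinearMap.proj 2,
          Real.exp (deriv l (y 2) * y 1) • (deriv l (y 2) • ContinuousLinearMap.proj 1 +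
            y 1 • deriv (deriv l) (y 2) • ContinuousLinearMap.proj 2), 0;
        0, deriv l (y 2) • ContinuousLinearMap.proj 2, 0;
        0, 0, deriv l (y 2) • ContinuousLinearMap.proj 2] : Matrix (Fin 3) (Fin 3) (E3 →L[ℝ] ℝ)) i j)
      y := fun y hy i j => by
    have hly := contDiffAt_of_coordRange hl hy
    have hdl : DifferentiableAt ℝ (deriv l) (y 2) :=
      (hly.fderiv_infty.clm_apply contDiffAt_const).diffAt
    have e₁ := hasFDerivAt_comp_eval hly.diffAt
    have e₂ := ((hasFDerivAt_comp_eval hdl).mul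
      (ContinuousLinearMap.proj 1 : E3 →L[ℝ] ℝ).hasFDerivAt).exp
    fin_cases i <;> fin_cases j
    exacts [e₁, e₂, hasFDerivAt_const _ _, hasFDerivAt_const _ _, e₁,
      hasFDerivAt_const _ _, hasFDerivAt_const _ _, hasFDerivAt_const _ _, e₁]
  refine isNijenhuisAt_of_hasMatrixIn (n := 1)
    (d := fun _ => powKerDim !![0, 1, 0; 0, 0, 1; 0, 0, 0]) hJ hφ hM
    (fun y hy => (hasFDerivAt_matCLM (hder y hy)).1) (fun y hy u v => ?_) (fun i => ?_) fun y hy => ?_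
  · rw [nij_matCLM (hder y hy)]
    funext i
    simp only [Fin.sum_univ_three]
    fin_cases i <;> simp [dotProduct, Fin.sum_univ_three] <;> ring
  · refine powKerDim_one_le (e := Pi.single 0 1) fun v hv => ⟨v 0, ?_⟩
    have e0 := congrFun hv 0
    have e1 := congrFun hv 1
    ext j
    fin_cases j <;> simp_all [Matrix.mulVec, dotProduct, Fin.sum_univ_three]
  · have he : Real.exp (deriv l (y 2) * y 1) ≠ 0 := (Real.exp_pos _).ne'
    generalize Real.exp (deriv l (y 2) * y 1) = e at *
    generalize l (y 2) = a at *
    have hB : HasKerDims (matCLM !![a, 1, 0; 0, a, 1; 0, 0, a]) ![(a : ℂ)]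
        (fun _ : Fin 1 => powKerDim !![0, 1, 0; 0, 0, 1; 0, 0, 0]) := by
      refine hasKerDims_of_factor (M := !![(a : ℂ), 1, 0; 0, a, 1; 0, 0, a]) ?_ ?_
        (Q := fun _ => 1) ?_ ?_ ?_ ?_
      · rw [toMatrix'_matCLM]
        ext i j
        fin_cases i <;> fin_cases j <;> simp
      · exact Function.injective_of_subsingleton _
      · simp
      · simp
      · intro i
        fin_cases i
        ext i j
        fin_cases i <;> fin_cases j <;> simp
      · intro μ hμ
        have m0 := hμ 0
        simp at m0
        simp [Matrix.det_fin_three, sub_eq_zero, Ne.symm m0]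
    -- Conjugation by `diag(e⁻¹, 1, 1)` normalises the exponential entry to `1`, leaving the
    -- standard Jordan block.
    refine ⟨_, hB.of_intertwines (T := matCLM !![e⁻¹, 0, 0; 0, 1, 0; 0, 0, 1])
      (S := matCLM !![e, 0, 0; 0, 1, 0; 0, 0, 1]) ?_ ?_ ?_⟩ <;>
    · intro v
      simp only [matCLM_apply]
      ext i
      fin_cases i <;> simp [Matrix.mulVec, dotProduct, Fin.sum_univ_three, he] <;> field_simp

theorem isNijenhuisAt_of_hasFormD (hJ : SmoothAt J p) (h : HasFormD J p) :
    IsNijenhuisAt J p ∧ IsStableAt J p ∧ IsNondegenerateAt J p := by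
  obtain ⟨φ, Z, l₃, hφ, hZ, h₃, him, hM⟩ := h
  -- Openness upgrades differentiability on the image to complex differentiability at its points.
  have hopen : IsOpen (zCoord '' φ.target) := by
    let T : E3 →L[ℝ] ℂ := (ContinuousLinearMap.proj 0 : E3 →L[ℝ] ℝ).smulRight (1 : ℂ)
      + (ContinuousLinearMap.proj 1 : E3 →L[ℝ] ℝ).smulRight Complex.I
    have hT : zCoord = T := by
      funext y
      apply Complex.ext <;> simp [T, zCoord]
    rw [hT]
    refine T.isOpenMap (fun z => ⟨![z.re, z.im, 0], ?_⟩) _ φ.open_target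
    apply Complex.ext <;> simp [T]
  have hz : ∀ y, HasFDerivAt zCoord ((ContinuousLinearMap.proj 0 : E3 →L[ℝ] ℝ).smulRight (1 : ℂ)
      + (ContinuousLinearMap.proj 1 : E3 →L[ℝ] ℝ).smulRight Complex.I) y := fun y => by
    refine (ContinuousLinearMap.hasFDerivAt _).congr_of_eventuallyEq (Eventually.of_forall fun y => ?_)
    apply Complex.ext <;> simp [zCoord]
  have hder : ∀ y ∈ φ.target, ∀ i j, HasFDerivAt
      (fun y : E3 => (!![(Z (zCoord y)).re, -(Z (zCoord y)).im, 0;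
         (Z (zCoord y)).im, (Z (zCoord y)).re, 0; 0, 0, l₃ (y 2)] : Matrix (Fin 3) (Fin 3) ℝ) i j)
      ((!![(deriv Z (zCoord y)).re • ContinuousLinearMap.proj 0
            - (deriv Z (zCoord y)).im • ContinuousLinearMap.proj 1,
          -((deriv Z (zCoord y)).im • ContinuousLinearMap.proj 0
            + (deriv Z (zCoord y)).re • ContinuousLinearMap.proj 1), 0;
        (deriv Z (zCoord y)).im • ContinuousLinearMap.proj 0
            + (deriv Z (zCoord y)).re • ContinuousLinearMap.proj 1,
          (deriv Z (zCoord y)).re • ContinuousLinearMap.proj 0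
            - (deriv Z (zCoord y)).im • ContinuousLinearMap.proj 1, 0;
        0, 0, deriv l₃ (y 2) • ContinuousLinearMap.proj 2] : Matrix (Fin 3) (Fin 3) (E3 →L[ℝ] ℝ)) i j)
      y := fun y hy i j => by
    have hZd : DifferentiableAt ℂ Z (zCoord y) := hZ.differentiableAt (hopen.mem_nhds ⟨y, hy, rfl⟩)
    have h1 := (hZd.hasDerivAt.complexToReal_fderiv).comp y (hz y)
    have e₁ : HasFDerivAt (fun y => (Z (zCoord y)).re) ((deriv Z (zCoord y)).re •
        ContinuousLinearMap.proj 0 - (deriv Z (zCoord y)).im • ContinuousLinearMap.proj 1 :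
        E3 →L[ℝ] ℝ) y := by
      refine (Complex.reCLM.hasFDerivAt.comp y h1).congr_fderiv ?_
      ext1 v
      simp
      ring
    have e₂ : HasFDerivAt (fun y => (Z (zCoord y)).im) ((deriv Z (zCoord y)).im •
        ContinuousLinearMap.proj 0 + (deriv Z (zCoord y)).re • ContinuousLinearMap.proj 1 :
        E3 →L[ℝ] ℝ) y := by
      refine (Complex.imCLM.hasFDerivAt.comp y h1).congr_fderiv ?_
      ext1 v
      simp
    have e₃ := hasFDerivAt_comp_eval (contDiffAt_of_coordRange h₃ hy).diffAt
    fin_cases i <;> fin_cases j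
    exacts [e₁, e₂.neg, hasFDerivAt_const _ _, e₂, e₁,
      hasFDerivAt_const _ _, hasFDerivAt_const _ _, hasFDerivAt_const _ _, e₃]
  have hI := Complex.I_mul_I
  -- On the upper block `M - (a ± ib)` is `b` times a constant matrix, which explains the first two
  -- matrices here; the Cauchy–Riemann equations are built into `hder`.
  refine isNijenhuisAt_of_hasMatrixIn (n := 3)
    (d := fun i => powKerDim ((![!![-Complex.I, -1, 0; 1, -Complex.I, 0; 0, 0, 1],
      !![Complex.I, -1, 0; 1, Complex.I, 0; 0, 0, 1],
      !![1, 0, 0; 0, 1, 0; 0, 0, 0]] : Fin 3 → Matrix (Fin 3) (Fin 3) ℂ) i)) hJ hφ hM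
    (fun y hy => (hasFDerivAt_matCLM (hder y hy)).1) (fun y hy u v => ?_) (fun i => ?_) fun y hy => ?_
  · rw [nij_matCLM (hder y hy)]
    funext i
    simp only [Fin.sum_univ_three]
    fin_cases i <;> simp [dotProduct, Fin.sum_univ_three] <;> ring
  · refine powKerDim_one_le (e := (![![Complex.I, 1, 0], ![-Complex.I, 1, 0], ![0, 0, 1]] :
      Fin 3 → Fin 3 → ℂ) i) fun v hv => ⟨v ((![1, 1, 2] : Fin 3 → Fin 3) i), ?_⟩
    have e0 := congrFun hv 0
    have e1 := congrFun hv 1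
    have e2 := congrFun hv 2
    ext j
    fin_cases i <;> simp [Matrix.mulVec, dotProduct, Fin.sum_univ_three] at e0 e1 e2 <;>
      fin_cases j <;> simp [e0, e1, e2] <;> linear_combination e1
  · have hb := him y hy
    have hb' : ((Z (zCoord y)).im : ℂ) ≠ 0 := Complex.ofReal_ne_zero.2 hb
    generalize (Z (zCoord y)).im = b at *
    generalize (Z (zCoord y)).re = a at *
    generalize l₃ (y 2) = c at *
    have k1 : (c : ℂ) ≠ a + b * Complex.I := fun h => hb (by simpa using (congrArg Complex.im h).symm)
    have k2 : (c : ℂ) ≠ a - b * Complex.I := fun h => hb (by simpa using congrArg Complex.im h)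
    have k3 : (a + b * Complex.I : ℂ) ≠ a - b * Complex.I := fun h => hb (by
      have := congrArg Complex.im h
      simp at this
      linarith)
    refine ⟨![(a + b * Complex.I : ℂ), a - b * Complex.I, c], hasKerDims_of_factor
      (M := !![(a : ℂ), -b, 0; b, a, 0; 0, 0, c]) ?_ ?_
      (Q := ![!![(b : ℂ), 0, 0; 0, b, 0; 0, 0, c - (a + b * Complex.I)],
        !![(b : ℂ), 0, 0; 0, b, 0; 0, 0, c - (a - b * Complex.I)],
        !![(a - c : ℂ), -b, 0; b, a - c, 0; 0, 0, 1]]) ?_ ?_ ?_ ?_⟩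
    · rw [toMatrix'_matCLM]
      ext i j
      fin_cases i <;> fin_cases j <;> simp
    · intro i j hij
      fin_cases i <;> fin_cases j <;> simp_all
    · have hprod : (a - c) * (a - c) + b * b ≠ (0 : ℂ) := by
        have : (a - c) * (a - c) + b * b = ((c : ℂ) - (a + b * Complex.I)) * (c - (a - b * Complex.I)) := by
          linear_combination (b : ℂ) * b * hI
        rw [this]
        exact mul_ne_zero (sub_ne_zero.2 k1) (sub_ne_zero.2 k2)
      intro i
      fin_cases i
      · simp [Matrix.det_fin_three, hb, sub_eq_zero, k1]
      · simp [Matrix.det_fin_three, hb, sub_eq_zero, k2]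
      · simpa [Matrix.det_fin_three] using hprod
    · intro i
      fin_cases i <;> ext i j <;> fin_cases i <;> fin_cases j <;>
        simp [Matrix.mul_apply, Fin.sum_univ_three, mul_comm]
    · intro i
      fin_cases i <;> ext i j <;> fin_cases i <;> fin_cases j <;>
        simp [Matrix.mul_apply, Fin.sum_univ_three]
    · intro μ hμ
      have m0 := hμ 0
      have m1 := hμ 1
      have m2 := hμ 2
      simp at m0 m1 m2
      have : (!![(a : ℂ), -b, 0; b, a, 0; 0, 0, c] - μ • 1).det
          = (μ - (a + b * Complex.I)) * (μ - (a - b * Complex.I)) * (c - μ) := by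
        simp [Matrix.det_fin_three]
        linear_combination (b : ℂ) * b * (c - μ) * hI
      rw [this]
      exact mul_ne_zero (mul_ne_zero (sub_ne_zero.2 m0) (sub_ne_zero.2 m1)) (sub_ne_zero.2 (Ne.symm m2))

end Converse
end NijenhuisGerm

theorem mainTheorem3 (J : NijenhuisGerm.OperatorField) (p : NijenhuisGerm.E3)
    (hJ : NijenhuisGerm.SmoothAt J p) :
    (NijenhuisGerm.IsNijenhuisAt J p ∧ NijenhuisGerm.IsStableAt J p ∧
        NijenhuisGerm.IsNondegenerateAt J p) ↔
      (NijenhuisGerm.HasFormA J p ∨ NijenhuisGerm.HasFormB J p ∨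
        NijenhuisGerm.HasFormC J p ∨ NijenhuisGerm.HasFormD J p) := by
  constructor
  · rintro ⟨hN, hS, hD⟩
    exact NijenhuisGerm.hasForm_of_isNijenhuisAt hJ hN hS hD
  · rintro (h | h | h | h)
    · exact NijenhuisGerm.isNijenhuisAt_of_hasFormA hJ h
    · exact NijenhuisGerm.isNijenhuisAt_of_hasFormB hJ h
    · exact NijenhuisGerm.isNijenhuisAt_of_hasFormC hJ h
    · exact NijenhuisGerm.isNijenhuisAt_of_hasFormD hJ h
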